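/- **Proposition p1.1 (well-posedness).** Let $\alpha\in\mathbb R$ with $\alpha<-d/2$ and let $m_0,\nu_0>0$. Let $H^{0,\alpha}$ be the space of real functions on $\mathbb R^d$ with $\|\pi\|_{0,\alpha}^2=\int(1+|x|^2)^\alpha|\pi(x)|^2\,dx<\infty$, let $H^{1,\alpha}$ be the space of real functions with weak gradient such that $\|\psi\|_{1,\alpha}^2=\int(1+|x|^2)^\alpha\big(|\psi(x)|^2+|\nabla\psi(x)|^2\big)\,dx<\infty$, and let $L^\alpha$ be the space of $u:\mathbb Z^d\to\mathbb R^n$ with $\|u\|_\alpha^2=\sum_k(1+|k|^2)^\alpha|u(k)|^2<\infty$. Let $\mathcal E=\mathcal E^{0,\alpha}=H^{1,\alpha}\oplus L^\alpha\oplus H^{0,\alpha}\oplus L^\alpha$ be the Hilbert space of vectors $Y=(\psi,u,\pi,v)$ with norm $\|Y\|_{0,\alpha}^2=\|\psi\|_{1,\alpha}^2+\|u\|_\alpha^2+\|\pi\|_{0,\alpha}^2+\|v\|_\alpha^2$. Let $R:\mathbb R^d\to\mathbb R^n$ satisfy the following conditions. * **R1.** $R\in C^\infty(\mathbb R^d)$,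 and $|R(x)|\le\bar R e^{-\varepsilon|x|}$ for some $\varepsilon>0$ and $\bar R<\infty$. * **R2.** For some $\kappa>0$, all $\theta\in[0,2\pi]^d$ and all $X=(\varphi,u)\in H^1(\mathbb T^d;\mathbb C)\oplus\mathbb C^n$, $\mathbb T^d=\mathbb R^d/\mathbb Z^d$, one has $(X,\tilde{\mathcal H}(\theta)X)\ge\kappa^2\big(\|\varphi\|_{H^1(\mathbb T^d)}^2+|u|^2\big)$, where $$(X,\tilde{\mathcal H}(\theta)X)=\int_{\mathbb T^d}\Big(|(i\nabla+\theta)\varphi|^2+m_0^2|\varphi|^2+2\,\mathrm{Re}\big(\overline{\varphi}\,\tilde R_\Pi(\theta,y)\cdot u\big)\Big)dy+\omega_*^2(\theta)|u|^2,$$ $\tilde R_\Pi(\theta,y)=e^{iy\cdot\theta}\sum_{k\in\mathbb Z^d}e^{ik\cdot\theta}R(k+y)$ and $\omega_*^2(\theta)=\sum_{j=1}^d2(1-\cos\theta_j)+\nu_0^2$. Consider the Cauchy problem for the coupled field–crystal system $$\dot\psi=\pi,\qquad \dot u=v,\qquad \dot\pi=(\Delta-m_0^2)\psi-\sum_{k\in\mathbb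 Z^d}u(k,t)\cdot R(x-k),\qquad \dot v(k,t)=(\Delta_L-\nu_0^2)u(k,t)-\int_{\mathbb R^d}R(x-k)\psi(x,t)\,dx,$$ $t\in\mathbb R$, $Y(0)=Y_0$, where $\Delta_Lu(k)=\sum_{|e|=1}(u(k+e)-u(k))$; the equations for $\psi$ and $\pi$ are understood in the sense of distributions in $x$ (after pairing with any test function in $C_0^\infty(\mathbb R^d)$ they hold for every $t$). (i) For every $Y_0\in\mathcal E$ there is a unique solution $Y\in C(\mathbb R,\mathcal E)$ of the Cauchy problem. (ii) The operator $W(t):Y_0\mapsto Y(t)$ is continuous on $\mathcal E$ for every $t\in\mathbb R$. If $\alpha$ is an even integer and $\alpha\le-2$, then for every $T>0$ there is a constant $C(T)$ such that $\sup_{|t|\le T}\|W(t)Y_0\|_{0,\alpha}\le C(T)\|Y_0\|_{0,\alpha}$ for all $Y_0\in\mathcal E$. -/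

import Mathlib

open MeasureTheory

open scoped ENNReal ContDiff Laplacian

noncomputable section

namespace FieldCrystal

/-- The Euclidean space `ℝ^d`. -/
abbrev Space (d : ℕ) : Type := EuclideanSpace ℝ (Fin d)

/-- The lattice `ℤ^d`. -/
abbrev Lattice (d : ℕ) : Type := Fin d → ℤ

/-- The lattice point `k ∈ ℤ^d` as a point of `ℝ^d`. -/
def toSpace {d : ℕ} (k : Lattice d) : Space d := WithLp.toLp 2 fun j => (k j : ℝ)

/-- The `j`-th coordinate vector of `ℝ^d`. -/
def basisVec {d : ℕ} (j : Fin d) : Space d := EuclideanSpace.single j 1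

/-- The weight `(1 + |x|²)^α`. -/
def weight {d : ℕ} (α : ℝ) (x : Space d) : ℝ := (1 + ‖x‖ ^ 2) ^ α

theorem weight_pos {d : ℕ} (α : ℝ) (x : Space d) : 0 < weight α x :=
  Real.rpow_pos_of_pos (by positivity) α

theorem continuous_weight {d : ℕ} (α : ℝ) : Continuous (weight (d := d) α) :=
  (continuous_const.add (continuous_norm.pow 2)).rpow_const
    fun x => Or.inl (show (1 : ℝ) + ‖x‖ ^ 2 ≠ 0 by positivity)

/-- The measure `(1 + |x|²)^α dx` on `ℝ^d`. -/
def fieldMeasure (d : ℕ) (α : ℝ) : Measure (Space d) :=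
  volume.withDensity fun x => ENNReal.ofReal (weight α x)

/-- The measure on `ℤ^d` that gives the point `k` the mass `(1 + |k|²)^α`. -/
def latticeMeasure (d : ℕ) (α : ℝ) : Measure (Lattice d) :=
  Measure.count.withDensity fun k => ENNReal.ofReal (weight α (toSpace k))

/-- `H^{0,α}(ℝ^d)`: real functions with `‖ψ‖² = ∫ (1 + |x|²)^α |ψ(x)|² dx < ∞`. -/
abbrev H0 (d : ℕ) (α : ℝ) : Type := Lp ℝ 2 (fieldMeasure d α)

/-- Vector fields `g : ℝ^d → ℝ^d` with `∫ (1 + |x|²)^α |g(x)|² dx < ∞`. -/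
abbrev H0Vec (d : ℕ) (α : ℝ) : Type := Lp (Space d) 2 (fieldMeasure d α)

/-- `L^α`: functions `u : ℤ^d → ℝ^n` with `‖u‖² = ∑ (1 + |k|²)^α |u(k)|² < ∞`.
Every point of `ℤ^d` has positive mass, so the values `u k` are well defined. -/
abbrev LatticeSpace (d n : ℕ) (α : ℝ) : Type :=
  Lp (EuclideanSpace ℝ (Fin n)) 2 (latticeMeasure d α)

/-- Test functions: `C_0^∞(ℝ^d)`. -/
def IsTest {d : ℕ} (φ : Space d → ℝ) : Prop := ContDiff ℝ ∞ φ ∧ HasCompactSupport φ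

/-- `g` is the weak (distributional) gradient of `ψ` on `ℝ^d`. -/
def IsWeakGradient {d : ℕ} (ψ : Space d → ℝ) (g : Space d → Space d) : Prop :=
  ∀ φ : Space d → ℝ, IsTest φ → ∀ j : Fin d,
    ∫ x, ψ x * fderiv ℝ φ x (basisVec j) = -∫ x, g x j * φ x

theorem fieldMeasure_ae {d : ℕ} {α : ℝ} {p : Space d → Prop}
    (h : ∀ᵐ x ∂(fieldMeasure d α), p x) : ∀ᵐ x, p x := by
  have hm : Measurable fun x : Space d => ENNReal.ofReal (weight α x) :=
    (continuous_weight α).measurable.ennreal_ofReal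
  have h' := (ae_withDensity_iff hm).1 h
  filter_upwards [h'] with x hx
  exact hx (by simpa using weight_pos α x)

instance {d : ℕ} {α : ℝ} : IsLocallyFiniteMeasure (fieldMeasure d α) :=
  IsLocallyFiniteMeasure.withDensity_ofReal (continuous_weight α)

theorem integrable_mul_of_compact {d : ℕ} {α : ℝ} {f : Space d → ℝ}
    (hf : MemLp f 2 (fieldMeasure d α)) {φ : Space d → ℝ} (hφ : Continuous φ)
    (hc : HasCompactSupport φ) : Integrable fun x => f x * φ x := by
  have hq : Continuous fun x => φ x / weight α x :=
    hφ.div (continuous_weight α) fun x => (weight_pos α x).ne'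
  have hqc : HasCompactSupport fun x => φ x / weight α x := by
    simp only [div_eq_mul_inv]
    exact hc.mul_right (f' := fun x => (weight α x)⁻¹)
  have hi : Integrable (fun x => f x * (φ x / weight α x)) (fieldMeasure d α) :=
    hf.integrable_mul (q := 2) (hq.memLp_of_hasCompactSupport hqc)
  have hm : Measurable fun x : Space d => ENNReal.ofReal (weight α x) :=
    (continuous_weight α).measurable.ennreal_ofReal
  refine ((integrable_withDensity_iff_integrable_smul' hm
    (Filter.Eventually.of_forall fun x => ENNReal.ofReal_lt_top)).1 hi).congr
    (Filter.Eventually.of_forall fun x => ?_)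
  have hw := weight_pos α x
  simp only [ENNReal.toReal_ofReal hw.le, smul_eq_mul]
  field_simp

theorem continuous_partial {d : ℕ} {φ : Space d → ℝ} (hφ : IsTest φ) (j : Fin d) :
    Continuous fun x => fderiv ℝ φ x (basisVec j) :=
  (hφ.1.continuous_fderiv (by simp)).clm_apply continuous_const

theorem compact_partial {d : ℕ} {φ : Space d → ℝ} (hφ : IsTest φ) (j : Fin d) :
    HasCompactSupport fun x => fderiv ℝ φ x (basisVec j) :=
  hφ.2.fderiv_apply (𝕜 := ℝ) (basisVec j)

theorem memLp_coord {d : ℕ} {α : ℝ} (g : H0Vec d α) (j : Fin d) :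
    MemLp (fun x => g x j) 2 (fieldMeasure d α) :=
  (EuclideanSpace.proj (𝕜 := ℝ) j : Space d →L[ℝ] ℝ).comp_memLp' (Lp.memLp g)

/-- `H^{1,α}(ℝ^d)`, the weighted Sobolev space, realised as the space of pairs `(ψ, ∇ψ)`
with `ψ` and its weak gradient in the weighted `L²` spaces. Its norm is
`‖ψ‖² = ∫ (1 + |x|²)^α (|ψ(x)|² + |∇ψ(x)|²) dx`. -/
def H1 (d : ℕ) (α : ℝ) : Submodule ℝ (WithLp 2 (H0 d α × H0Vec d α)) where
  carrier := {p | IsWeakGradient p.fst p.snd}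
  zero_mem' := by
    intro φ _ j
    have h1 : ∀ᵐ x, (0 : H0 d α) x = 0 := fieldMeasure_ae (Lp.coeFn_zero ℝ 2 _)
    have h2 : ∀ᵐ x, (0 : H0Vec d α) x = 0 := fieldMeasure_ae (Lp.coeFn_zero (Space d) 2 _)
    have e1 : ∫ x, (0 : H0 d α) x * fderiv ℝ φ x (basisVec j) = 0 :=
      integral_eq_zero_of_ae (by filter_upwards [h1] with x hx; rw [hx]; simp)
    have e2 : ∫ x, (0 : H0Vec d α) x j * φ x = 0 :=
      integral_eq_zero_of_ae (by filter_upwards [h2] with x hx; rw [hx]; simp)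
    change ∫ x, (0 : H0 d α) x * fderiv ℝ φ x (basisVec j) =
      -∫ x, (0 : H0Vec d α) x j * φ x
    rw [e1, e2, neg_zero]
  add_mem' := by
    intro p q hp hq φ hφ j
    have h1 := fieldMeasure_ae (Lp.coeFn_add p.fst q.fst)
    have h2 := fieldMeasure_ae (Lp.coeFn_add p.snd q.snd)
    have e1 : ∫ x, (p.fst + q.fst) x * fderiv ℝ φ x (basisVec j) =
        (∫ x, p.fst x * fderiv ℝ φ x (basisVec j)) +
          ∫ x, q.fst x * fderiv ℝ φ x (basisVec j) := by
      rw [← integral_add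
        (integrable_mul_of_compact (Lp.memLp p.fst) (continuous_partial hφ j)
          (compact_partial hφ j))
        (integrable_mul_of_compact (Lp.memLp q.fst) (continuous_partial hφ j)
          (compact_partial hφ j))]
      refine integral_congr_ae ?_
      filter_upwards [h1] with x hx
      simp only [hx, Pi.add_apply, add_mul]
    have e2 : ∫ x, (p.snd + q.snd) x j * φ x =
        (∫ x, p.snd x j * φ x) + ∫ x, q.snd x j * φ x := by
      rw [← integral_add
        (integrable_mul_of_compact (memLp_coord p.snd j) hφ.1.continuous hφ.2)
        (integrable_mul_of_compact (memLp_coord q.snd j) hφ.1.continuous hφ.2)]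
      refine integral_congr_ae ?_
      filter_upwards [h2] with x hx
      simp only [hx, Pi.add_apply, PiLp.add_apply, add_mul]
    change ∫ x, (p.fst + q.fst) x * fderiv ℝ φ x (basisVec j) =
      -∫ x, (p.snd + q.snd) x j * φ x
    rw [e1, e2, hp φ hφ j, hq φ hφ j]
    ring
  smul_mem' := by
    intro c p hp φ hφ j
    have h1 := fieldMeasure_ae (Lp.coeFn_smul c p.fst)
    have h2 := fieldMeasure_ae (Lp.coeFn_smul c p.snd)
    have e1 : ∫ x, (c • p.fst) x * fderiv ℝ φ x (basisVec j) =
        c * ∫ x, p.fst x * fderiv ℝ φ x (basisVec j) := by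
      rw [← integral_const_mul]
      refine integral_congr_ae ?_
      filter_upwards [h1] with x hx
      simp only [hx, Pi.smul_apply, smul_eq_mul, mul_assoc]
    have e2 : ∫ x, (c • p.snd) x j * φ x = c * ∫ x, p.snd x j * φ x := by
      rw [← integral_const_mul]
      refine integral_congr_ae ?_
      filter_upwards [h2] with x hx
      simp only [hx, Pi.smul_apply, PiLp.smul_apply, smul_eq_mul, mul_assoc]
    change ∫ x, (c • p.fst) x * fderiv ℝ φ x (basisVec j) =
      -∫ x, (c • p.snd) x j * φ x
    rw [e1, e2, hp φ hφ j]
    ring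

/-- The phase space `𝓔 = H^{1,α} ⊕ L^α ⊕ H^{0,α} ⊕ L^α` of vectors `Y = (ψ, u, π, v)`, with
the Hilbert norm `‖Y‖² = ‖ψ‖² + ‖u‖² + ‖π‖² + ‖v‖²`. -/
abbrev PhaseSpace (d n : ℕ) (α : ℝ) : Type :=
  WithLp 2 (WithLp 2 (H1 d α × LatticeSpace d n α) × WithLp 2 (H0 d α × LatticeSpace d n α))

variable {d n : ℕ} {α : ℝ}

/-- The field `ψ`. -/
def fieldOf (Y : PhaseSpace d n α) : Space d → ℝ := (Y.fst.fst : WithLp 2 (H0 d α × H0Vec d α)).fst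

/-- The displacements `u`. -/
def dispOf (Y : PhaseSpace d n α) : Lattice d → EuclideanSpace ℝ (Fin n) := Y.fst.snd

/-- The momentum `π` of the field. -/
def momOf (Y : PhaseSpace d n α) : Space d → ℝ := Y.snd.fst

/-- The velocities `v`. -/
def velOf (Y : PhaseSpace d n α) : Lattice d → EuclideanSpace ℝ (Fin n) := Y.snd.snd

/-- The discrete Laplacian `Δ_L u(k) = ∑_{|e| = 1} (u(k + e) - u(k))`; the unit vectors of
`ℤ^d` are `± e_j`. -/
def latticeLaplacian (u : Lattice d → EuclideanSpace ℝ (Fin n)) (k : Lattice d) :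
    EuclideanSpace ℝ (Fin n) :=
  ∑ j : Fin d, ((u (k + Pi.single j 1) - u k) + (u (k - Pi.single j 1) - u k))

/-- `(S u)(x) = ∑_k R(x - k) · u(k)`. -/
def couplingS (R : Space d → EuclideanSpace ℝ (Fin n))
    (u : Lattice d → EuclideanSpace ℝ (Fin n)) (x : Space d) : ℝ :=
  ∑' k : Lattice d, inner ℝ (R (x - toSpace k)) (u k)

/-- `(S^* ψ)(k) = ∫ R(x - k) ψ(x) dx`. -/
def couplingSAdj (R : Space d → EuclideanSpace ℝ (Fin n)) (ψ : Space d → ℝ) (k : Lattice d) :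
    EuclideanSpace ℝ (Fin n) :=
  ∫ x, ψ x • R (x - toSpace k)

/-- `Y` solves the Cauchy problem
`ψ' = π`, `u' = v`, `π' = (Δ - m₀²) ψ - S u`, `v' = (Δ_L - ν₀²) u - S^* ψ`, `Y(0) = Y₀`,
where the field equations are understood in the sense of distributions on `ℝ^d`. -/
structure IsSolution (R : Space d → EuclideanSpace ℝ (Fin n)) (m₀ ν₀ : ℝ)
    (Y₀ : PhaseSpace d n α) (Y : ℝ → PhaseSpace d n α) : Prop where
  initial : Y 0 = Y₀
  field_eq : ∀ φ : Space d → ℝ, IsTest φ → ∀ t : ℝ,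
    HasDerivAt (fun s => ∫ x, fieldOf (Y s) x * φ x) (∫ x, momOf (Y t) x * φ x) t
  disp_eq : ∀ (k : Lattice d) (t : ℝ),
    HasDerivAt (fun s => dispOf (Y s) k) (velOf (Y t) k) t
  mom_eq : ∀ φ : Space d → ℝ, IsTest φ → ∀ t : ℝ,
    HasDerivAt (fun s => ∫ x, momOf (Y s) x * φ x)
      ((∫ x, fieldOf (Y t) x * (Δ φ x - m₀ ^ 2 * φ x)) -
        ∫ x, couplingS R (dispOf (Y t)) x * φ x) t
  vel_eq : ∀ (k : Lattice d) (t : ℝ),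
    HasDerivAt (fun s => velOf (Y s) k)
      (latticeLaplacian (dispOf (Y t)) k - ν₀ ^ 2 • dispOf (Y t) k -
        couplingSAdj R (fieldOf (Y t)) k) t

/-- Condition R1: `R` is smooth and decays exponentially. -/
def ConditionR1 (R : Space d → EuclideanSpace ℝ (Fin n)) : Prop :=
  ContDiff ℝ ∞ R ∧ ∃ ε > 0, ∃ Rbar : ℝ, ∀ x, ‖R x‖ ≤ Rbar * Real.exp (-ε * ‖x‖)

/-- The unit cell `[0,1]^d`. -/
def unitCell (d : ℕ) : Set (Space d) := {y | ∀ j, y j ∈ Set.Icc (0 : ℝ) 1}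

/-- `ℤ^d`-periodicity, so that `f` is a function on the torus `ℝ^d / ℤ^d`. -/
def IsPeriodic {F : Type*} (f : Space d → F) : Prop :=
  ∀ (k : Lattice d) (y : Space d), f (y + toSpace k) = f y

/-- `φ` belongs to the Sobolev space `H¹` of the torus `ℝ^d / ℤ^d` (complex valued), with weak
gradient `g`. -/
structure IsTorusH1 (φ : Space d → ℂ) (g : Space d → EuclideanSpace ℂ (Fin d)) : Prop where
  periodic : IsPeriodic φ
  periodic_grad : IsPeriodic g
  memLp : MemLp φ 2 (volume.restrict (unitCell d))
  memLp_grad : MemLp g 2 (volume.restrict (unitCell d))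
  weak_grad : ∀ χ : Space d → ℂ, ContDiff ℝ ∞ χ → IsPeriodic χ → ∀ j : Fin d,
    ∫ y in unitCell d, φ y * fderiv ℝ χ y (basisVec j) = -∫ y in unitCell d, g y j * χ y

/-- The Zak transform of the coupling function, componentwise:
`R_Π(θ, y) = e^{i y·θ} ∑_k e^{i k·θ} R(k + y)`. -/
def zakCoupling (R : Space d → EuclideanSpace ℝ (Fin n)) (θ y : Space d) (i : Fin n) : ℂ :=
  Complex.exp (Complex.I * (inner ℝ y θ : ℝ)) *
    ∑' k : Lattice d,
      Complex.exp (Complex.I * (inner ℝ (toSpace k) θ : ℝ)) * (R (toSpace k + y) i : ℂ)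

/-- `ω_*²(θ) = ∑_j 2 (1 - cos θ_j) + ν₀²`. -/
def omegaStarSq (ν₀ : ℝ) (θ : Space d) : ℝ := (∑ j, 2 * (1 - Real.cos (θ j))) + ν₀ ^ 2

/-- The quadratic form `(X, H(θ) X)`, `X = (φ, u)`, of the operator
`H(θ) = [[(i∇ + θ)² + m₀², S(θ)], [S(θ)^*, ω_*²(θ)]]` on the torus, where
`S(θ) u = R_Π(θ, ·) · u`, and `g` is the gradient of `φ`. -/
def blochForm (R : Space d → EuclideanSpace ℝ (Fin n)) (m₀ ν₀ : ℝ) (θ : Space d)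
    (φ : Space d → ℂ) (g : Space d → EuclideanSpace ℂ (Fin d)) (u : EuclideanSpace ℂ (Fin n)) :
    ℝ :=
  (∫ y in unitCell d,
    ((∑ j, ‖Complex.I * g y j + (θ j : ℂ) * φ y‖ ^ 2) + m₀ ^ 2 * ‖φ y‖ ^ 2 +
      2 * ((starRingEnd ℂ) (φ y) * ∑ i, zakCoupling R θ y i * u i).re)) +
    omegaStarSq ν₀ θ * ‖u‖ ^ 2

/-- Condition R2: `H(θ)` is positive definite for `θ ∈ [0, 2π]^d`, that is,
`(X, H(θ) X) ≥ κ² ‖X‖²` with the norm of `H¹ ⊕ ℂ^n` on the right. -/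
def ConditionR2 (R : Space d → EuclideanSpace ℝ (Fin n)) (m₀ ν₀ : ℝ) : Prop :=
  ∃ κ > 0, ∀ θ : Space d, (∀ j, θ j ∈ Set.Icc (0 : ℝ) (2 * Real.pi)) →
    ∀ (φ : Space d → ℂ) (g : Space d → EuclideanSpace ℂ (Fin d)) (u : EuclideanSpace ℂ (Fin n)),
      IsTorusH1 φ g →
        κ ^ 2 * ((∫ y in unitCell d, (‖φ y‖ ^ 2 + ‖g y‖ ^ 2)) + ‖u‖ ^ 2) ≤
          blochForm R m₀ ν₀ θ φ g u

end FieldCrystal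

end

/-! Write the system as `Y' = (A + B) Y`, where `A (ψ, u, π, v) = (π, 0, Δψ, 0)` is the free wave
operator and `B` is bounded: it holds the masses, the coupling, the lattice Laplacian and the term
`v` in `u' = v`. Two facts about `A` suffice: it is quasi-skew, `|⟨AY, Y⟩| ≤ c ‖Y‖²`, and `lam - A`
is onto for all real `lam` with `|lam|` large. Hille–Yosida in both time directions then gives a
flow with `‖Y(t)‖ ≤ exp (c|t|) ‖Y(0)‖`, and a bounded perturbation only enlarges `c`.

Quasi-skewness is the energy identity in the space with weight `w = (1 + |x|²)^α`. The gradient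
terms of `⟨AY, Y⟩` cancel up to `∫ π ∇w·∇ψ`, and `|∇w| ≤ |α| w`. Surjectivity reduces to `lam² ψ -
Δψ = h`, which is solved by Lax–Milgram (`exists_isVarLaplacian`). The delicate point is that the
equations give `Δψ` only as a distribution, while the energy identity tests it against `π ∈
H^{1,α}`. No density of test functions is invoked. `IsDistLaplacian.isVarLaplacian` compares `ψ`
with the variational solution of the same equation: the difference solves `Δf = μf`, its
mollifications grow polynomially, and a maximum principle (`nonpos_of_laplacian_eq`) forces it to
vanish.

`S` and `S^*` are bounded by Schur's test: Peetre's inequality `weight_le` carries the weight across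
the kernel at a polynomial price, which the exponential decay of `R` pays.

The operator enters only through weak equations, a set of pairs `(l, l')` of functionals with `l (A
Y) = l' Y`; its graph is `weakGraph`. For uniqueness, a weak solution `Y` with `Y 0 = 0` is
integrated in time: `Z = ∫ Y` satisfies `A Z = Y = Z'`, so the energy estimate applies to `Z`.
Uniqueness makes `W(t)` additive, and the exponential bound then gives its continuity and the
estimate in (ii). -/

section Evolution

/-! ### Hille–Yosida theorem for dissipative relations on a Hilbert space. -/

open Set Filter Topology

variable {E : Type*} [NormedAddCommGroup E] [InnerProductSpace ℝ E]

/-- A linear relation `Γ` on a Hilbert space, thought of as the graph of an unbounded operator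
`A`, that is quasi-skew with resolvents at all large real `lam` of both signs. -/
structure IsGroupGenerator (Γ : Submodule ℝ (E × E)) (c : ℝ) : Prop where
  abs_inner_le : ∀ p ∈ Γ, |inner ℝ p.2 p.1| ≤ c * ‖p.1‖ ^ 2
  surj : ∃ lam₀ : ℝ, ∀ lam : ℝ, lam₀ < |lam| → ∀ z, ∃ p ∈ Γ, lam • p.1 - p.2 = z
  eq_zero : ∀ y, ((0 : E), y) ∈ Γ → y = 0

/-- A dissipative relation whose resolvents exist at all large positive real numbers. -/
structure IsContractionGenerator (Γ : Submodule ℝ (E × E)) : Prop where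
  inner_le : ∀ p ∈ Γ, inner ℝ p.2 p.1 ≤ 0
  surj : ∃ lam₀ : ℝ, ∀ lam : ℝ, lam₀ < lam → ∀ z, ∃ p ∈ Γ, lam • p.1 - p.2 = z
  eq_zero : ∀ y, ((0 : E), y) ∈ Γ → y = 0

namespace IsContractionGenerator

variable {Γ : Submodule ℝ (E × E)}

/-- Pair `lam • p.1 - p.2` with `p.1`: dissipativity discards the second term, and Cauchy–Schwarz
does the rest. -/
theorem mul_norm_le (h : IsContractionGenerator Γ) (lam : ℝ)
    {p : E × E} (hp : p ∈ Γ) : lam * ‖p.1‖ ≤ ‖lam • p.1 - p.2‖ := by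
  rcases eq_or_ne p.1 0 with h0 | h0
  · simp [h0]
  have h1 : inner ℝ (lam • p.1 - p.2) p.1 ≤ ‖lam • p.1 - p.2‖ * ‖p.1‖ := real_inner_le_norm _ _
  rw [inner_sub_left, real_inner_smul_left, real_inner_self_eq_norm_sq] at h1
  have h2 := h.inner_le p hp
  have h3 : 0 < ‖p.1‖ := norm_pos_iff.2 h0
  nlinarith

/-- Here `J n = n (n - A)⁻¹`, normalised to be a contraction. The two last clauses are `A J = n (J -
1)` and `J (n - A) = n` on the domain. -/
theorem exists_resolvent (h : IsContractionGenerator Γ) :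
    ∃ (N : ℕ) (J : ℕ → E →L[ℝ] E), 0 < N ∧ (∀ n, N ≤ n → ‖J n‖ ≤ 1) ∧
      (∀ n, N ≤ n → ∀ z, (J n z, (n : ℝ) • (J n z - z)) ∈ Γ) ∧
      (∀ n, N ≤ n → ∀ p ∈ Γ, J n ((n : ℝ) • p.1 - p.2) = (n : ℝ) • p.1) := by
  obtain ⟨lam₀, hs⟩ := h.surj
  obtain ⟨N, hN⟩ := exists_nat_gt (max lam₀ 0)
  have hN0 : (0 : ℝ) < N := (le_max_right _ _).trans_lt hN
  have key : ∀ n : ℕ, N ≤ n → ∃ J : E →L[ℝ] E, ‖J‖ ≤ 1 ∧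
      (∀ z, (J z, (n : ℝ) • (J z - z)) ∈ Γ) ∧
      (∀ p ∈ Γ, J ((n : ℝ) • p.1 - p.2) = (n : ℝ) • p.1) := by
    intro n hn
    have hn' : (N : ℝ) ≤ n := by exact_mod_cast hn
    have hn0 : (0 : ℝ) < n := hN0.trans_le hn'
    choose P hP hPz using hs n (((le_max_left _ _).trans_lt hN).trans_le hn')
    have uniq : ∀ p ∈ Γ, ∀ q ∈ Γ, (n : ℝ) • p.1 - p.2 = (n : ℝ) • q.1 - q.2 → p.1 = q.1 := by
      intro p hp q hq hpq
      have := h.mul_norm_le n (Γ.sub_mem hp hq)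
      have e : (n : ℝ) • (p - q).1 - (p - q).2 = 0 := by
        rw [Prod.fst_sub, Prod.snd_sub, smul_sub, ← sub_eq_zero.2 hpq]; abel
      rw [e, norm_zero] at this
      have h3 : ‖(p - q).1‖ ≤ 0 := by
        by_contra hc
        push Not at hc
        nlinarith [mul_pos hn0 hc]
      exact sub_eq_zero.1 (norm_le_zero_iff.1 h3)
    let L : E →ₗ[ℝ] E :=
      { toFun := fun z => (n : ℝ) • (P z).1
        map_add' := by
          intro a b
          rw [← smul_add]
          congr 1
          refine uniq _ (hP _) _ (Γ.add_mem (hP a) (hP b)) ?_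
          rw [hPz, Prod.fst_add, Prod.snd_add, smul_add]
          nth_rewrite 1 [← hPz a, ← hPz b]
          abel
        map_smul' := by
          intro c a
          rw [RingHom.id_apply, smul_comm c]
          congr 1
          refine uniq _ (hP _) _ (Γ.smul_mem c (hP a)) ?_
          rw [hPz, Prod.smul_fst, Prod.smul_snd, smul_comm, ← smul_sub, hPz] }
    refine ⟨L.mkContinuous 1 fun z => ?_, L.mkContinuous_norm_le zero_le_one _, fun z => ?_,
      fun p hp => ?_⟩
    · have := h.mul_norm_le n (hP z)
      rw [hPz] at this
      change ‖(n : ℝ) • (P z).1‖ ≤ 1 * ‖z‖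
      rw [norm_smul, Real.norm_of_nonneg hn0.le, one_mul]
      exact this
    · change ((n : ℝ) • (P z).1, (n : ℝ) • ((n : ℝ) • (P z).1 - z)) ∈ Γ
      have e : (n : ℝ) • (P z).1 - z = (P z).2 := by
        nth_rewrite 2 [← hPz z]; abel
      rw [e]
      exact Γ.smul_mem (n : ℝ) (hP z)
    · change (n : ℝ) • (P _).1 = _
      rw [uniq _ (hP _) p hp (hPz _)]
  choose! J hJ1 hJ2 hJ3 using key
  exact ⟨N, J, by exact_mod_cast hN0, hJ1, hJ2, hJ3⟩

/-- Density is a consequence of the range condition. If `z = lam • p.1 - p.2` is orthogonal to the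
domain, pairing with `p.1` gives `lam ‖p.1‖² ≤ 0`, so `p.1 = 0`; then `p.2 = 0` because the relation
is single-valued at `0`. -/
theorem dense_domain [CompleteSpace E] (h : IsContractionGenerator Γ) (x : E) {ε : ℝ}
    (hε : 0 < ε) : ∃ p ∈ Γ, ‖x - p.1‖ < ε := by
  have ht : (Γ.map (LinearMap.fst ℝ E E)).topologicalClosure = ⊤ := by
    rw [Submodule.topologicalClosure_eq_top_iff, Submodule.eq_bot_iff]
    intro z hz
    obtain ⟨lam₀, hs⟩ := h.surj
    have hl : lam₀ < max lam₀ 0 + 1 := by linarith [le_max_left lam₀ 0]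
    have hl0 : 0 < max lam₀ 0 + 1 := by linarith [le_max_right lam₀ 0]
    obtain ⟨p, hp, rfl⟩ := hs _ hl z
    have h0 := (Submodule.mem_orthogonal' _ _).1 hz p.1 ⟨p, hp, rfl⟩
    rw [inner_sub_left, real_inner_smul_left, real_inner_self_eq_norm_sq] at h0
    have h2 := h.inner_le p hp
    have h3 : ‖p.1‖ ^ 2 ≤ 0 := by
      by_contra hc
      push Not at hc
      nlinarith [mul_pos hl0 hc]
    have h4 : p.1 = 0 := by
      have : ‖p.1‖ = 0 := by nlinarith [norm_nonneg p.1]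
      exact norm_eq_zero.1 this
    have h5 : p.2 = 0 := h.eq_zero _ (by rw [← h4]; exact hp)
    rw [h4, h5]; simp
  have hx : x ∈ closure ((Γ.map (LinearMap.fst ℝ E E) : Submodule ℝ E) : Set E) := by
    have : x ∈ (Γ.map (LinearMap.fst ℝ E E)).topologicalClosure := by rw [ht]; trivial
    exact this
  obtain ⟨_, ⟨p, hp, rfl⟩, hd⟩ := Metric.mem_closure_iff.1 hx ε hε
  exact ⟨p, hp, by rw [← dist_eq_norm]; exact hd⟩

end IsContractionGenerator

section Exponential

variable [CompleteSpace E]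

theorem hasDerivAt_exp_smul_apply (A : E →L[ℝ] E) (x : E) (t : ℝ) :
    HasDerivAt (fun s : ℝ => NormedSpace.exp (s • A) x) (A (NormedSpace.exp (t • A) x)) t := by
  have := (hasDerivAt_exp_smul_const' (𝕂 := ℝ) A t).clm_apply (hasDerivAt_const t x)
  simpa using this

/-- Dissipative bounded operators generate contractions. -/
theorem norm_exp_smul_apply_le {A : E →L[ℝ] E} (hA : ∀ z, inner ℝ (A z) z ≤ 0) (x : E) {t : ℝ}
    (ht : 0 ≤ t) : ‖NormedSpace.exp (t • A) x‖ ≤ ‖x‖ := by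
  have hd : ∀ s : ℝ, HasDerivAt (fun s : ℝ => ‖NormedSpace.exp (s • A) x‖ ^ 2)
      (2 * inner ℝ (NormedSpace.exp (s • A) x) (A (NormedSpace.exp (s • A) x))) s := fun s =>
    (hasDerivAt_exp_smul_apply A x s).norm_sq
  have hanti : Antitone fun s : ℝ => ‖NormedSpace.exp (s • A) x‖ ^ 2 :=
    antitone_of_hasDerivAt_nonpos hd fun s => by
      have := hA (NormedSpace.exp (s • A) x)
      rw [real_inner_comm] at this
      simp only [Pi.zero_apply]
      linarith
  have := hanti ht
  simp only [zero_smul, NormedSpace.exp_zero, one_apply_eq_self] at this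
  exact (sq_le_sq₀ (norm_nonneg _) (norm_nonneg _)).1 this

/-- Interpolate by `s ↦ exp ((t - s) B) exp (s A) x`. As `A` and `B` commute, its derivative is a
product of contractions applied to `A x - B x`. -/
theorem norm_exp_sub_exp_le {A B : E →L[ℝ] E} (hA : ∀ z, inner ℝ (A z) z ≤ 0)
    (hB : ∀ z, inner ℝ (B z) z ≤ 0) (hAB : Commute A B) (x : E) {t : ℝ} (ht : 0 ≤ t) :
    ‖NormedSpace.exp (t • A) x - NormedSpace.exp (t • B) x‖ ≤ ‖A x - B x‖ * t := by
  have hd : ∀ s : ℝ, HasDerivAt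
      (fun s : ℝ => NormedSpace.exp ((t - s) • B) (NormedSpace.exp (s • A) x))
      (NormedSpace.exp ((t - s) • B) (NormedSpace.exp (s • A) (A x - B x))) s := by
    intro s
    have h1 : HasDerivAt (fun s : ℝ => NormedSpace.exp ((t - s) • B))
        (-(NormedSpace.exp ((t - s) • B) * B)) s := by
      have := (hasDerivAt_exp_smul_const (𝕂 := ℝ) B (t - s)).scomp s
        ((hasDerivAt_const s t).sub (hasDerivAt_id s))
      simpa [Function.comp_def] using this
    have h2 : HasDerivAt (fun s : ℝ => NormedSpace.exp (s • A) x)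
        (NormedSpace.exp (s • A) (A x)) s := by
      have := (hasDerivAt_exp_smul_const (𝕂 := ℝ) A s).clm_apply (hasDerivAt_const s x)
      simpa using this
    have h3 := h1.clm_apply h2
    convert h3 using 1
    have hc : Commute B (NormedSpace.exp (s • A)) := (hAB.symm.smul_right s).exp_right
    have hcx : B (NormedSpace.exp (s • A) x) = NormedSpace.exp (s • A) (B x) :=
      congrArg (fun T : E →L[ℝ] E => T x) hc.eq
    change _ = -(NormedSpace.exp ((t - s) • B) (B (NormedSpace.exp (s • A) x))) + _
    rw [hcx, map_sub, map_sub]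
    abel
  have hb : ∀ s ∈ Icc (0 : ℝ) t,
      ‖NormedSpace.exp ((t - s) • B) (NormedSpace.exp (s • A) (A x - B x))‖ ≤ ‖A x - B x‖ :=
    fun s hs => (norm_exp_smul_apply_le hB _ (sub_nonneg.2 hs.2)).trans
      (norm_exp_smul_apply_le hA _ hs.1)
  have := (convex_Icc (0 : ℝ) t).norm_image_sub_le_of_norm_hasDerivWithin_le
    (fun s _ => (hd s).hasDerivWithinAt) hb (left_mem_Icc.2 ht) (right_mem_Icc.2 ht)
  simpa [abs_of_nonneg ht] using this

end Exponential

/-- The forward flow of a dissipative relation, as a mild solution tested against every pair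
`(l, l')` of functionals with `l (A x) = l' x`. -/
theorem IsContractionGenerator.exists_flow [CompleteSpace E] {Γ : Submodule ℝ (E × E)}
    (h : IsContractionGenerator Γ) (x : E) :
    ∃ S : ℝ → E, Continuous S ∧ S 0 = x ∧ (∀ t, 0 ≤ t → ‖S t‖ ≤ ‖x‖) ∧
      ∀ l l' : E →L[ℝ] ℝ, (∀ p ∈ Γ, l p.2 = l' p.1) → ∀ t, 0 ≤ t →
        l (S t) = l x + ∫ s in (0 : ℝ)..t, l' (S s) := by
  obtain ⟨N, J, hN0, hJ1, hJ2, hJ3⟩ := h.exists_resolvent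
  have hnpos : ∀ n, N ≤ n → (0 : ℝ) < n := fun n hn => by exact_mod_cast hN0.trans_le hn
  -- Yosida approximants `A n = A J n`, bounded and dissipative.
  set A : ℕ → E →L[ℝ] E := fun n => (n : ℝ) • (J n - 1) with hAdef
  have hAapp : ∀ n z, A n z = (n : ℝ) • (J n z - z) := fun n z => by simp [hAdef]
  have hAdiss : ∀ n, N ≤ n → ∀ z, inner ℝ (A n z) z ≤ 0 := by
    intro n hn z
    rw [hAapp, real_inner_smul_left, inner_sub_left, real_inner_self_eq_norm_sq]
    have h1 : inner ℝ (J n z) z ≤ ‖z‖ ^ 2 := by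
      calc inner ℝ (J n z) z ≤ ‖J n z‖ * ‖z‖ := real_inner_le_norm _ _
        _ ≤ (1 * ‖z‖) * ‖z‖ := by gcongr; exact (J n).le_of_opNorm_le (hJ1 n hn) z
        _ = ‖z‖ ^ 2 := by ring
    exact mul_nonpos_of_nonneg_of_nonpos (hnpos n hn).le (by linarith)
  have hJcomm : ∀ n m, N ≤ n → N ≤ m → Commute (J n) (J m) := by
    -- The resolvent identity, obtained by feeding the graph point of `J m z` to the left inverse `J
    -- n`. Its two instances, with `n` and `m` exchanged, force commutation.
    have key : ∀ n m, N ≤ n → N ≤ m → ∀ z,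
        (n : ℝ) • J m z = (m : ℝ) • J n z + ((n : ℝ) - m) • J n (J m z) := by
      intro n m hn hm z
      have := hJ3 n hn _ (hJ2 m hm z)
      simp only [map_sub, map_smul] at this
      rw [← this]
      module
    intro n m hn hm
    rcases eq_or_ne n m with rfl | hne
    · exact Commute.refl _
    ext z
    change J n (J m z) = J m (J n z)
    have h1 := key n m hn hm z
    have h2 := key m n hm hn z
    rw [h2] at h1
    have hne' : (n : ℝ) - m ≠ 0 := sub_ne_zero.2 (by exact_mod_cast hne)
    have h3 : ((n : ℝ) - m) • (J n (J m z) - J m (J n z)) = 0 := by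
      have h4 : (n : ℝ) • J m z - ((n : ℝ) • J m z + ((m : ℝ) - n) • J m (J n z) +
          ((n : ℝ) - m) • J n (J m z)) = 0 := sub_eq_zero.2 h1
      rw [← neg_eq_zero, ← h4]
      module
    exact sub_eq_zero.1 ((smul_eq_zero.1 h3).resolve_left hne')
  have hAcomm : ∀ n m, N ≤ n → N ≤ m → Commute (A n) (A m) := fun n m hn hm =>
    (((hJcomm n m hn hm).sub_left (Commute.one_left _)).sub_right
      (Commute.one_right _)).smul_left _ |>.smul_right _
  -- the resolvents converge strongly to the identity
  have hJdom : ∀ n, N ≤ n → ∀ p ∈ Γ, J n p.1 - p.1 = (n : ℝ)⁻¹ • J n p.2 := by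
    intro n hn p hp
    have := hJ3 n hn p hp
    rw [map_sub, map_smul, sub_eq_iff_eq_add, ← sub_eq_iff_eq_add', ← smul_sub] at this
    rw [← this, inv_smul_smul₀ (hnpos n hn).ne']
  have hAdom : ∀ n, N ≤ n → ∀ p ∈ Γ, A n p.1 = J n p.2 := by
    intro n hn p hp
    rw [hAapp, hJdom n hn p hp, smul_inv_smul₀ (hnpos n hn).ne']
  have hJlim : ∀ z, Tendsto (fun n => J n z) atTop (𝓝 z) := by
    intro z
    rw [Metric.tendsto_atTop]
    intro ε hε
    obtain ⟨p, hp, hpz⟩ := h.dense_domain z (ε := ε / 3) (by positivity)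
    obtain ⟨K, hK⟩ := exists_nat_gt (‖p.2‖ / (ε / 3))
    refine ⟨max N K, fun n hn => ?_⟩
    have hnN : N ≤ n := (le_max_left _ _).trans hn
    have hnK : (K : ℝ) ≤ n := by exact_mod_cast (le_max_right _ _).trans hn
    have e : J n z - z = J n (z - p.1) + (J n p.1 - p.1) - (z - p.1) := by
      rw [map_sub]; abel
    have e1 : ‖J n (z - p.1)‖ ≤ ‖z - p.1‖ := by
      simpa using (J n).le_of_opNorm_le (hJ1 n hnN) (z - p.1)
    have e2 : ‖J n p.1 - p.1‖ < ε / 3 := by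
      rw [hJdom n hnN p hp, norm_smul, norm_inv, Real.norm_of_nonneg (hnpos n hnN).le,
        inv_mul_lt_iff₀ (hnpos n hnN)]
      have : ‖J n p.2‖ ≤ ‖p.2‖ := by simpa using (J n).le_of_opNorm_le (hJ1 n hnN) p.2
      rw [div_lt_iff₀ (by positivity)] at hK
      nlinarith
    rw [dist_eq_norm, e]
    calc _ ≤ ‖J n (z - p.1)‖ + ‖J n p.1 - p.1‖ + ‖z - p.1‖ :=
          (norm_sub_le _ _).trans (by gcongr; exact norm_add_le _ _)
      _ < ε := by linarith
  -- the approximating flows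
  set F : ℕ → ℝ → E := fun n t => NormedSpace.exp (max t 0 • A n) x with hFdef
  have hFcont : ∀ n, Continuous (F n) := fun n => by
    have : Continuous fun s : ℝ => NormedSpace.exp (s • A n) x :=
      continuous_iff_continuousAt.2 fun s => (hasDerivAt_exp_smul_apply (A n) x s).continuousAt
    exact this.comp (continuous_id.max continuous_const)
  have hFnorm : ∀ n, N ≤ n → ∀ t, ‖F n t‖ ≤ ‖x‖ := fun n hn t =>
    norm_exp_smul_apply_le (hAdiss n hn) x (le_max_right _ _)
  have hFcauchy : ∀ T : ℝ, UniformCauchySeqOn F atTop (Iic T) := by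
    intro T
    rw [Metric.uniformCauchySeqOn_iff]
    intro ε hε
    obtain ⟨p, hp, hpx⟩ := h.dense_domain x (ε := ε / 3) (by positivity)
    have hc := (hJlim p.2).cauchySeq
    rw [Metric.cauchySeq_iff] at hc
    obtain ⟨K, hK⟩ := hc (ε / 3 / (max T 0 + 1)) (by positivity)
    refine ⟨max N K, fun m hm n hn t ht => ?_⟩
    have hnN : N ≤ n := (le_max_left _ _).trans hn
    have hmN : N ≤ m := (le_max_left _ _).trans hm
    have hmn := hK m ((le_max_right _ _).trans hm) n ((le_max_right _ _).trans hn)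
    rw [dist_eq_norm] at hmn ⊢
    have ht0 : (0 : ℝ) ≤ max t 0 := le_max_right _ _
    -- Replace `x` by a nearby domain point `p.1`, where `A n p.1 = J n p.2` converges; the two
    -- replacement errors are controlled by contractivity.
    have e : F m t - F n t = NormedSpace.exp (max t 0 • A m) (x - p.1) +
        (NormedSpace.exp (max t 0 • A m) p.1 - NormedSpace.exp (max t 0 • A n) p.1) -
        NormedSpace.exp (max t 0 • A n) (x - p.1) := by
      simp only [hFdef, map_sub]; abel
    have e1 := norm_exp_smul_apply_le (hAdiss m hmN) (x - p.1) ht0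
    have e2 := norm_exp_smul_apply_le (hAdiss n hnN) (x - p.1) ht0
    have e3 := norm_exp_sub_exp_le (hAdiss m hmN) (hAdiss n hnN) (hAcomm m n hmN hnN) p.1 ht0
    rw [hAdom m hmN p hp, hAdom n hnN p hp] at e3
    have e4 : ‖J m p.2 - J n p.2‖ * max t 0 ≤ ε / 3 := by
      rw [lt_div_iff₀ (by positivity)] at hmn
      have : max t 0 ≤ max T 0 + 1 := by
        have : max t 0 ≤ max T 0 := max_le_max_right 0 ht
        linarith
      nlinarith [norm_nonneg (J m p.2 - J n p.2)]
    rw [e]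
    calc _ ≤ ‖NormedSpace.exp (max t 0 • A m) (x - p.1)‖ +
        ‖NormedSpace.exp (max t 0 • A m) p.1 - NormedSpace.exp (max t 0 • A n) p.1‖ +
        ‖NormedSpace.exp (max t 0 • A n) (x - p.1)‖ :=
          (norm_sub_le _ _).trans (by gcongr; exact norm_add_le _ _)
      _ < ε := by linarith
  have hlim : ∀ t, ∃ y, Tendsto (fun n => F n t) atTop (𝓝 y) := fun t =>
    cauchySeq_tendsto_of_complete ((hFcauchy t).cauchySeq (self_mem_Iic))
  choose S hS using hlim
  have hunif : ∀ T, TendstoUniformlyOn F S atTop (Iic T) := fun T =>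
    (hFcauchy T).tendstoUniformlyOn_of_tendsto fun t _ => hS t
  have hScont : Continuous S := by
    rw [continuous_iff_continuousAt]
    intro t
    exact ((hunif (t + 1)).continuousOn
      (Frequently.of_forall fun n => (hFcont n).continuousOn)).continuousAt
      (Iic_mem_nhds (by linarith))
  have hSnorm : ∀ t, ‖S t‖ ≤ ‖x‖ := fun t =>
    le_of_tendsto (hS t).norm (eventually_atTop.2 ⟨N, fun n hn => hFnorm n hn t⟩)
  refine ⟨S, hScont, ?_, fun t _ => hSnorm t, ?_⟩
  · refine tendsto_nhds_unique (hS 0) ?_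
    simp [hFdef]
  · intro l l' hl t ht
    have hJF : ∀ s, Tendsto (fun n => J n (F n s)) atTop (𝓝 (S s)) := by
      intro s
      have h1 : Tendsto (fun n => J n (F n s - S s)) atTop (𝓝 0) := by
        refine squeeze_zero_norm' (a := fun n => ‖F n s - S s‖)
          (eventually_atTop.2 ⟨N, fun n hn => ?_⟩) ?_
        · simpa using (J n).le_of_opNorm_le (hJ1 n hn) (F n s - S s)
        · have := ((hS s).sub_const (S s)).norm
          simpa using this
      have := h1.add (hJlim (S s))
      simpa using this
    -- Since `(J n z, A n z)` lies in the graph, `l (A n z) = l' (J n z)`: the unbounded operator is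
    -- traded for `l'` before the limit is taken.
    have hinteg : ∀ n, N ≤ n → ∫ s in (0 : ℝ)..t, l' (J n (F n s)) = l (F n t) - l x := by
      intro n hn
      have hcongr : ∫ s in (0 : ℝ)..t, l' (J n (F n s)) =
          ∫ s in (0 : ℝ)..t, l' (J n (NormedSpace.exp (s • A n) x)) := by
        refine intervalIntegral.integral_congr fun s hs => ?_
        rw [uIcc_of_le ht] at hs
        simp only [hFdef, max_eq_left hs.1]
      rw [hcongr, intervalIntegral.integral_eq_sub_of_hasDerivAt
        (f := fun s => l (NormedSpace.exp (s • A n) x))]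
      · simp [hFdef, max_eq_left ht]
      · intro s _
        have h1 := l.hasFDerivAt.comp_hasDerivAt s (hasDerivAt_exp_smul_apply (A n) x s)
        have h2 : l (A n (NormedSpace.exp (s • A n) x)) =
            l' (J n (NormedSpace.exp (s • A n) x)) := by
          rw [hAapp]
          exact hl _ (hJ2 n hn _)
        rw [h2] at h1
        exact h1
      · refine Continuous.intervalIntegrable ?_ _ _
        have : Continuous fun s : ℝ => NormedSpace.exp (s • A n) x :=
          continuous_iff_continuousAt.2 fun s =>
            (hasDerivAt_exp_smul_apply (A n) x s).continuousAt
        fun_prop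
    have hlim1 : Tendsto (fun n => ∫ s in (0 : ℝ)..t, l' (J n (F n s))) atTop
        (𝓝 (∫ s in (0 : ℝ)..t, l' (S s))) := by
      refine intervalIntegral.tendsto_integral_filter_of_dominated_convergence
        (fun _ => ‖l'‖ * ‖x‖) (Eventually.of_forall fun n => ?_)
        (eventually_atTop.2 ⟨N, fun n hn => Eventually.of_forall fun s _ => ?_⟩) ?_
        (Eventually.of_forall fun s _ => (l'.continuous.tendsto _).comp (hJF s))
      · exact (l'.continuous.comp ((J n).continuous.comp (hFcont n))).aestronglyMeasurable
      · refine (l'.le_opNorm _).trans ?_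
        gcongr
        refine le_trans ?_ (hFnorm n hn s)
        simpa using (J n).le_of_opNorm_le (hJ1 n hn) (F n s)
      · exact intervalIntegrable_const
    have hlim2 : Tendsto (fun n => ∫ s in (0 : ℝ)..t, l' (J n (F n s))) atTop
        (𝓝 (l (S t) - l x)) := by
      refine (((l.continuous.tendsto _).comp (hS t)).sub_const (l x)).congr' ?_
      exact eventually_atTop.2 ⟨N, fun n hn => (hinteg n hn).symm⟩
    rw [tendsto_nhds_unique hlim1 hlim2]
    ring

end Evolution

/-! ### Weak evolution equations, bounded perturbations and two-sided flows. -/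

section Evolution

open Set Filter Topology

variable {E : Type*} [NormedAddCommGroup E] [InnerProductSpace ℝ E]

/-- The relation `{(x, y) | l y = l' x for all (l, l') ∈ L}` cut out by a family of weak
equations. -/
def weakGraph (L : Set ((E →L[ℝ] ℝ) × (E →L[ℝ] ℝ))) : Submodule ℝ (E × E) where
  carrier := {p | ∀ l ∈ L, l.1 p.2 = l.2 p.1}
  zero_mem' := by intro l _; simp
  add_mem' := by intro p q hp hq l hl; simp [hp l hl, hq l hl]
  smul_mem' := by intro a p hp l hl; simp [hp l hl]

/-- `Y` satisfies the family of weak evolution equations `(l (Y t))' = l' (Y t)`. -/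
def IsWeakFlow (L : Set ((E →L[ℝ] ℝ) × (E →L[ℝ] ℝ))) (Y : ℝ → E) : Prop :=
  ∀ l ∈ L, ∀ t, HasDerivAt (fun s => l.1 (Y s)) (l.2 (Y t)) t

theorem IsWeakFlow.sub {L : Set ((E →L[ℝ] ℝ) × (E →L[ℝ] ℝ))} {Y Z : ℝ → E}
    (hY : IsWeakFlow L Y) (hZ : IsWeakFlow L Z) : IsWeakFlow L fun t => Y t - Z t := by
  intro l hl t
  simpa using (hY l hl t).fun_sub (hZ l hl t)

/-- The relation `{(x, y + B x) | (x, y) ∈ Γ}`. -/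
def perturb (Γ : Submodule ℝ (E × E)) (B : E →L[ℝ] E) : Submodule ℝ (E × E) where
  carrier := {p | (p.1, p.2 - B p.1) ∈ Γ}
  zero_mem' := by
    change ((0 : E), (0 : E) - B 0) ∈ Γ
    rw [map_zero, sub_zero]
    exact Γ.zero_mem
  add_mem' := by
    intro p q hp hq
    have := Γ.add_mem hp hq
    simpa [add_sub_add_comm] using this
  smul_mem' := by
    intro a p hp
    have := Γ.smul_mem a hp
    simpa [smul_sub] using this

namespace IsGroupGenerator

variable {Γ : Submodule ℝ (E × E)} {c : ℝ}

theorem mul_norm_le (h : IsGroupGenerator Γ c) (lam : ℝ) {p : E × E} (hp : p ∈ Γ) :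
    (|lam| - c) * ‖p.1‖ ≤ ‖lam • p.1 - p.2‖ := by
  rcases eq_or_ne p.1 0 with h0 | h0
  · simp [h0]
  have h1 := abs_real_inner_le_norm (lam • p.1 - p.2) p.1
  rw [inner_sub_left, real_inner_smul_left, real_inner_self_eq_norm_sq] at h1
  have h2 := h.abs_inner_le p hp
  have h3 : 0 < ‖p.1‖ := norm_pos_iff.2 h0
  have h4 : |lam| * ‖p.1‖ ^ 2 - |inner ℝ p.2 p.1| ≤ |lam * ‖p.1‖ ^ 2 - inner ℝ p.2 p.1| := by
    have := abs_sub_abs_le_abs_sub (lam * ‖p.1‖ ^ 2) (inner ℝ p.2 p.1)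
    rwa [abs_mul, abs_of_nonneg (sq_nonneg ‖p.1‖)] at this
  nlinarith

/-- The right resolvent at large `|lam|`, with its norm bound. -/
theorem exists_resolvent (h : IsGroupGenerator Γ c) {lam : ℝ} (hc : c < |lam|)
    (hs : ∀ z, ∃ p ∈ Γ, lam • p.1 - p.2 = z) :
    ∃ K : E →L[ℝ] E, ‖K‖ ≤ (|lam| - c)⁻¹ ∧ ∀ z, (K z, lam • K z - z) ∈ Γ := by
  have hpos : 0 < |lam| - c := sub_pos.2 hc
  choose P hP hPz using hs
  have uniq : ∀ p ∈ Γ, ∀ q ∈ Γ, lam • p.1 - p.2 = lam • q.1 - q.2 → p.1 = q.1 := by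
    intro p hp q hq hpq
    have := h.mul_norm_le lam (Γ.sub_mem hp hq)
    have e : lam • (p - q).1 - (p - q).2 = 0 := by
      rw [Prod.fst_sub, Prod.snd_sub, smul_sub, ← sub_eq_zero.2 hpq]; abel
    rw [e, norm_zero] at this
    have h3 : ‖(p - q).1‖ ≤ 0 := by
      by_contra hc
      push Not at hc
      nlinarith [mul_pos hpos hc]
    exact sub_eq_zero.1 (norm_le_zero_iff.1 h3)
  let K : E →ₗ[ℝ] E :=
    { toFun := fun z => (P z).1
      map_add' := by
        intro a b
        refine uniq _ (hP _) _ (Γ.add_mem (hP a) (hP b)) ?_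
        rw [hPz, Prod.fst_add, Prod.snd_add, smul_add]
        nth_rewrite 1 [← hPz a, ← hPz b]
        abel
      map_smul' := by
        intro c a
        refine uniq _ (hP _) _ (Γ.smul_mem c (hP a)) ?_
        rw [hPz, Prod.smul_fst, Prod.smul_snd, smul_comm, ← smul_sub, hPz] }
  refine ⟨K.mkContinuous (|lam| - c)⁻¹ fun z => ?_,
    K.mkContinuous_norm_le (inv_nonneg.2 hpos.le) _, fun z => ?_⟩
  · have := h.mul_norm_le lam (hP z)
    rw [hPz] at this
    change ‖(P z).1‖ ≤ _
    rwa [inv_mul_eq_div, le_div_iff₀' hpos]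
  · change ((P z).1, lam • (P z).1 - z) ∈ Γ
    have e : lam • (P z).1 - z = (P z).2 := by
      nth_rewrite 2 [← hPz z]; abel
    rw [e]
    exact hP z

theorem perturb [CompleteSpace E] (h : IsGroupGenerator Γ c) (B : E →L[ℝ] E) :
    IsGroupGenerator (perturb Γ B) (c + ‖B‖) where
  abs_inner_le := by
    intro p hp
    have h1 := h.abs_inner_le _ hp
    simp only [inner_sub_left] at h1
    have h2 : |inner ℝ (B p.1) p.1| ≤ ‖B‖ * ‖p.1‖ ^ 2 := by
      refine (abs_real_inner_le_norm _ _).trans ?_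
      nlinarith [B.le_opNorm p.1, norm_nonneg p.1]
    have h3 := abs_add_le (inner ℝ p.2 p.1 - inner ℝ (B p.1) p.1) (inner ℝ (B p.1) p.1)
    rw [sub_add_cancel] at h3
    linarith
  surj := by
    obtain ⟨lam₀, hs⟩ := h.surj
    refine ⟨max lam₀ (c + ‖B‖), fun lam hlam z => ?_⟩
    have hl0 := (le_max_left _ _).trans_lt hlam
    have hlc := (le_max_right _ _).trans_lt hlam
    have hpos : 0 < |lam| - c := by linarith [norm_nonneg B]
    obtain ⟨K, hK, hKΓ⟩ := h.exists_resolvent (sub_pos.1 hpos) (hs lam hl0)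
    -- With `K = (lam - A)⁻¹`, one has `lam - A - B = (1 - B K)(lam - A)`, and a Neumann series
    -- inverts the first factor.
    have hlt : ‖B * K‖ < 1 := by
      calc ‖B * K‖ ≤ ‖B‖ * ‖K‖ := norm_mul_le _ _
        _ ≤ ‖B‖ * (|lam| - c)⁻¹ := by gcongr
        _ < 1 := by rw [mul_inv_lt_iff₀ hpos]; linarith
    obtain ⟨U, hU⟩ := isUnit_one_sub_of_norm_lt_one hlt
    set w : E := (↑U⁻¹ : E →L[ℝ] E) z with hw
    have hwz : w - B (K w) = z := by
      have : ((↑U : E →L[ℝ] E) * (↑U⁻¹ : E →L[ℝ] E)) z = z := by rw [U.mul_inv]; rfl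
      rw [hU] at this
      exact this
    refine ⟨(K w, lam • K w - z), ?_, by simp⟩
    change (K w, lam • K w - z - B (K w)) ∈ Γ
    have : lam • K w - z - B (K w) = lam • K w - w := by rw [← hwz]; abel
    rw [this]
    exact hKΓ w
  eq_zero := by
    intro y hy
    refine h.eq_zero y ?_
    have : ((0 : E), y - B 0) ∈ Γ := hy
    simpa using this

/-- As `σ² = 1`, the comap is the graph of `σ A - c`: the operator run in time direction `σ` and
damped until it is dissipative. -/
theorem contraction (h : IsGroupGenerator Γ c) {σ : ℝ} (hσ : |σ| = 1) :
    IsContractionGenerator (Γ.comap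
      (LinearMap.prod (LinearMap.fst ℝ E E)
        (σ • (LinearMap.snd ℝ E E + c • LinearMap.fst ℝ E E)))) where
  inner_le := by
    intro p hp
    have h1 : |inner ℝ (σ • (p.2 + c • p.1)) p.1| ≤ c * ‖p.1‖ ^ 2 := h.abs_inner_le _ hp
    rw [real_inner_smul_left, abs_mul, hσ, one_mul, inner_add_left, real_inner_smul_left,
      real_inner_self_eq_norm_sq] at h1
    linarith [le_abs_self (inner ℝ p.2 p.1 + c * ‖p.1‖ ^ 2)]
  surj := by
    obtain ⟨lam₀, hs⟩ := h.surj
    -- Solving `lam - (σ A - c)` amounts to solving `σ (lam + c) - A`, so `|lam + c|` must exceed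
    -- `lam₀`.
    refine ⟨|lam₀| + |c|, fun lam hlam z => ?_⟩
    have h1 : lam₀ < |σ * (lam + c)| := by
      rw [abs_mul, hσ, one_mul]
      linarith [le_abs_self lam₀, neg_abs_le c, le_abs_self (lam + c)]
    have hσ2 : σ * σ = 1 := by rw [← abs_mul_abs_self, hσ, one_mul]
    obtain ⟨p, hp, hz⟩ := hs _ h1 (σ • z)
    refine ⟨(p.1, σ • p.2 - c • p.1), ?_, ?_⟩
    · change (p.1, σ • (σ • p.2 - c • p.1 + c • p.1)) ∈ Γ
      rw [sub_add_cancel, smul_smul, hσ2, one_smul]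
      exact hp
    · have : z = σ • (σ • z) := by rw [smul_smul, hσ2, one_smul]
      rw [this, ← hz, smul_sub, smul_smul, ← mul_assoc, hσ2]
      module
  eq_zero := by
    intro y hy
    have h1 : ((0 : E), σ • (y + c • (0 : E))) ∈ Γ := hy
    have h2 := h.eq_zero _ h1
    have hσ0 : σ ≠ 0 := by rintro rfl; simp at hσ
    simpa [hσ0] using h2

/-- Solutions of weak evolution equations are unique. -/
theorem eq_zero_of_isWeakFlow [CompleteSpace E] {L : Set ((E →L[ℝ] ℝ) × (E →L[ℝ] ℝ))}
    (h : IsGroupGenerator (weakGraph L) c) {Y : ℝ → E} (hY : Continuous Y) (h0 : Y 0 = 0)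
    (hw : IsWeakFlow L Y) (t : ℝ) : Y t = 0 := by
  -- `Y t` need not lie in the domain, so it has no energy identity of its own. Its primitive does:
  -- integrating the weak equations from `Y 0 = 0` puts `(Z t, Y t)` in the graph, with `Z' = Y`.
  set Z : ℝ → E := fun t => ∫ s in (0 : ℝ)..t, Y s with hZ
  have hZd : ∀ t, HasDerivAt Z (Y t) t := fun t =>
    intervalIntegral.integral_hasDerivAt_right (hY.intervalIntegrable _ _)
      hY.aestronglyMeasurable.stronglyMeasurableAtFilter hY.continuousAt
  have hΓ : ∀ t, (Z t, Y t) ∈ weakGraph L := by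
    intro t l hl
    change l.1 (Y t) = l.2 (Z t)
    have hcont : Continuous fun s => l.2 (Y s) := l.2.continuous.comp hY
    rw [hZ, ← ContinuousLinearMap.intervalIntegral_comp_comm _ (hY.intervalIntegrable _ _),
      intervalIntegral.integral_eq_sub_of_hasDerivAt (fun s _ => hw l hl s)
        (hcont.intervalIntegrable _ _), h0]
    simp
  have hN : ∀ t, HasDerivAt (fun s => ‖Z s‖ ^ 2) (2 * inner ℝ (Z t) (Y t)) t := fun t =>
    (hZd t).norm_sq
  have hle : ∀ t, |2 * inner ℝ (Z t) (Y t)| ≤ 2 * c * ‖Z t‖ ^ 2 := by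
    intro t
    have := h.abs_inner_le _ (hΓ t)
    rw [real_inner_comm] at this
    rw [abs_mul, abs_two]
    linarith
  have hZ0 : Z 0 = 0 := by simp [hZ]
  have hpos : ∀ t, 0 ≤ t → Z t = 0 := by
    intro t ht
    -- Gronwall's argument, forward in time here and backward below.
    have hanti : Antitone fun s => Real.exp (-(2 * c) * s) * ‖Z s‖ ^ 2 := by
      refine antitone_of_hasDerivAt_nonpos
        (fun s => (((hasDerivAt_id s).const_mul (-(2 * c))).exp.mul (hN s))) fun s => ?_
      have h1 := le_abs_self (2 * inner ℝ (Z s) (Y s))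
      have h2 := Real.exp_pos (-(2 * c) * s)
      simp only [id, Pi.zero_apply]
      nlinarith [hle s]
    have := hanti ht
    simp only [hZ0, norm_zero] at this
    have h2 := Real.exp_pos (-(2 * c) * t)
    have h3 : ‖Z t‖ ^ 2 ≤ 0 := by
      by_contra hc
      push Not at hc
      nlinarith [mul_pos h2 hc]
    exact norm_eq_zero.1 (by nlinarith [norm_nonneg (Z t)])
  have hneg : ∀ t, t ≤ 0 → Z t = 0 := by
    intro t ht
    have hmono : Monotone fun s => Real.exp ((2 * c) * s) * ‖Z s‖ ^ 2 := by
      refine monotone_of_hasDerivAt_nonneg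
        (fun s => (((hasDerivAt_id s).const_mul (2 * c)).exp.mul (hN s))) fun s => ?_
      have h1 := neg_abs_le (2 * inner ℝ (Z s) (Y s))
      have h2 := Real.exp_pos ((2 * c) * s)
      simp only [id, Pi.zero_apply]
      nlinarith [hle s]
    have := hmono ht
    simp only [hZ0, norm_zero] at this
    have h2 := Real.exp_pos ((2 * c) * t)
    have h3 : ‖Z t‖ ^ 2 ≤ 0 := by
      by_contra hc
      push Not at hc
      nlinarith [mul_pos h2 hc]
    exact norm_eq_zero.1 (by nlinarith [norm_nonneg (Z t)])
  have hall : Z = fun _ => 0 := by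
    funext s
    rcases le_total 0 s with hs | hs
    exacts [hpos s hs, hneg s hs]
  have := hZd t
  rw [hall] at this
  exact this.unique (hasDerivAt_const t 0)

/-- Half of a group: solutions in the time direction `σ`. -/
theorem exists_half_flow [CompleteSpace E] (h : IsGroupGenerator Γ c) {σ : ℝ} (hσ : |σ| = 1)
    (x : E) : ∃ S : ℝ → E, Continuous S ∧ S 0 = x ∧
      (∀ t, 0 ≤ t → ‖S t‖ ≤ Real.exp (c * t) * ‖x‖) ∧
      ∀ l l' : E →L[ℝ] ℝ, (∀ p ∈ Γ, l p.2 = l' p.1) → ∀ t, 0 ≤ t →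
        l (S t) = l x + σ * ∫ s in (0 : ℝ)..t, l' (S s) := by
  obtain ⟨S, hc, h0, hb, hw⟩ := (h.contraction hσ).exists_flow x
  -- The factor `exp (c t)` undoes the damping by `c`. The integrated equation is recovered by the
  -- product rule, applied to the primitive `g`, which is differentiable on the whole line and
  -- agrees with `l (S s)` for `s ≥ 0`.
  refine ⟨fun t => Real.exp (c * t) • S t, by fun_prop, by simp [h0], fun t ht => ?_, ?_⟩
  · rw [norm_smul, Real.norm_of_nonneg (Real.exp_pos _).le]
    gcongr
    exact hb t ht
  · intro l l' hl t ht
    have hw' := hw l (σ • l' - c • l) fun p hp => by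
      have h1 : l (σ • (p.2 + c • p.1)) = l' p.1 := hl _ hp
      have hσ2 : σ * σ = 1 := by rw [← abs_mul_abs_self, hσ, one_mul]
      simp only [map_smul, map_add, smul_eq_mul] at h1
      simp only [sub_apply, smul_apply, smul_eq_mul, ← h1, ← mul_assoc, hσ2]
      ring
    have hc1 : Continuous fun s => (σ • l' - c • l) (S s) :=
      (σ • l' - c • l).continuous.comp hc
    set g : ℝ → ℝ := fun t => l x + ∫ s in (0 : ℝ)..t, (σ • l' - c • l) (S s) with hg
    have hgd : ∀ s, HasDerivAt g ((σ • l' - c • l) (S s)) s := fun s =>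
      (intervalIntegral.integral_hasDerivAt_right (hc1.intervalIntegrable _ _)
        hc1.aestronglyMeasurable.stronglyMeasurableAtFilter hc1.continuousAt).const_add _
    have hed : ∀ s, HasDerivAt (fun s => Real.exp (c * s) * g s)
        (Real.exp (c * s) * c * g s + Real.exp (c * s) * (σ • l' - c • l) (S s)) s := fun s => by
      simpa using ((hasDerivAt_id s).const_mul c).exp.fun_mul (hgd s)
    have hgS : ∀ s, 0 ≤ s → g s = l (S s) := fun s hs => (hw' s hs).symm
    have hgc : Continuous g := continuous_iff_continuousAt.2 fun s => (hgd s).continuousAt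
    have hftc := intervalIntegral.integral_eq_sub_of_hasDerivAt (a := 0) (b := t)
      (fun s _ => hed s) (Continuous.intervalIntegrable (by fun_prop) _ _)
    have hcongr : ∫ s in (0 : ℝ)..t,
        (Real.exp (c * s) * c * g s + Real.exp (c * s) * (σ • l' - c • l) (S s)) =
        ∫ s in (0 : ℝ)..t, σ * l' (Real.exp (c * s) • S s) := by
      refine intervalIntegral.integral_congr fun s hs => ?_
      rw [uIcc_of_le ht] at hs
      simp only [hgS s hs.1, sub_apply, smul_apply, smul_eq_mul, map_smul]
      ring
    rw [hcongr, intervalIntegral.integral_const_mul] at hftc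
    have hg0 : g 0 = l x := by simp [hg]
    rw [hg0, hgS t ht] at hftc
    simp only [map_smul, smul_eq_mul] at hftc ⊢
    rw [hftc]
    simp

/-- Existence of weak solutions, with an exponential bound. -/
theorem exists_isWeakFlow [CompleteSpace E] {L : Set ((E →L[ℝ] ℝ) × (E →L[ℝ] ℝ))}
    (h : IsGroupGenerator (weakGraph L) c) (x : E) :
    ∃ Y : ℝ → E, Continuous Y ∧ Y 0 = x ∧ IsWeakFlow L Y ∧
      ∀ t, ‖Y t‖ ≤ Real.exp (c * |t|) * ‖x‖ := by
  obtain ⟨S, hc, h0, hb, hw⟩ := h.exists_half_flow (σ := 1) (by simp) x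
  obtain ⟨S', hc', h0', hb', hw'⟩ := h.exists_half_flow (σ := -1) (by simp) x
  -- The two half flows are glued at `0`. The integrated equation holds across the junction, so
  -- differentiability at `0` needs no separate argument.
  set Y : ℝ → E := fun t => if 0 ≤ t then S t else S' (-t) with hY
  have hYp : ∀ t, 0 ≤ t → Y t = S t := fun t ht => by simp [hY, ht]
  have hYn : ∀ t, t ≤ 0 → Y t = S' (-t) := fun t ht => by
    rcases ht.eq_or_lt with rfl | ht
    · simp [hY, h0, h0']
    · simp [hY, not_le.2 ht]
  have hYc : Continuous Y := by
    refine Continuous.if_le hc (hc'.comp continuous_neg) continuous_const continuous_id ?_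
    rintro t rfl
    simp [h0, h0']
  refine ⟨Y, hYc, by simp [hYp, h0], ?_, fun t => ?_⟩
  · intro l hl t
    have hinteg : ∀ t, l.1 (Y t) = l.1 x + ∫ s in (0 : ℝ)..t, l.2 (Y s) := by
      intro t
      rcases le_total 0 t with ht | ht
      · rw [hYp t ht, hw l.1 l.2 (fun p hp => hp l hl) t ht, one_mul]
        congr 1
        refine intervalIntegral.integral_congr fun s hs => ?_
        rw [uIcc_of_le ht] at hs
        simp only [hYp s hs.1]
      · have ht' : 0 ≤ -t := neg_nonneg.2 ht
        rw [hYn t ht, hw' l.1 l.2 (fun p hp => hp l hl) (-t) ht']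
        congr 1
        have e : ∫ s in (0 : ℝ)..-t, l.2 (S' s) = ∫ s in t..0, l.2 (S' (-s)) := by
          rw [intervalIntegral.integral_comp_neg (fun s => l.2 (S' s)), neg_zero]
        rw [e, intervalIntegral.integral_symm t 0, neg_one_mul]
        congr 1
        refine intervalIntegral.integral_congr fun s hs => ?_
        rw [uIcc_of_le ht] at hs
        simp only [hYn s hs.2]
    have hc1 : Continuous fun s => l.2 (Y s) := l.2.continuous.comp hYc
    have := (intervalIntegral.integral_hasDerivAt_right (hc1.intervalIntegrable 0 t)
        hc1.aestronglyMeasurable.stronglyMeasurableAtFilter hc1.continuousAt).const_add (l.1 x)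
    exact this.congr_of_eventuallyEq (Eventually.of_forall hinteg)
  · rcases le_total 0 t with ht | ht
    · rw [hYp t ht, abs_of_nonneg ht]; exact hb t ht
    · rw [hYn t ht, abs_of_nonpos ht]; exact hb' _ (neg_nonneg.2 ht)

end IsGroupGenerator

end Evolution

/-! ### Pairing weighted spaces with test functions; completeness of `H^{1,α}`. -/

noncomputable section

namespace FieldCrystal

section Pairing

variable {d : ℕ} {α : ℝ}

theorem contDiff_weight (α : ℝ) : ContDiff ℝ ∞ (weight (d := d) α) := by
  refine ContDiff.rpow_const_of_ne (contDiff_const.add (contDiff_norm_sq ℝ)) fun x => ?_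
  positivity

theorem measurable_ofReal_weight (α : ℝ) :
    Measurable fun x : Space d => ENNReal.ofReal (weight α x) :=
  (continuous_weight α).measurable.ennreal_ofReal

theorem integral_fieldMeasure {F : Type*} [NormedAddCommGroup F] [NormedSpace ℝ F]
    (f : Space d → F) : ∫ x, f x ∂(fieldMeasure d α) = ∫ x, weight α x • f x := by
  rw [fieldMeasure, integral_withDensity_eq_integral_toReal_smul (measurable_ofReal_weight α)
    (Filter.Eventually.of_forall fun x => ENNReal.ofReal_lt_top)]
  simp_rw [ENNReal.toReal_ofReal (weight_pos α _).le]

theorem fieldMeasure_ae_of_ae {p : Space d → Prop} (h : ∀ᵐ x, p x) :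
    ∀ᵐ x ∂(fieldMeasure d α), p x :=
  (withDensity_absolutelyContinuous _ _).ae_le h

/-- The partial derivative in the `j`-th coordinate direction. -/
def pderiv (j : Fin d) (φ : Space d → ℝ) (x : Space d) : ℝ := fderiv ℝ φ x (basisVec j)

theorem contDiff_pderiv {φ : Space d → ℝ} (hφ : ContDiff ℝ ∞ φ) (j : Fin d) :
    ContDiff ℝ ∞ (pderiv j φ) :=
  (hφ.fderiv_right (m := ∞) (by simp)).clm_apply contDiff_const

theorem IsTest.pderiv {φ : Space d → ℝ} (hφ : IsTest φ) (j : Fin d) : IsTest (pderiv j φ) :=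
  ⟨contDiff_pderiv hφ.1 j, compact_partial hφ j⟩

theorem laplacian_eq_sum_pderiv {φ : Space d → ℝ} (hφ : ContDiff ℝ ∞ φ) :
    Δ φ = fun x => ∑ j, pderiv j (pderiv j φ) x := by
  rw [InnerProductSpace.laplacian_eq_iteratedFDeriv_orthonormalBasis φ
    (EuclideanSpace.basisFun (Fin d) ℝ)]
  funext x
  refine Finset.sum_congr rfl fun j _ => ?_
  rw [iteratedFDeriv_two_apply]
  have hd : DifferentiableAt ℝ (fderiv ℝ φ) x :=
    ((hφ.fderiv_right (m := ∞) (by simp)).differentiable (by simp)).differentiableAt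
  have hb : (EuclideanSpace.basisFun (Fin d) ℝ) j = basisVec j := by simp [basisVec]
  have : pderiv j (pderiv j φ) x = fderiv ℝ (fderiv ℝ φ) x (basisVec j) (basisVec j) := by
    have h1 : HasFDerivAt (pderiv j φ)
        ((fderiv ℝ (fderiv ℝ φ) x).flip (basisVec j)) x := by
      have := hd.hasFDerivAt.clm_apply (hasFDerivAt_const (basisVec j) x)
      simp only [ContinuousLinearMap.comp_zero, zero_add] at this
      exact this
    rw [pderiv, h1.fderiv]
    rfl
  rw [this]
  simp [hb]

theorem continuous_laplacian {φ : Space d → ℝ} (hφ : IsTest φ) : Continuous (Δ φ) := by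
  rw [laplacian_eq_sum_pderiv hφ.1]
  exact continuous_finsetSum _ fun j _ => ((hφ.pderiv j).pderiv j).1.continuous

theorem hasCompactSupport_laplacian {φ : Space d → ℝ} (hφ : IsTest φ) :
    HasCompactSupport (Δ φ) := by
  refine HasCompactSupport.intro hφ.2 fun x hx => ?_
  rw [laplacian_eq_sum_pderiv hφ.1]
  refine Finset.sum_eq_zero fun j _ => image_eq_zero_of_notMem_tsupport fun h => hx ?_
  exact tsupport_fderiv_apply_subset ℝ (basisVec j)
    (tsupport_fderiv_apply_subset ℝ (basisVec j) h)

theorem memLp_div_weight {φ : Space d → ℝ} (hφ : Continuous φ) (hc : HasCompactSupport φ) :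
    MemLp (fun x => φ x / weight α x) 2 (fieldMeasure d α) := by
  have hq : Continuous fun x => φ x / weight α x :=
    hφ.div (continuous_weight α) fun x => (weight_pos α x).ne'
  have hqc : HasCompactSupport fun x => φ x / weight α x := by
    simp only [div_eq_mul_inv]
    exact hc.mul_right (f' := fun x => (weight α x)⁻¹)
  exact hq.memLp_of_hasCompactSupport hqc

theorem memLp_div_weight_smul {φ : Space d → ℝ} (hφ : Continuous φ) (hc : HasCompactSupport φ)
    (j : Fin d) : MemLp (fun x => (φ x / weight α x) • (basisVec j : Space d)) 2
      (fieldMeasure d α) :=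
  ((ContinuousLinearMap.id ℝ ℝ).smulRight (basisVec j : Space d)).comp_memLp'
    (memLp_div_weight hφ hc)

open Classical in
/-- The Riesz representative in `H^{0,α}` of `f ↦ ∫ f φ`. -/
def testRep (α : ℝ) (φ : Space d → ℝ) : H0 d α :=
  -- The value `0` is only a default: for continuous `φ` of compact support `memLp_div_weight`
  -- selects the first branch.
  if h : MemLp (fun x => φ x / weight α x) 2 (fieldMeasure d α) then h.toLp else 0

open Classical in
/-- The Riesz representative of `g ↦ ∫ g_j φ`. -/
def testRepVec (α : ℝ) (φ : Space d → ℝ) (j : Fin d) : H0Vec d α :=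
  if h : MemLp (fun x => (φ x / weight α x) • (basisVec j : Space d)) 2 (fieldMeasure d α)
    then h.toLp else 0

theorem inner_testRep {φ : Space d → ℝ} (hφ : Continuous φ) (hc : HasCompactSupport φ)
    (f : H0 d α) : inner ℝ (testRep α φ) f = ∫ x, f x * φ x := by
  have hm := memLp_div_weight (α := α) hφ hc
  rw [testRep, dif_pos hm, L2.inner_def, integral_fieldMeasure]
  refine integral_congr_ae ?_
  filter_upwards [fieldMeasure_ae hm.coeFn_toLp] with x hx
  have := (weight_pos α x).ne'
  rw [hx]
  simp only [RCLike.inner_apply, conj_trivial, smul_eq_mul]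
  field_simp

theorem inner_testRepVec {φ : Space d → ℝ} (hφ : Continuous φ) (hc : HasCompactSupport φ)
    (j : Fin d) (g : H0Vec d α) : inner ℝ (testRepVec α φ j) g = ∫ x, g x j * φ x := by
  have hm := memLp_div_weight_smul (α := α) hφ hc j
  rw [testRepVec, dif_pos hm, L2.inner_def, integral_fieldMeasure]
  refine integral_congr_ae ?_
  filter_upwards [fieldMeasure_ae hm.coeFn_toLp] with x hx
  have := (weight_pos α x).ne'
  rw [hx, real_inner_smul_left, basisVec, EuclideanSpace.inner_single_left]
  simp only [smul_eq_mul, map_one, one_mul]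
  field_simp

theorem locallyIntegrable_of_memLp {f : Space d → ℝ} (hf : MemLp f 2 (fieldMeasure d α)) :
    LocallyIntegrable f volume := by
  rw [locallyIntegrable_iff]
  intro K hK
  obtain ⟨η, hη1, -, hηc, -⟩ := exists_continuous_one_zero_of_isCompact hK
    isClosed_empty (Set.disjoint_empty K)
  have hi := integrable_mul_of_compact hf η.continuous hηc
  refine (hi.integrableOn (s := K)).congr_fun (fun x hx => ?_) hK.measurableSet
  simp [hη1 hx]

/-- Elements of `H^{0,α}` are determined by their pairings with test functions. -/
theorem eq_zero_of_inner_testRep (f : H0 d α)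
    (h : ∀ φ : Space d → ℝ, IsTest φ → inner ℝ (testRep α φ) f = 0) : f = 0 := by
  have h1 : ∀ᵐ x, f x = 0 := by
    refine ae_eq_zero_of_integral_contDiff_smul_eq_zero (locallyIntegrable_of_memLp (Lp.memLp f)) ?_
    intro φ hφ hc
    have := h φ ⟨hφ, hc⟩
    rw [inner_testRep hφ.continuous hc] at this
    simpa [mul_comm] using this
  exact (Lp.eq_zero_iff_ae_eq_zero).2 (fieldMeasure_ae_of_ae h1)

theorem eq_zero_of_inner_testRepVec (g : H0Vec d α)
    (h : ∀ φ : Space d → ℝ, IsTest φ → ∀ j, inner ℝ (testRepVec α φ j) g = 0) : g = 0 := by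
  have h1 : ∀ j, ∀ᵐ x, g x j = 0 := by
    intro j
    refine ae_eq_zero_of_integral_contDiff_smul_eq_zero
      (locallyIntegrable_of_memLp (memLp_coord g j)) ?_
    intro φ hφ hc
    have := h φ ⟨hφ, hc⟩ j
    rw [inner_testRepVec hφ.continuous hc] at this
    simpa [mul_comm] using this
  refine (Lp.eq_zero_iff_ae_eq_zero).2 (fieldMeasure_ae_of_ae ?_)
  filter_upwards [ae_all_iff.2 h1] with x hx
  ext j
  exact hx j

theorem mem_H1_iff (p : WithLp 2 (H0 d α × H0Vec d α)) :
    p ∈ H1 d α ↔ ∀ φ : Space d → ℝ, IsTest φ → ∀ j : Fin d,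
      inner ℝ (testRep α (pderiv j φ)) p.fst = -inner ℝ (testRepVec α φ j) p.snd := by
  change IsWeakGradient _ _ ↔ _
  refine forall_congr' fun φ => forall_congr' fun hφ => forall_congr' fun j => ?_
  rw [inner_testRep (hφ.pderiv j).1.continuous (hφ.pderiv j).2,
    inner_testRepVec hφ.1.continuous hφ.2]
  rfl

/-- Weak gradients are unique. -/
theorem eq_zero_of_mem_H1 {p : WithLp 2 (H0 d α × H0Vec d α)} (hp : p ∈ H1 d α)
    (h : p.fst = 0) : p.snd = 0 := by
  refine eq_zero_of_inner_testRepVec _ fun φ hφ j => ?_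
  have := (mem_H1_iff p).1 hp φ hφ j
  rw [h, inner_zero_right] at this
  linarith

/-- Each instance of the weak gradient identity equates two continuous functionals of the pair. -/
theorem isClosed_H1 : IsClosed (H1 d α : Set (WithLp 2 (H0 d α × H0Vec d α))) := by
  have : (H1 d α : Set (WithLp 2 (H0 d α × H0Vec d α))) =
      ⋂ (φ : Space d → ℝ) (_ : IsTest φ) (j : Fin d),
        {p | inner ℝ (testRep α (pderiv j φ)) p.fst = -inner ℝ (testRepVec α φ j) p.snd} := by
    ext p
    simp only [SetLike.mem_coe, mem_H1_iff, Set.mem_iInter, Set.mem_ofPred_eq]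
  rw [this]
  refine isClosed_iInter fun φ => isClosed_iInter fun _ => isClosed_iInter fun j => ?_
  refine isClosed_eq ?_ ?_
  · exact continuous_const.inner (WithLp.fstL 2 ℝ (H0 d α) (H0Vec d α)).continuous
  · exact (continuous_const.inner (WithLp.sndL 2 ℝ (H0 d α) (H0Vec d α)).continuous).neg

instance : CompleteSpace (H1 d α) := isClosed_H1.completeSpace_coe

end Pairing

end FieldCrystal

end

/-! ### Weighted Green form and Lax–Milgram. -/

noncomputable section

namespace FieldCrystal

section Elliptic

variable {d : ℕ} {α : ℝ}

/-- The logarithmic gradient `∇w / w` of the weight. -/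
def logGrad (α : ℝ) (x : Space d) : Space d := (2 * α / (1 + ‖x‖ ^ 2)) • x

theorem continuous_logGrad (α : ℝ) : Continuous (logGrad (d := d) α) := by
  have h : Continuous fun x : Space d => 2 * α / (1 + ‖x‖ ^ 2) :=
    continuous_const.div (by fun_prop) fun x => by positivity
  exact h.smul continuous_id

/-- This is `2‖x‖ ≤ 1 + ‖x‖²`. Differentiating the weight thus costs only a bounded factor, so the
weighted energy grows at most exponentially. -/
theorem norm_logGrad_le (α : ℝ) (x : Space d) : ‖logGrad α x‖ ≤ |α| := by
  have h : 0 < 1 + ‖x‖ ^ 2 := by positivity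
  rw [logGrad, norm_smul, Real.norm_eq_abs, abs_div, abs_of_pos h, abs_mul, abs_two,
    div_mul_eq_mul_div, div_le_iff₀ h]
  nlinarith [abs_nonneg α, sq_nonneg (‖x‖ - 1)]

theorem pderiv_weight (j : Fin d) (x : Space d) :
    pderiv j (weight α) x = weight α x * logGrad α x j := by
  have hpos : 0 < 1 + ‖x‖ ^ 2 := by positivity
  have h1 : HasFDerivAt (fun y : Space d => 1 + ‖y‖ ^ 2) (2 • innerSL ℝ x) x := by
    have := (hasStrictFDerivAt_norm_sq x).hasFDerivAt.const_add 1
    exact this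
  have h2 := h1.rpow_const (p := α) (Or.inl hpos.ne')
  have h3 : fderiv ℝ (weight α) x = (α * (1 + ‖x‖ ^ 2) ^ (α - 1)) • (2 • innerSL ℝ x) := h2.fderiv
  rw [pderiv, h3, logGrad, weight, Real.rpow_sub_one hpos.ne']
  simp only [smul_apply, innerSL_apply_apply, basisVec, EuclideanSpace.inner_single_right,
    PiLp.smul_apply, smul_eq_mul, nsmul_eq_mul, conj_trivial]
  push_cast
  field_simp

theorem pderiv_div_weight {φ : Space d → ℝ} (hφ : ContDiff ℝ ∞ φ) (j : Fin d) (x : Space d) :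
    pderiv j (fun y => φ y / weight α y) x =
      (pderiv j φ x - φ x * logGrad α x j) / weight α x := by
  have hw := (weight_pos α x).ne'
  have hq : ContDiff ℝ ∞ fun y => φ y / weight α y :=
    hφ.div (contDiff_weight α) fun y => (weight_pos α y).ne'
  have h1 := (hq.differentiable (by simp)).differentiableAt (x := x) |>.hasFDerivAt
  have h2 : HasFDerivAt (weight α) (fderiv ℝ (weight α) x) x :=
    ((contDiff_weight α).differentiable (by simp)).differentiableAt.hasFDerivAt
  have h3 := (h1.fun_mul h2).fderiv
  have h4 : fderiv ℝ (weight α) x (basisVec j) = weight α x * logGrad α x j := pderiv_weight j x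
  have h5 : (fun y => φ y / weight α y * weight α y) = φ := by
    funext y
    exact div_mul_cancel₀ _ (weight_pos α y).ne'
  rw [h5] at h3
  simp only [pderiv, h3, add_apply, smul_apply, smul_eq_mul, h4]
  field_simp
  ring

theorem memLp_inner_logGrad (g : H0Vec d α) :
    MemLp (fun x => inner ℝ (logGrad α x) (g x)) 2 (fieldMeasure d α) := by
  refine MemLp.of_le_mul (c := |α|) (Lp.memLp g) ?_ (Filter.Eventually.of_forall fun x => ?_)
  · exact (continuous_logGrad α).aestronglyMeasurable.inner (Lp.aestronglyMeasurable g)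
  · refine (norm_inner_le_norm _ _).trans ?_
    gcongr
    exact norm_logGrad_le α x

/-- The bounded operator `g ↦ (∇w / w) · g`. -/
def drift (d : ℕ) (α : ℝ) : H0Vec d α →L[ℝ] H0 d α :=
  LinearMap.mkContinuous
    { toFun := fun g => (memLp_inner_logGrad g).toLp
      map_add' := by
        intro g h
        ext1
        filter_upwards [(memLp_inner_logGrad (g + h)).coeFn_toLp,
          (memLp_inner_logGrad g).coeFn_toLp, (memLp_inner_logGrad h).coeFn_toLp,
          Lp.coeFn_add g h, Lp.coeFn_add (memLp_inner_logGrad g).toLp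
            (memLp_inner_logGrad h).toLp] with x h1 h2 h3 h4 h5
        rw [h1, h5, Pi.add_apply, h2, h3, h4, Pi.add_apply, inner_add_right]
      map_smul' := by
        intro c g
        ext1
        filter_upwards [(memLp_inner_logGrad (c • g)).coeFn_toLp,
          (memLp_inner_logGrad g).coeFn_toLp, Lp.coeFn_smul c g,
          Lp.coeFn_smul c (memLp_inner_logGrad g).toLp] with x h1 h2 h4 h5
        rw [h1, RingHom.id_apply, h5, Pi.smul_apply, h2, h4, Pi.smul_apply, inner_smul_right,
          smul_eq_mul] } |α| (by
    intro g
    refine Lp.norm_le_mul_norm_of_ae_le_mul ?_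
    filter_upwards [(memLp_inner_logGrad g).coeFn_toLp] with x h1
    change ‖((memLp_inner_logGrad g).toLp : Space d → ℝ) x‖ ≤ _
    rw [h1]
    refine (norm_inner_le_norm _ _).trans ?_
    gcongr
    exact norm_logGrad_le α x)

theorem drift_ae (g : H0Vec d α) :
    ∀ᵐ x, drift d α g x = inner ℝ (logGrad α x) (g x) :=
  fieldMeasure_ae (memLp_inner_logGrad g).coeFn_toLp

theorem norm_drift_le (g : H0Vec d α) : ‖drift d α g‖ ≤ |α| * ‖g‖ :=
  (drift d α).le_of_opNorm_le (LinearMap.mkContinuous_norm_le _ (abs_nonneg α) _) g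

/-- `φ ↦ ∂_j φ - φ ∂_j w / w`, so that `∂_j (φ / w)` is its value divided by `w`. -/
def twistedPartial (α : ℝ) (j : Fin d) (φ : Space d → ℝ) (x : Space d) : ℝ :=
  pderiv j φ x - φ x * logGrad α x j

theorem continuous_logGrad_apply (α : ℝ) (j : Fin d) :
    Continuous fun x : Space d => logGrad α x j :=
  (EuclideanSpace.proj (𝕜 := ℝ) j : Space d →L[ℝ] ℝ).continuous.comp (continuous_logGrad α)

theorem continuous_twistedPartial {φ : Space d → ℝ} (hφ : IsTest φ) (j : Fin d) :
    Continuous (twistedPartial α j φ) :=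
  (hφ.pderiv j).1.continuous.sub (hφ.1.continuous.mul (continuous_logGrad_apply α j))

theorem hasCompactSupport_twistedPartial {φ : Space d → ℝ} (hφ : IsTest φ) (j : Fin d) :
    HasCompactSupport (twistedPartial α j φ) :=
  (hφ.pderiv j).2.sub (hφ.2.mul_right (f' := fun x => logGrad α x j))

/-- `φ / w` with its gradient, for a test function `φ`. -/
def testPair (α : ℝ) (φ : Space d → ℝ) : WithLp 2 (H0 d α × H0Vec d α) :=
  WithLp.toLp 2 (testRep α φ, ∑ j, testRepVec α (twistedPartial α j φ) j)

/-- Makes `φ / w` an admissible competitor in `IsVarLaplacian`; with this choice the weight cancels.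
-/
theorem testPair_mem {φ : Space d → ℝ} (hφ : IsTest φ) : testPair α φ ∈ H1 d α := by
  rw [mem_H1_iff]
  intro η hη j
  have hm := memLp_div_weight (α := α) hφ.1.continuous hφ.2
  change inner ℝ _ (testRep α φ) = -inner ℝ _ (∑ i, testRepVec α (twistedPartial α i φ) i)
  rw [inner_sum, Finset.sum_eq_single j]
  · have hm' := memLp_div_weight_smul (α := α) (continuous_twistedPartial (α := α) hφ j)
      (hasCompactSupport_twistedPartial hφ j) j
    rw [inner_testRep (hη.pderiv j).1.continuous (hη.pderiv j).2,
      inner_testRepVec hη.1.continuous hη.2]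
    have e1 : ∫ x, testRep α φ x * pderiv j η x =
        ∫ x, (φ x / weight α x) * fderiv ℝ η x (basisVec j) := by
      refine integral_congr_ae ?_
      rw [testRep, dif_pos hm]
      filter_upwards [fieldMeasure_ae hm.coeFn_toLp] with x hx
      rw [hx]
      rfl
    have e2 : ∫ x, testRepVec α (twistedPartial α j φ) j x j * η x =
        ∫ x, fderiv ℝ (fun y => φ y / weight α y) x (basisVec j) * η x := by
      refine integral_congr_ae ?_
      rw [testRepVec, dif_pos hm']
      filter_upwards [fieldMeasure_ae hm'.coeFn_toLp] with x hx
      have := pderiv_div_weight (α := α) hφ.1 j x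
      rw [pderiv] at this
      rw [hx, this]
      simp [basisVec, twistedPartial]
    rw [e1, e2]
    have hq : ContDiff ℝ ∞ fun x => φ x / weight α x :=
      hφ.1.div (contDiff_weight α) fun x => (weight_pos α x).ne'
    have hqd : Continuous fun x => fderiv ℝ (fun y => φ y / weight α y) x (basisVec j) :=
      (contDiff_pderiv hq j).continuous
    refine integral_mul_fderiv_eq_neg_fderiv_mul_of_integrable ?_ ?_ ?_
      (fun x _ => (hq.differentiable (by simp)).differentiableAt)
      (fun x _ => (hη.1.differentiable (by simp)).differentiableAt)
    · exact (hqd.mul hη.1.continuous).integrable_of_hasCompactSupport hη.2.mul_left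
    · exact (hq.continuous.mul (hη.pderiv j).1.continuous).integrable_of_hasCompactSupport
        (hη.pderiv j).2.mul_left
    · exact (hq.continuous.mul hη.1.continuous).integrable_of_hasCompactSupport hη.2.mul_left
  · intro i _ hij
    have hm' := memLp_div_weight_smul (α := α) (continuous_twistedPartial (α := α) hφ i)
      (hasCompactSupport_twistedPartial hφ i) i
    rw [inner_testRepVec hη.1.continuous hη.2]
    refine integral_eq_zero_of_ae ?_
    rw [testRepVec, dif_pos hm']
    filter_upwards [fieldMeasure_ae hm'.coeFn_toLp] with x hx
    rw [hx]
    simp [basisVec, hij.symm]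
  · simp

/-- The weighted Green form `∫ w ∇ψ·∇χ + ∫ χ ∇w·∇ψ` equals `-∫ w h χ` for all `χ ∈ H^{1,α}`,
that is, `Δψ = h`. -/
def IsVarLaplacian (ψ : WithLp 2 (H0 d α × H0Vec d α)) (h : H0 d α) : Prop :=
  ∀ χ ∈ H1 d α, inner ℝ ψ.snd χ.snd + inner ℝ (drift d α ψ.snd) χ.fst = -inner ℝ h χ.fst

/-- `Δψ = h` in the sense of distributions. -/
def IsDistLaplacian (ψ h : H0 d α) : Prop :=
  ∀ φ : Space d → ℝ, IsTest φ → inner ℝ (testRep α φ) h = inner ℝ (testRep α (Δ φ)) ψ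

theorem inner_testRep_laplacian {φ : Space d → ℝ} (hφ : IsTest φ) (f : H0 d α) :
    inner ℝ (testRep α (Δ φ)) f = ∑ j, inner ℝ (testRep α (pderiv j (pderiv j φ))) f := by
  rw [inner_testRep (continuous_laplacian hφ) (hasCompactSupport_laplacian hφ),
    laplacian_eq_sum_pderiv hφ.1]
  have : ∀ j, inner ℝ (testRep α (pderiv j (pderiv j φ))) f =
      ∫ x, f x * pderiv j (pderiv j φ) x := fun j =>
    inner_testRep ((hφ.pderiv j).pderiv j).1.continuous ((hφ.pderiv j).pderiv j).2 f
  simp_rw [this, Finset.mul_sum]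
  exact integral_finsetSum _ fun j _ => integrable_mul_of_compact (Lp.memLp f)
    ((hφ.pderiv j).pderiv j).1.continuous ((hφ.pderiv j).pderiv j).2

/-- In `w ∇(φ/w) = ∇φ - φ ∇w/w` the second term is exactly compensated by the drift, leaving the
unweighted `∫ ∇ψ·∇φ`. -/
theorem green_testPair {ψ : WithLp 2 (H0 d α × H0Vec d α)} (hψ : ψ ∈ H1 d α)
    {φ : Space d → ℝ} (hφ : IsTest φ) :
    inner ℝ ψ.snd (testPair α φ).snd + inner ℝ (drift d α ψ.snd) (testPair α φ).fst =
      -inner ℝ (testRep α (Δ φ)) ψ.fst := by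
  change inner ℝ ψ.snd (∑ j, testRepVec α (twistedPartial α j φ) j) +
    inner ℝ (drift d α ψ.snd) (testRep α φ) = _
  rw [inner_testRep_laplacian hφ, ← Finset.sum_neg_distrib]
  have e1 : ∀ j, -inner ℝ (testRep α (pderiv j (pderiv j φ))) ψ.fst =
      ∫ x, ψ.snd x j * pderiv j φ x := fun j => by
    rw [(mem_H1_iff ψ).1 hψ _ (hφ.pderiv j) j, neg_neg,
      inner_testRepVec (hφ.pderiv j).1.continuous (hφ.pderiv j).2]
  have e2 : ∀ j, inner ℝ ψ.snd (testRepVec α (twistedPartial α j φ) j) =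
      (∫ x, ψ.snd x j * pderiv j φ x) - ∫ x, ψ.snd x j * (φ x * logGrad α x j) := fun j => by
    rw [real_inner_comm, inner_testRepVec (continuous_twistedPartial hφ j)
      (hasCompactSupport_twistedPartial hφ j), ← integral_sub]
    · simp_rw [twistedPartial, mul_sub]
    · exact integrable_mul_of_compact (memLp_coord ψ.snd j) (hφ.pderiv j).1.continuous
        (hφ.pderiv j).2
    · exact integrable_mul_of_compact (memLp_coord ψ.snd j)
        (hφ.1.continuous.mul (continuous_logGrad_apply α j)) hφ.2.mul_right
  have e3 : inner ℝ (drift d α ψ.snd) (testRep α φ) =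
      ∑ j, ∫ x, ψ.snd x j * (φ x * logGrad α x j) := by
    rw [real_inner_comm, inner_testRep hφ.1.continuous hφ.2, ← integral_finsetSum]
    · refine integral_congr_ae ?_
      filter_upwards [drift_ae ψ.snd] with x hx
      rw [hx, PiLp.inner_apply, Finset.sum_mul]
      refine Finset.sum_congr rfl fun j _ => ?_
      simp only [RCLike.inner_apply, conj_trivial]
      ring
    · exact fun j _ => integrable_mul_of_compact (memLp_coord ψ.snd j)
        (hφ.1.continuous.mul (continuous_logGrad_apply α j)) hφ.2.mul_right
  rw [inner_sum, e3, ← Finset.sum_add_distrib]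
  refine Finset.sum_congr rfl fun j _ => ?_
  rw [e1, e2]
  ring

theorem IsVarLaplacian.isDistLaplacian {ψ : WithLp 2 (H0 d α × H0Vec d α)} {h : H0 d α}
    (hv : IsVarLaplacian ψ h) (hψ : ψ ∈ H1 d α) : IsDistLaplacian ψ.fst h := by
  intro φ hφ
  have h1 := hv _ (testPair_mem hφ)
  rw [green_testPair hψ hφ] at h1
  have h2 : inner ℝ h (testPair α φ).fst = inner ℝ (testRep α φ) h := real_inner_comm _ _
  linarith

/-- Solvability of `μψ - Δψ = f` in `H^{1,α}` for large `μ`. -/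
theorem exists_isVarLaplacian {μ : ℝ} (hμ : 1 + α ^ 2 ≤ μ) (f : H0 d α) :
    ∃ ψ ∈ H1 d α, IsVarLaplacian ψ (μ • ψ.fst - f) := by
  let P : H1 d α →L[ℝ] H0 d α := (WithLp.fstL 2 ℝ _ _).comp (H1 d α).subtypeL
  let Q : H1 d α →L[ℝ] H0Vec d α := (WithLp.sndL 2 ℝ _ _).comp (H1 d α).subtypeL
  let B : H1 d α →L[ℝ] H1 d α →L[ℝ] ℝ := μ • (innerSL ℝ).bilinearComp P P +
    (innerSL ℝ).bilinearComp Q Q + (innerSL ℝ).bilinearComp ((drift d α).comp Q) P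
  have hB : ∀ v w, B v w = μ * inner ℝ (P v) (P w) + inner ℝ (Q v) (Q w) +
      inner ℝ (drift d α (Q v)) (P w) := fun v w => rfl
  have hco : IsCoercive B := by
    -- The drift term is at least `-|α| ‖Q v‖ ‖P v‖ ≥ -(α² ‖P v‖² + ‖Q v‖²)/2`; half of the gradient
    -- term absorbs one part and `μ ≥ 1 + α²` the other.
    refine ⟨1 / 2, by norm_num, fun v => ?_⟩
    have hn : ‖v‖ ^ 2 = ‖P v‖ ^ 2 + ‖Q v‖ ^ 2 :=
      WithLp.prod_norm_sq_eq_of_L2 (v : WithLp 2 (H0 d α × H0Vec d α))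
    rw [hB, real_inner_self_eq_norm_sq, real_inner_self_eq_norm_sq, mul_assoc, ← pow_two, hn]
    have h1 : -(|α| * ‖Q v‖ * ‖P v‖) ≤ inner ℝ (drift d α (Q v)) (P v) := by
      have := (abs_le.1 (abs_real_inner_le_norm (drift d α (Q v)) (P v))).1
      nlinarith [norm_drift_le (Q v), norm_nonneg (P v)]
    nlinarith [sq_nonneg (|α| * ‖P v‖ - ‖Q v‖), sq_abs α, sq_nonneg ‖P v‖,
      mul_le_mul_of_nonneg_right hμ (sq_nonneg ‖P v‖)]
  -- The drift makes `B` nonsymmetric, so Lax–Milgram is used.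
  obtain ⟨ψ, hψ⟩ : ∃ ψ, ∀ w, B ψ w = inner ℝ f (P w) := by
    refine ⟨hco.continuousLinearEquivOfBilin.symm
      ((InnerProductSpace.toDual ℝ (H1 d α)).symm ((innerSL ℝ f).comp P)), fun w => ?_⟩
    rw [← hco.continuousLinearEquivOfBilin_apply, ContinuousLinearEquiv.apply_symm_apply,
      InnerProductSpace.toDual_symm_apply]
    rfl
  refine ⟨ψ, ψ.2, fun χ hχ => ?_⟩
  have h1 := hψ ⟨χ, hχ⟩
  rw [hB] at h1
  change μ * inner ℝ (ψ : WithLp 2 (H0 d α × H0Vec d α)).fst χ.fst +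
    inner ℝ (ψ : WithLp 2 (H0 d α × H0Vec d α)).snd χ.snd +
    inner ℝ (drift d α (ψ : WithLp 2 (H0 d α × H0Vec d α)).snd) χ.fst = inner ℝ f χ.fst at h1
  rw [inner_sub_left, real_inner_smul_left]
  linarith

end Elliptic

end FieldCrystal

end

/-! ### Maximum principle; distributional and variational Laplacians agree. -/

noncomputable section

namespace FieldCrystal

section MaximumPrinciple

variable {d : ℕ} {α : ℝ}

/-- If `c > 0`, the second derivative test makes `x` a local minimum as well, so `k` is locally
constant and `c = 0`. -/
theorem nonpos_of_isLocalMax_of_hasDerivAt {k k' : ℝ → ℝ} {c x : ℝ}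
    (h1 : ∀ s, HasDerivAt k (k' s) s) (h2 : HasDerivAt k' c x) (hm : IsLocalMax k x) : c ≤ 0 := by
  by_contra hc
  push Not at hc
  have hk : deriv k = k' := funext fun s => (h1 s).deriv
  have hmin : IsLocalMin k x := by
    refine isLocalMin_of_deriv_deriv_pos ?_ hm.deriv_eq_zero (h1 x).continuousAt
    rw [hk, h2.deriv]
    exact hc
  have hconst : k =ᶠ[nhds x] fun _ => k x := by
    filter_upwards [hm, hmin] with s hs hs'
    exact le_antisymm hs hs'
  have h0 : k' =ᶠ[nhds x] fun _ => 0 := by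
    have := hconst.deriv
    rw [hk] at this
    simpa using this
  have := h2.congr_of_eventuallyEq h0.symm
  exact hc.ne' (this.unique (hasDerivAt_const x 0))

theorem norm_add_smul_basisVec_sq (x : Space d) (j : Fin d) (s : ℝ) :
    ‖x + s • basisVec j‖ ^ 2 = ‖x‖ ^ 2 + 2 * s * x j + s ^ 2 := by
  rw [norm_add_sq_real, real_inner_smul_right, norm_smul, basisVec,
    EuclideanSpace.inner_single_right, PiLp.norm_single]
  simp
  ring

/-- A function of polynomial growth with `ΔF = μF`, `μ` large, is nonpositive. The derivatives of
`F` are taken along coordinate lines. -/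
theorem nonpos_of_laplacian_eq {F : Space d → ℝ} {D D2 : Fin d → Space d → ℝ} {C μ : ℝ} {M : ℕ}
    (hc : Continuous F) (hgrow : ∀ x, F x ≤ C * (1 + ‖x‖ ^ 2) ^ M)
    (h1 : ∀ j x s, HasDerivAt (fun s : ℝ => F (x + s • basisVec j)) (D j (x + s • basisVec j)) s)
    (h2 : ∀ j x, HasDerivAt (fun s : ℝ => D j (x + s • basisVec j)) (D2 j x) 0)
    (hμ : (d : ℝ) * (4 * (M + 1 : ℝ) ^ 2) < μ) (heq : ∀ x, ∑ j, D2 j x = μ * F x) (x : Space d) :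
    F x ≤ 0 := by
  have hμ0 : 0 < μ := lt_of_le_of_lt (by positivity) hμ
  refine le_of_forall_pos_le_add fun δ hδ => ?_
  -- The barrier `ε (1 + |y|²)^(M+1)` outgrows `F`, so `F` minus the barrier attains its maximum.
  -- There `μ F = ΔF` is at most the Laplacian of the barrier, which is at most `4 d N²` times the
  -- barrier; since `μ` exceeds `4 d N²`, `F` lies below the barrier.
  set N : ℕ := M + 1 with hN
  have hane : ∀ y : Space d, 0 < 1 + ‖y‖ ^ 2 := fun y => by positivity
  have hone : ∀ y : Space d, 1 ≤ 1 + ‖y‖ ^ 2 := fun y => by nlinarith [sq_nonneg ‖y‖]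
  -- `ε` may depend on the given point `x`: the barrier has to be small only there.
  obtain ⟨ε, hε, hεδ⟩ : ∃ ε > 0, ε * (1 + ‖x‖ ^ 2) ^ N ≤ δ :=
    ⟨δ / (1 + ‖x‖ ^ 2) ^ N, by have := hane x; positivity,
      (div_mul_cancel₀ _ (pow_pos (hane x) N).ne').le⟩
  set k : Space d → ℝ := fun y => F y - ε * (1 + ‖y‖ ^ 2) ^ N with hk
  have hkc : Continuous k := hc.sub (by fun_prop)
  have hkC : ∀ y, k y ≤ (1 + ‖y‖ ^ 2) ^ M * (C - ε * (1 + ‖y‖ ^ 2)) := by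
    intro y
    have := hgrow y
    have hp : (1 + ‖y‖ ^ 2) ^ N = (1 + ‖y‖ ^ 2) ^ M * (1 + ‖y‖ ^ 2) := pow_succ _ _
    simp only [hk, hp]
    linarith
  obtain ⟨x₀, hx₀⟩ : ∃ x₀, ∀ y, k y ≤ k x₀ := by
    refine hkc.exists_forall_ge' 0 ?_
    have hev : ∀ᶠ y : Space d in Filter.cocompact (Space d), (|C| + |k 0|) / ε + 1 ≤ ‖y‖ :=
      (tendsto_norm_cocompact_atTop (E := Space d)).eventually_ge_atTop _
    filter_upwards [hev] with y hy
    have hq : 0 ≤ (|C| + |k 0|) / ε := by positivity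
    have hy1 : (|C| + |k 0|) / ε ≤ 1 + ‖y‖ ^ 2 := by nlinarith
    rw [div_le_iff₀ hε] at hy1
    have h3 : C - ε * (1 + ‖y‖ ^ 2) ≤ -|k 0| := by linarith [le_abs_self C]
    have hpow : 1 ≤ (1 + ‖y‖ ^ 2) ^ M := one_le_pow₀ (hone y)
    calc k y ≤ (1 + ‖y‖ ^ 2) ^ M * (C - ε * (1 + ‖y‖ ^ 2)) := hkC y
      _ ≤ (1 + ‖y‖ ^ 2) ^ M * (-|k 0|) := by gcongr
      _ ≤ -|k 0| := by nlinarith [abs_nonneg (k 0)]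
      _ ≤ k 0 := neg_abs_le _
  set a : ℝ := 1 + ‖x₀‖ ^ 2 with ha
  have ha1 : 1 ≤ a := hone x₀
  have hD2 : ∀ j, D2 j x₀ ≤ ε * (4 * (N : ℝ) ^ 2 * a ^ N) := by
    intro j
    have hp : ∀ s : ℝ, HasDerivAt (fun s : ℝ => 1 + ‖x₀ + s • basisVec j‖ ^ 2)
        (2 * x₀ j + 2 * s) s := by
      intro s
      simp_rw [norm_add_smul_basisVec_sq]
      have := (((hasDerivAt_id s).const_mul (2 * x₀ j)).add ((hasDerivAt_id s).pow 2)).const_add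
        (1 + ‖x₀‖ ^ 2)
      refine (this.congr_deriv ?_).congr_of_eventuallyEq (Filter.Eventually.of_forall fun r => ?_)
      · simp
      · simp
        ring
    have hb1 : ∀ s : ℝ, HasDerivAt (fun s : ℝ => k (x₀ + s • basisVec j))
        (D j (x₀ + s • basisVec j) -
          ε * (N * (1 + ‖x₀ + s • basisVec j‖ ^ 2) ^ M * (2 * x₀ j + 2 * s))) s := fun s =>
      (h1 j x₀ s).fun_sub (((hp s).fun_pow N).const_mul ε)
    have hlin : HasDerivAt (fun s : ℝ => 2 * x₀ j + 2 * s) 2 0 := by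
      simpa using ((hasDerivAt_id (0 : ℝ)).const_mul 2).const_add (2 * x₀ j)
    have hb2 := (h2 j x₀).fun_sub
      (((((hp 0).fun_pow M).const_mul (N : ℝ)).fun_mul hlin).const_mul ε)
    have hloc : IsLocalMax (fun s : ℝ => k (x₀ + s • basisVec j)) 0 :=
      Filter.Eventually.of_forall fun s => by simpa using hx₀ _
    have hle := nonpos_of_isLocalMax_of_hasDerivAt hb1 hb2 hloc
    simp only [zero_smul, add_zero, mul_zero] at hle
    rw [← ha] at hle
    have hxj : (x₀ j) ^ 2 ≤ a := by
      have := EuclideanSpace.norm_sq_eq x₀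
      have h4 : ‖x₀ j‖ ^ 2 ≤ ∑ i, ‖x₀ i‖ ^ 2 :=
        Finset.single_le_sum (f := fun i => ‖x₀ i‖ ^ 2) (fun i _ => sq_nonneg _)
          (Finset.mem_univ j)
      rw [Real.norm_eq_abs, sq_abs] at h4
      linarith
    have hbound : (N : ℝ) * ((M : ℝ) * a ^ (M - 1) * (2 * x₀ j)) * (2 * x₀ j) + N * a ^ M * 2 ≤
        4 * (N : ℝ) ^ 2 * a ^ N := by
      have hMN : (M : ℝ) + 1 = N := by rw [hN]; push_cast; ring
      have ha0 : 0 < a := by linarith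
      have e1 : (M : ℝ) * a ^ (M - 1) * (x₀ j) ^ 2 ≤ M * a ^ M := by
        -- For `M = 0` the truncated exponent `M - 1` is harmless, because the factor `M` vanishes.
        rcases Nat.eq_zero_or_pos M with h0 | h0
        · simp [h0]
        · have : a ^ M = a ^ (M - 1) * a := by rw [← pow_succ, Nat.sub_add_cancel h0]
          rw [this, ← mul_assoc]
          gcongr
      have e2 : a ^ M ≤ a ^ N := pow_le_pow_right₀ ha1 (Nat.le_succ M)
      have e3 : (0 : ℝ) ≤ N := Nat.cast_nonneg N
      have e4 : (0 : ℝ) < a ^ M := pow_pos ha0 M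
      calc _ = 4 * N * ((M : ℝ) * a ^ (M - 1) * (x₀ j) ^ 2) + 2 * N * a ^ M := by ring
        _ ≤ 4 * N * (M * a ^ M) + 4 * N * a ^ M := by
            have := mul_le_mul_of_nonneg_left e1 (show (0 : ℝ) ≤ 4 * N by positivity)
            nlinarith [mul_nonneg e3 e4.le]
        _ = 4 * (N : ℝ) ^ 2 * a ^ M := by rw [← hMN]; ring
        _ ≤ 4 * (N : ℝ) ^ 2 * a ^ N := by gcongr
    have := mul_le_mul_of_nonneg_left hbound hε.le
    linarith
  have hx₀' : F x₀ ≤ ε * a ^ N := by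
    have hsum : μ * F x₀ ≤ d * (ε * (4 * (N : ℝ) ^ 2 * a ^ N)) := by
      rw [← heq]
      refine (Finset.sum_le_sum fun j _ => hD2 j).trans ?_
      simp
    have h5 : d * (ε * (4 * (N : ℝ) ^ 2 * a ^ N)) ≤ μ * (ε * a ^ N) := by
      have : (d : ℝ) * (4 * (N : ℝ) ^ 2) ≤ μ := by rw [hN]; push_cast; exact hμ.le
      have h6 : 0 ≤ ε * a ^ N := by positivity
      nlinarith
    exact le_of_mul_le_mul_left (hsum.trans h5) hμ0
  have h7 : k x ≤ 0 := (hx₀ x).trans (by simp only [hk]; linarith)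
  simp only [hk] at h7
  linarith

theorem one_add_norm_sq_le (x y : Space d) :
    1 + ‖x‖ ^ 2 ≤ 2 * (1 + ‖x - y‖ ^ 2) * (1 + ‖y‖ ^ 2) := by
  have h : ‖x‖ ≤ ‖x - y‖ + ‖y‖ := by simpa using norm_add_le (x - y) y
  nlinarith [norm_nonneg x, norm_nonneg (x - y), norm_nonneg y, sq_nonneg (‖x - y‖ - ‖y‖),
    mul_nonneg (sq_nonneg ‖x - y‖) (sq_nonneg ‖y‖)]

/-- Peetre's inequality for the weights. -/
theorem weight_le (α : ℝ) (x y : Space d) :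
    weight α x ≤ 2 ^ |α| * weight |α| (x - y) * weight α y := by
  have hx : 0 < 1 + ‖x‖ ^ 2 := by positivity
  have hy : 0 < 1 + ‖y‖ ^ 2 := by positivity
  have hxy : 0 < 1 + ‖x - y‖ ^ 2 := by positivity
  rcases le_total 0 α with h | h
  · rw [abs_of_nonneg h, weight, weight, weight, ← Real.mul_rpow (by norm_num) hxy.le,
      ← Real.mul_rpow (by positivity) hy.le]
    exact Real.rpow_le_rpow hx.le (one_add_norm_sq_le x y) h
  -- For negative `α`, the elementary inequality is used with `x` and `y` exchanged and exponent
  -- `-α`, then inverted.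
  · have h1 : (1 + ‖y‖ ^ 2) ^ (-α) ≤
        2 ^ (-α) * (1 + ‖x - y‖ ^ 2) ^ (-α) * (1 + ‖x‖ ^ 2) ^ (-α) := by
      rw [← Real.mul_rpow (by norm_num) hxy.le, ← Real.mul_rpow (by positivity) hx.le]
      have := one_add_norm_sq_le y x
      rw [norm_sub_rev] at this
      exact Real.rpow_le_rpow hy.le this (by linarith)
    rw [abs_of_nonpos h, weight, weight, weight]
    rw [Real.rpow_neg hy.le, Real.rpow_neg hx.le] at h1
    have hxp := Real.rpow_pos_of_pos hx α
    have hyp := Real.rpow_pos_of_pos hy α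
    rw [inv_le_iff_one_le_mul₀ hyp] at h1
    have h2 := mul_le_mul_of_nonneg_left h1 hxp.le
    calc (1 + ‖x‖ ^ 2) ^ α = (1 + ‖x‖ ^ 2) ^ α * 1 := (mul_one _).symm
      _ ≤ _ := h2
      _ = _ := by field_simp

theorem inv_weight (α : ℝ) (x : Space d) : (weight α x)⁻¹ = weight (-α) x := by
  rw [weight, weight, Real.rpow_neg (by positivity)]

/-- `y ↦ ρ (x - y)`. -/
def reflect (x : Space d) (ρ : Space d → ℝ) (y : Space d) : ℝ := ρ (x - y)

theorem IsTest.reflect {ρ : Space d → ℝ} (hρ : IsTest ρ) (x : Space d) :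
    IsTest (reflect x ρ) :=
  ⟨hρ.1.comp (contDiff_const.sub contDiff_id),
    hρ.2.comp_homeomorph (Homeomorph.subLeft x)⟩

theorem pderiv_reflect {ρ : Space d → ℝ} (hρ : ContDiff ℝ ∞ ρ) (x : Space d) (j : Fin d) :
    pderiv j (reflect x ρ) = fun y => -reflect x (pderiv j ρ) y := by
  funext y
  have h1 : HasFDerivAt ρ (fderiv ℝ ρ (x - y)) (x - y) :=
    (hρ.differentiable (by simp)).differentiableAt.hasFDerivAt
  have h2 : HasFDerivAt (fun y : Space d => x - y) (-ContinuousLinearMap.id ℝ (Space d)) y :=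
    (hasFDerivAt_id y).const_sub x
  have h3 : fderiv ℝ (reflect x ρ) y = _ := (h1.comp y h2).fderiv
  rw [pderiv, h3]
  simp [reflect, pderiv]

theorem pderiv_pderiv_reflect {ρ : Space d → ℝ} (hρ : ContDiff ℝ ∞ ρ) (x : Space d)
    (j : Fin d) : pderiv j (pderiv j (reflect x ρ)) = reflect x (pderiv j (pderiv j ρ)) := by
  rw [pderiv_reflect hρ]
  funext y
  have h := congrFun (pderiv_reflect (contDiff_pderiv hρ j) x j) y
  rw [pderiv] at h ⊢
  rw [fderiv_fun_neg, neg_apply, h, neg_neg]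

/-- The mollification `x ↦ ∫ f(y) ρ(x - y) dy`. -/
def mollify (f : H0 d α) (ρ : Space d → ℝ) (x : Space d) : ℝ := ∫ y, f y * ρ (x - y)

theorem hasFDerivAt_mollify (f : H0 d α) {ρ : Space d → ℝ} (hρ : IsTest ρ) (x : Space d) :
    ∃ T : Space d →L[ℝ] ℝ, HasFDerivAt (mollify f ρ) T x ∧
      ∀ j, T (basisVec j) = mollify f (pderiv j ρ) x := by
  have hf := locallyIntegrable_of_memLp (Lp.memLp f)
  refine ⟨_, hρ.2.hasFDerivAt_convolution_right (ContinuousLinearMap.mul ℝ ℝ) hf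
    (hρ.1.of_le (by simp)) x, fun j => ?_⟩
  rw [convolution_precompR_apply _ hf (hρ.2.fderiv ℝ) (hρ.1.continuous_fderiv (by simp))]
  rfl

theorem continuous_mollify (f : H0 d α) {ρ : Space d → ℝ} (hρ : IsTest ρ) :
    Continuous (mollify f ρ) :=
  continuous_iff_continuousAt.2 fun x => (hasFDerivAt_mollify f hρ x).choose_spec.1.continuousAt

theorem hasDerivAt_mollify (f : H0 d α) {ρ : Space d → ℝ} (hρ : IsTest ρ) (j : Fin d)
    (x : Space d) (s : ℝ) : HasDerivAt (fun s : ℝ => mollify f ρ (x + s • basisVec j))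
      (mollify f (pderiv j ρ) (x + s • basisVec j)) s := by
  obtain ⟨T, hT, hTj⟩ := hasFDerivAt_mollify f hρ (x + s • basisVec j)
  have h1 : HasDerivAt (fun s : ℝ => x + s • basisVec j) (basisVec j : Space d) s := by
    simpa using ((hasDerivAt_id s).smul_const (basisVec j : Space d)).const_add x
  have := hT.comp_hasDerivAt s h1
  rw [hTj] at this
  exact this

theorem mollify_eq_inner (f : H0 d α) {ρ : Space d → ℝ} (hρ : IsTest ρ) (x : Space d) :
    mollify f ρ x = inner ℝ (testRep α (reflect x ρ)) f :=
  (inner_testRep (hρ.reflect x).1.continuous (hρ.reflect x).2 f).symm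

/-- Mollifications of elements of `H^{0,α}` grow at most polynomially. -/
theorem exists_mollify_le (f : H0 d α) {ρ : Space d → ℝ} (hρ : IsTest ρ) :
    ∃ C, ∀ x, |mollify f ρ x| ≤ C * (1 + ‖x‖ ^ 2) ^ ⌈|α|⌉₊ := by
  set I : ℝ := ∫ z, 2 ^ |α| * weight |α| z * ρ z ^ 2 with hI
  have hinteg : Integrable fun z : Space d => 2 ^ |α| * weight |α| z * ρ z ^ 2 := by
    refine Continuous.integrable_of_hasCompactSupport ?_ ?_
    · exact (continuous_const.mul (continuous_weight _)).mul (hρ.1.continuous.pow 2)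
    · have : HasCompactSupport fun z => ρ z ^ 2 :=
        hρ.2.comp_left (g := fun r : ℝ => r ^ 2) (by simp)
      exact this.mul_left
  have hI0 : 0 ≤ I := integral_nonneg fun z => by
    have := weight_pos |α| z
    positivity
  have hpow : ∀ x : Space d, weight (-α) x ≤ (1 + ‖x‖ ^ 2) ^ ⌈|α|⌉₊ := by
    intro x
    rw [← Real.rpow_natCast, weight]
    refine Real.rpow_le_rpow_of_exponent_le (by nlinarith [sq_nonneg ‖x‖]) ?_
    exact (neg_le_abs α).trans (Nat.le_ceil _)
  -- The squared norm is `∫ w(x - z)⁻¹ ρ(z)² dz`; Peetre's inequality extracts `w(x)⁻¹` and leaves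
  -- the integral `I` over the support of `ρ`.
  have hnorm : ∀ x, ‖testRep α (reflect x ρ)‖ ^ 2 ≤ I * (1 + ‖x‖ ^ 2) ^ ⌈|α|⌉₊ := by
    intro x
    have hr := hρ.reflect x
    have hm := memLp_div_weight (α := α) hr.1.continuous hr.2
    rw [← real_inner_self_eq_norm_sq, inner_testRep hr.1.continuous hr.2]
    have e1 : ∫ y, testRep α (reflect x ρ) y * reflect x ρ y =
        ∫ y, weight (-α) y * ρ (x - y) ^ 2 := by
      refine integral_congr_ae ?_
      rw [testRep, dif_pos hm]
      filter_upwards [fieldMeasure_ae hm.coeFn_toLp] with y hy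
      rw [hy, ← inv_weight, reflect]
      ring
    have e2 : ∫ y, weight (-α) y * ρ (x - y) ^ 2 = ∫ z, weight (-α) (x - z) * ρ z ^ 2 := by
      rw [← integral_sub_left_eq_self (fun y => weight (-α) y * ρ (x - y) ^ 2) volume x]
      simp
    rw [e1, e2]
    calc ∫ z, weight (-α) (x - z) * ρ z ^ 2
        ≤ ∫ z, (2 ^ |α| * weight |α| z * ρ z ^ 2) * weight (-α) x := by
          refine integral_mono_of_nonneg (Filter.Eventually.of_forall fun z => ?_)
            (hinteg.mul_const _) (Filter.Eventually.of_forall fun z => ?_)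
          · have := weight_pos (-α) (x - z)
            positivity
          · have h1 := weight_le (-α) (x - z) x
            have h2 : weight |α| (x - z - x) = weight |α| z := by
              simp [weight]
            rw [abs_neg, h2] at h1
            have := mul_le_mul_of_nonneg_right h1 (sq_nonneg (ρ z))
            simp only
            linarith
      _ = I * weight (-α) x := by rw [integral_mul_const]
      _ ≤ _ := by gcongr; exact hpow x
  refine ⟨(1 + I) * (1 + ‖f‖ ^ 2), fun x => ?_⟩
  have hp1 : 1 ≤ (1 + ‖x‖ ^ 2) ^ ⌈|α|⌉₊ := one_le_pow₀ (by nlinarith [sq_nonneg ‖x‖])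
  rw [mollify_eq_inner f hρ]
  calc _ ≤ ‖testRep α (reflect x ρ)‖ * ‖f‖ := abs_real_inner_le_norm _ _
    _ ≤ (1 + ‖testRep α (reflect x ρ)‖ ^ 2) * (1 + ‖f‖ ^ 2) := by
        gcongr
        · nlinarith [sq_nonneg (‖testRep α (reflect x ρ)‖ - 1)]
        · nlinarith [sq_nonneg (‖f‖ - 1)]
    _ ≤ ((1 + I) * (1 + ‖x‖ ^ 2) ^ ⌈|α|⌉₊) * (1 + ‖f‖ ^ 2) := by
        gcongr
        nlinarith [hnorm x]
    _ = _ := by ring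

/-- `Δψ = μψ` has no nonzero distributional solution in `H^{0,α}` when `μ` is large. -/
theorem eq_zero_of_isDistLaplacian {μ : ℝ} (hμ : (d : ℝ) * (4 * (⌈|α|⌉₊ + 1 : ℝ) ^ 2) < μ)
    {f : H0 d α} (hf : IsDistLaplacian f (μ • f)) : f = 0 := by
  -- Mollification turns the distributional equation into a pointwise one, with all derivatives
  -- falling on `ρ`. No sign of `ρ` is required, so `-ρ` yields the opposite inequality.
  have hnp : ∀ ρ : Space d → ℝ, IsTest ρ → ∀ x, mollify f ρ x ≤ 0 := by
    intro ρ hρ x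
    obtain ⟨C, hC⟩ := exists_mollify_le f hρ
    refine nonpos_of_laplacian_eq (D := fun j => mollify f (pderiv j ρ))
      (D2 := fun j => mollify f (pderiv j (pderiv j ρ))) (continuous_mollify f hρ)
      (fun y => (le_abs_self _).trans (hC y)) (fun j y s => hasDerivAt_mollify f hρ j y s)
      (fun j y => ?_) hμ (fun y => ?_) x
    · simpa using hasDerivAt_mollify f (hρ.pderiv j) j y 0
    · have h1 := hf _ (hρ.reflect y)
      rw [inner_smul_right, inner_testRep_laplacian (hρ.reflect y)] at h1
      rw [mollify_eq_inner f hρ, h1]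
      refine Finset.sum_congr rfl fun j _ => ?_
      rw [mollify_eq_inner f ((hρ.pderiv j).pderiv j), pderiv_pderiv_reflect hρ.1]
  have hz : ∀ ρ : Space d → ℝ, IsTest ρ → ∀ x, mollify f ρ x = 0 := by
    intro ρ hρ x
    refine le_antisymm (hnp ρ hρ x) ?_
    have hneg : IsTest fun y => -ρ y := ⟨hρ.1.neg, hρ.2.neg⟩
    have := hnp _ hneg x
    simp only [mollify, mul_neg, integral_neg] at this
    rw [mollify]
    linarith
  refine eq_zero_of_inner_testRep f fun φ hφ => ?_
  -- The pairing of `f` with `φ` is the mollification by the reflected `φ`, evaluated at `0`.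
  have h1 := hz _ (hφ.reflect 0) 0
  rw [mollify] at h1
  rw [inner_testRep hφ.1.continuous hφ.2, ← h1]
  simp [reflect]

/-- For fields in `H^{1,α}`, a distributional Laplacian in `H^{0,α}` is a variational one. -/
theorem IsDistLaplacian.isVarLaplacian {ψ : WithLp 2 (H0 d α × H0Vec d α)} (hψ : ψ ∈ H1 d α)
    {h : H0 d α} (hd : IsDistLaplacian ψ.fst h) : IsVarLaplacian ψ h := by
  -- Large enough for both Lax–Milgram and the maximum principle. The variational solution `χ` of
  -- `μχ - Δχ = μψ - h` then coincides with `ψ`, which inherits its identity.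
  set μ : ℝ := (1 + α ^ 2) + (d : ℝ) * (4 * (⌈|α|⌉₊ + 1 : ℝ) ^ 2) with hμ
  have hμ1 : 1 + α ^ 2 ≤ μ := le_add_of_nonneg_right (by positivity)
  have hμ2 : (d : ℝ) * (4 * (⌈|α|⌉₊ + 1 : ℝ) ^ 2) < μ := by rw [hμ]; nlinarith [sq_nonneg α]
  obtain ⟨χ, hχ, hv⟩ := exists_isVarLaplacian hμ1 (μ • ψ.fst - h)
  have hfst : χ.fst - ψ.fst = 0 := by
    refine eq_zero_of_isDistLaplacian hμ2 fun φ hφ => ?_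
    have h1 := hv.isDistLaplacian hχ φ hφ
    have h2 := hd φ hφ
    simp only [inner_sub_right, inner_smul_right] at h1 h2 ⊢
    linarith
  have hsnd : χ.snd - ψ.snd = 0 := eq_zero_of_mem_H1 ((H1 d α).sub_mem hχ hψ) hfst
  intro η hη
  have h1 := hv η hη
  rw [sub_eq_zero.1 hfst, sub_eq_zero.1 hsnd, sub_sub_cancel] at h1
  exact h1

end MaximumPrinciple

end FieldCrystal

end

/-! ### Schur's test, lattice sums and decay of the kernel. -/

noncomputable section

section Schur

variable {X Y : Type*} [MeasurableSpace X] [MeasurableSpace Y]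

/-- Cauchy–Schwarz with the splitting `K u = K^{1/2} · (K^{1/2} u)`. -/
theorem sq_lintegral_mul_le {ν : Measure Y} {K u : Y → ℝ≥0∞} (hK : Measurable K)
    (hu : Measurable u) :
    (∫⁻ y, K y * u y ∂ν) ^ 2 ≤ (∫⁻ y, K y ∂ν) * ∫⁻ y, K y * u y ^ 2 ∂ν := by
  have h := ENNReal.lintegral_mul_le_Lp_mul_Lq ν Real.HolderConjugate.two_two
    (f := fun y => K y ^ (1 / 2 : ℝ)) (g := fun y => K y ^ (1 / 2 : ℝ) * u y)
    (hK.pow_const _).aemeasurable ((hK.pow_const _).mul hu).aemeasurable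
  have hs : ∀ a : ℝ≥0∞, a ^ (1 / 2 : ℝ) * a ^ (1 / 2 : ℝ) = a := fun a => by
    rw [← ENNReal.rpow_add_of_nonneg _ _ (by norm_num) (by norm_num)]; norm_num
  have hs2 : ∀ a : ℝ≥0∞, (a ^ (1 / 2 : ℝ)) ^ 2 = a := fun a => by rw [pow_two, hs]
  have e1 : ∀ y, ((fun y => K y ^ (1 / 2 : ℝ)) * fun y => K y ^ (1 / 2 : ℝ) * u y) y =
      K y * u y := fun y => by
    simp only [Pi.mul_apply, ← mul_assoc, hs]
  simp only [e1, ENNReal.rpow_two, mul_pow, hs2] at h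
  calc (∫⁻ y, K y * u y ∂ν) ^ 2 ≤ _ := pow_le_pow_left' h 2
    _ = _ := by rw [mul_pow, hs2, hs2]

/-- Schur's test. -/
theorem lintegral_sq_lintegral_mul_le {μ : Measure X} {ν : Measure Y} [SFinite μ] [SFinite ν]
    {K : X → Y → ℝ≥0∞} (hK : Measurable (Function.uncurry K)) {u w : Y → ℝ≥0∞}
    (hu : Measurable u) {A B : ℝ≥0∞} (hBt : B ≠ ⊤) (hA : ∀ x, ∫⁻ y, K x y ∂ν ≤ A)
    (hB : ∀ y, ∫⁻ x, K x y ∂μ ≤ B * w y) :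
    ∫⁻ x, (∫⁻ y, K x y * u y ∂ν) ^ 2 ∂μ ≤ A * B * ∫⁻ y, w y * u y ^ 2 ∂ν := by
  have hKx : ∀ x, Measurable (K x) := fun x => hK.comp measurable_prodMk_left
  have hKy : ∀ y, Measurable fun x => K x y := fun y => hK.comp measurable_prodMk_right
  have hu2 : Measurable (Function.uncurry fun x y => K x y * u y ^ 2) :=
    hK.mul ((hu.comp measurable_snd).pow_const 2)
  calc ∫⁻ x, (∫⁻ y, K x y * u y ∂ν) ^ 2 ∂μ
      ≤ ∫⁻ x, A * ∫⁻ y, K x y * u y ^ 2 ∂ν ∂μ :=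
        lintegral_mono fun x => (sq_lintegral_mul_le (hKx x) hu).trans (by gcongr; exact hA x)
    _ = A * ∫⁻ x, ∫⁻ y, K x y * u y ^ 2 ∂ν ∂μ :=
        lintegral_const_mul _ hu2.lintegral_prod_right
    _ = A * ∫⁻ y, ∫⁻ x, K x y * u y ^ 2 ∂μ ∂ν := by
        rw [lintegral_lintegral_swap hu2.aemeasurable]
    _ ≤ A * ∫⁻ y, B * (w y * u y ^ 2) ∂ν := by
        gcongr with y
        rw [lintegral_mul_const _ (hKy y), ← mul_assoc]
        gcongr
        exact hB y
    _ = A * B * ∫⁻ y, w y * u y ^ 2 ∂ν := by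
        rw [mul_assoc, lintegral_const_mul' _ _ hBt]

theorem eLpNorm_two_sq {F : Type*} [NormedAddCommGroup F] {μ : Measure X} (f : X → F) :
    eLpNorm f 2 μ ^ 2 = ∫⁻ x, ‖f x‖ₑ ^ 2 ∂μ := by
  have := eLpNorm_nnreal_pow_eq_lintegral (f := f) (μ := μ) (p := 2) (by norm_num)
  simpa using this

/-- A transformation of functions that is linear and bounded on `L²` defines a bounded
operator. -/
theorem exists_clm_of_lintegral_le {F G : Type*} [NormedAddCommGroup F] [NormedSpace ℝ F]
    [NormedAddCommGroup G] [NormedSpace ℝ G] {μ : Measure X} {ν : Measure Y} (T : (X → F) → Y → G)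
    {c : ℝ≥0∞} (hc : c ≠ ⊤) (hm : ∀ f : Lp F 2 μ, AEStronglyMeasurable (T f) ν)
    (hb : ∀ f : Lp F 2 μ, ∫⁻ y, ‖T f y‖ₑ ^ 2 ∂ν ≤ c * ∫⁻ x, ‖f x‖ₑ ^ 2 ∂μ)
    (hadd : ∀ f g : Lp F 2 μ, T (f + g : Lp F 2 μ) =ᵐ[ν] fun y => T f y + T g y)
    (hsmul : ∀ (a : ℝ) (f : Lp F 2 μ), T (a • f : Lp F 2 μ) =ᵐ[ν] fun y => a • T f y) :
    ∃ L : Lp F 2 μ →L[ℝ] Lp G 2 ν, ∀ f, L f =ᵐ[ν] T f := by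
  -- The constant `c + 1` replaces the square root of `c`, using `c ≤ (c + 1)²`.
  have hle : ∀ f : Lp F 2 μ, eLpNorm (T f) 2 ν ≤ (c + 1) * eLpNorm f 2 μ := by
    intro f
    have h := hb f
    rw [← eLpNorm_two_sq, ← eLpNorm_two_sq] at h
    have h2 : eLpNorm (T f) 2 ν ^ 2 ≤ ((c + 1) * eLpNorm f 2 μ) ^ 2 := by
      refine h.trans ?_
      rw [mul_pow]
      gcongr
      calc c ≤ c + 1 := le_self_add
        _ ≤ (c + 1) ^ 2 := by
          rw [pow_two]
          exact le_mul_of_one_le_right zero_le le_add_self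
    exact (ENNReal.pow_le_pow_left_iff two_ne_zero).1 h2
  have hc1 : c + 1 ≠ ⊤ := ENNReal.add_ne_top.2 ⟨hc, ENNReal.one_ne_top⟩
  have hT : ∀ f : Lp F 2 μ, MemLp (T f) 2 ν := fun f =>
    ⟨hm f, (hle f).trans_lt (ENNReal.mul_lt_top hc1.lt_top (Lp.memLp f).2)⟩
  refine ⟨LinearMap.mkContinuous
    { toFun := fun f => (hT f).toLp
      map_add' := fun f g => ?_
      map_smul' := fun a f => ?_ } (c + 1).toReal fun f => ?_, fun f => (hT f).coeFn_toLp⟩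
  · ext1
    filter_upwards [(hT (f + g)).coeFn_toLp, (hT f).coeFn_toLp, (hT g).coeFn_toLp, hadd f g,
      Lp.coeFn_add (hT f).toLp (hT g).toLp] with y h1 h2 h3 h4 h5
    rw [h1, h5, Pi.add_apply, h2, h3, h4]
  · ext1
    filter_upwards [(hT (a • f)).coeFn_toLp, (hT f).coeFn_toLp, hsmul a f,
      Lp.coeFn_smul a (hT f).toLp] with y h1 h2 h4 h5
    rw [h1, RingHom.id_apply, h5, Pi.smul_apply, h2, h4]
  · change ‖(hT f).toLp‖ ≤ _
    rw [Lp.norm_toLp, Lp.norm_def, ← ENNReal.toReal_mul]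
    exact ENNReal.toReal_mono (ENNReal.mul_ne_top hc1 (Lp.memLp f).2.ne) (hle f)

end Schur

namespace FieldCrystal

section Lattice

variable {d n : ℕ} {α : ℝ}

theorem latticeMeasure_ae {p : Lattice d → Prop} (h : ∀ᵐ k ∂(latticeMeasure d α), p k)
    (k : Lattice d) : p k := by
  have hm : Measurable fun k : Lattice d => ENNReal.ofReal (weight α (toSpace k)) :=
    measurable_of_countable _
  have h' := (ae_withDensity_iff hm).1 h
  rw [Measure.ae_count_iff] at h'
  exact h' k (by simpa using weight_pos α (toSpace k))

theorem lintegral_latticeMeasure (f : Lattice d → ℝ≥0∞) :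
    ∫⁻ k, f k ∂(latticeMeasure d α) = ∑' k, ENNReal.ofReal (weight α (toSpace k)) * f k := by
  rw [latticeMeasure, lintegral_withDensity_eq_lintegral_mul _ (measurable_of_countable _)
    (measurable_of_countable _), lintegral_count]
  rfl

theorem lintegral_fieldMeasure {f : Space d → ℝ≥0∞} (hf : Measurable f) :
    ∫⁻ x, f x ∂(fieldMeasure d α) = ∫⁻ x, ENNReal.ofReal (weight α x) * f x := by
  rw [fieldMeasure, lintegral_withDensity_eq_lintegral_mul _ (measurable_ofReal_weight α) hf]
  rfl

theorem one_le_dist_toSpace {k l : Lattice d} (h : k ≠ l) : 1 ≤ dist (toSpace k) (toSpace l) := by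
  obtain ⟨j, hj⟩ := Function.ne_iff.1 h
  rw [dist_eq_norm]
  refine le_trans ?_ (PiLp.norm_apply_le (toSpace k - toSpace l) j)
  have h1 : (1 : ℤ) ≤ |k j - l j| := Int.one_le_abs (sub_ne_zero.2 hj)
  have h2 : (toSpace k - toSpace l) j = ((k j - l j : ℤ) : ℝ) := by simp [toSpace]
  rw [h2, Real.norm_eq_abs]
  exact_mod_cast h1

theorem integrable_weight : Integrable (weight (d := d) (-(d + 1 : ℝ))) := by
  have := integrable_rpow_neg_one_add_norm_sq (E := Space d) (μ := volume)
    (r := 2 * (d + 1 : ℝ)) (by simp; linarith [(Nat.cast_nonneg d : (0 : ℝ) ≤ d)])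
  convert this using 2
  rw [weight]
  congr 1
  ring

theorem lintegral_weight_sub (x : Space d) :
    ∫⁻ y, ENNReal.ofReal (weight (-(d + 1 : ℝ)) (x - y)) =
      ∫⁻ y, ENNReal.ofReal (weight (-(d + 1 : ℝ)) (y : Space d)) :=
  lintegral_sub_left_eq_self (fun y => ENNReal.ofReal (weight (-(d + 1 : ℝ)) y)) x

theorem lintegral_weight_ne_top :
    ∫⁻ y, ENNReal.ofReal (weight (-(d + 1 : ℝ)) (y : Space d)) ≠ ⊤ := by
  have := (integrable_weight (d := d)).2
  rw [hasFiniteIntegral_iff_ofReal (Filter.Eventually.of_forall fun x => (weight_pos _ x).le)]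
    at this
  exact this.ne

/-- Uniform summability over the lattice. -/
theorem exists_tsum_weight_le :
    ∃ A : ℝ≥0∞, A ≠ ⊤ ∧ ∀ x : Space d,
      ∑' k, ENNReal.ofReal (weight (-(d + 1 : ℝ)) (x - toSpace k)) ≤ A := by
  set s : ℝ := d + 1 with hs
  have hs0 : 0 ≤ s := by positivity
  set I := ∫⁻ y, ENNReal.ofReal (weight (-s) (y : Space d)) with hI
  set v : ℝ≥0∞ := volume (Metric.ball (0 : Space d) (1 / 2)) with hv
  have hv0 : v ≠ 0 := (Metric.measure_ball_pos _ _ (by norm_num)).ne'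
  have hvt : v ≠ ⊤ := measure_ball_lt_top.ne
  -- The sum is compared with the integral over the disjoint balls of radius `1/2` about lattice
  -- points. One factor `2 ^ s` comes from Peetre's inequality, the other from `1 + |y - k|² ≤ 2` on
  -- a ball.
  set c : ℝ := 2 ^ s * 2 ^ s with hc
  refine ⟨ENNReal.ofReal c * I / v, ENNReal.div_ne_top
    (ENNReal.mul_ne_top ENNReal.ofReal_ne_top lintegral_weight_ne_top) hv0, fun x => ?_⟩
  rw [ENNReal.le_div_iff_mul_le (Or.inl hv0) (Or.inl hvt), ← ENNReal.tsum_mul_right]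
  have hmeas : Measurable fun y : Space d => ENNReal.ofReal (weight (-s) (x - y)) :=
    (measurable_ofReal_weight (-s)).comp (measurable_const.sub measurable_id)
  have hterm : ∀ k : Lattice d, ENNReal.ofReal (weight (-s) (x - toSpace k)) * v ≤
      ENNReal.ofReal c * ∫⁻ y in Metric.ball (toSpace k) (1 / 2),
        ENNReal.ofReal (weight (-s) (x - y)) := by
    intro k
    rw [← lintegral_const_mul _ hmeas, hv, ← Measure.addHaar_ball_center volume (toSpace k),
      ← setLIntegral_const]
    refine setLIntegral_mono (hmeas.const_mul _) fun y hy => ?_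
    rw [← ENNReal.ofReal_mul (by positivity)]
    refine ENNReal.ofReal_le_ofReal ((weight_le (-s) (x - toSpace k) (x - y)).trans ?_)
    have h1 : weight |-s| (x - toSpace k - (x - y)) ≤ 2 ^ s := by
      rw [abs_neg, abs_of_nonneg hs0, weight]
      refine Real.rpow_le_rpow (by positivity) ?_ hs0
      have e : x - toSpace k - (x - y) = y - toSpace k := by abel
      rw [e, ← dist_eq_norm]
      have := Metric.mem_ball.1 hy
      nlinarith [dist_nonneg (x := y) (y := toSpace k)]
    rw [abs_neg, abs_of_nonneg hs0] at h1 ⊢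
    have := (weight_pos (-s) (x - y)).le
    rw [hc]
    gcongr
  calc ∑' k, ENNReal.ofReal (weight (-s) (x - toSpace k)) * v
      ≤ ∑' k, ENNReal.ofReal c * ∫⁻ y in Metric.ball (toSpace k) (1 / 2),
        ENNReal.ofReal (weight (-s) (x - y)) := ENNReal.tsum_le_tsum hterm
    _ = ENNReal.ofReal c * ∫⁻ y in ⋃ k : Lattice d, Metric.ball (toSpace k) (1 / 2),
        ENNReal.ofReal (weight (-s) (x - y)) := by
        rw [ENNReal.tsum_mul_left, lintegral_iUnion (fun k => measurableSet_ball)]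
        intro k l hkl
        refine Metric.ball_disjoint_ball ?_
        have := one_le_dist_toSpace hkl
        linarith
    _ ≤ ENNReal.ofReal c * ∫⁻ y, ENNReal.ofReal (weight (-s) (x - y)) := by
        gcongr
        exact Measure.restrict_le_self
    _ = ENNReal.ofReal c * I := by rw [lintegral_weight_sub]

/-- Exponential decay beats every weight. -/
theorem exists_decay {R : Space d → EuclideanSpace ℝ (Fin n)} (hR : ConditionR1 R) (p s : ℝ) :
    ∃ C : ℝ, 0 ≤ C ∧ ∀ z, ‖R z‖ * weight p z ≤ C * weight (-s) z := by
  obtain ⟨-, ε, hε, Rbar, hR⟩ := hR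
  set m : ℕ := ⌈max (p + s) 0⌉₊ with hm
  have hRbar : 0 ≤ Rbar := by
    have := (norm_nonneg _).trans (hR 0)
    simpa using this
  refine ⟨Rbar * ((2 * m).factorial * Real.exp ε / ε ^ (2 * m)), by positivity, fun z => ?_⟩
  have hz : 0 < 1 + ‖z‖ ^ 2 := by positivity
  have hsplit : weight p z = weight (p + s) z * weight (-s) z := by
    rw [weight, weight, weight, ← Real.rpow_add hz]
    congr 1
    ring
  have h1 : weight (p + s) z ≤ (1 + ‖z‖) ^ (2 * m) := by
    calc weight (p + s) z ≤ (1 + ‖z‖ ^ 2) ^ (m : ℝ) := by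
          refine Real.rpow_le_rpow_of_exponent_le (by nlinarith [sq_nonneg ‖z‖]) ?_
          exact (le_max_left _ _).trans (Nat.le_ceil _)
      _ = (1 + ‖z‖ ^ 2) ^ m := Real.rpow_natCast _ _
      _ ≤ ((1 + ‖z‖) ^ 2) ^ m := by
          gcongr
          nlinarith [norm_nonneg z]
      _ = (1 + ‖z‖) ^ (2 * m) := by rw [pow_mul]
  -- This is `t^(2m) ≤ (2m)! exp t` at `t = ε (1 + ‖z‖)`.
  have h2 : (1 + ‖z‖) ^ (2 * m) * Real.exp (-ε * ‖z‖) ≤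
      (2 * m).factorial * Real.exp ε / ε ^ (2 * m) := by
    have := Real.pow_div_factorial_le_exp (ε * (1 + ‖z‖)) (by positivity) (2 * m)
    rw [div_le_iff₀ (by positivity), mul_pow] at this
    rw [le_div_iff₀ (by positivity)]
    have e : Real.exp (ε * (1 + ‖z‖)) * Real.exp (-ε * ‖z‖) = Real.exp ε := by
      rw [← Real.exp_add]
      congr 1
      ring
    calc _ = (ε ^ (2 * m) * (1 + ‖z‖) ^ (2 * m)) * Real.exp (-ε * ‖z‖) := by ring
      _ ≤ (Real.exp (ε * (1 + ‖z‖)) * (2 * m).factorial) * Real.exp (-ε * ‖z‖) := by gcongr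
      _ = (2 * m).factorial * (Real.exp (ε * (1 + ‖z‖)) * Real.exp (-ε * ‖z‖)) := by ring
      _ = _ := by rw [e]
  have hw := (weight_pos (-s) z).le
  rw [hsplit, ← mul_assoc]
  refine mul_le_mul_of_nonneg_right ?_ hw
  calc ‖R z‖ * weight (p + s) z ≤ (Rbar * Real.exp (-ε * ‖z‖)) * (1 + ‖z‖) ^ (2 * m) := by
        gcongr
        · exact (weight_pos _ _).le
        · exact hR z
    _ = Rbar * ((1 + ‖z‖) ^ (2 * m) * Real.exp (-ε * ‖z‖)) := by ring
    _ ≤ _ := by gcongr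

end Lattice

end FieldCrystal

end

/-! ### Boundedness of the coupling operators and of the lattice Laplacian. -/

noncomputable section

namespace FieldCrystal

section Coupling

variable {d n : ℕ} {R : Space d → EuclideanSpace ℝ (Fin n)}

/-- The coupling kernel maps weights to weights. -/
theorem exists_kernel_le (hR : ConditionR1 R) (α : ℝ) : ∃ A : ℝ≥0∞, A ≠ ⊤ ∧
    (∀ k : Lattice d, ∫⁻ x, ENNReal.ofReal (weight α x) * ‖R (x - toSpace k)‖ₑ ≤
      A * ENNReal.ofReal (weight α (toSpace k))) ∧
    ∀ x : Space d, ∑' k, ENNReal.ofReal (weight α (toSpace k)) * ‖R (x - toSpace k)‖ₑ ≤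
      A * ENNReal.ofReal (weight α x) := by
  -- The exponent `|α|` pays for Peetre's factor; the remaining decay of exponent `d + 1` is both
  -- integrable and summable.
  obtain ⟨C, hC0, hC⟩ := exists_decay hR |α| (d + 1)
  obtain ⟨A, hA, hAx⟩ := exists_tsum_weight_le (d := d)
  set I := ∫⁻ y, ENNReal.ofReal (weight (-(d + 1 : ℝ)) (y : Space d)) with hI
  have hIt : I ≠ ⊤ := lintegral_weight_ne_top
  set c : ℝ := 2 ^ |α| * C with hc
  have hc0 : 0 ≤ c := by positivity
  have hneg : ∀ (β : ℝ) (z : Space d), weight β (-z) = weight β z := fun β z => by simp [weight]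
  -- One pointwise bound serves the integral and the sum: the weights are even, so the sign of `z`
  -- matters only inside `R`.
  have hpt : ∀ x y z : Space d, (x - y = z ∨ y - x = z) →
      ENNReal.ofReal (weight α x) * ‖R z‖ₑ ≤
        ENNReal.ofReal c * ENNReal.ofReal (weight (-(d + 1 : ℝ)) z) *
          ENNReal.ofReal (weight α y) := by
    intro x y z hz
    have hzw : weight |α| (x - y) = weight |α| z := by
      rcases hz with rfl | rfl
      · rfl
      · rw [← hneg, neg_sub]
    have h1 := weight_le α x y
    rw [hzw] at h1
    rw [← ofReal_norm, ← ENNReal.ofReal_mul (weight_pos α x).le,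
      ← ENNReal.ofReal_mul hc0, ← ENNReal.ofReal_mul (mul_nonneg hc0 (weight_pos _ _).le)]
    refine ENNReal.ofReal_le_ofReal ?_
    have hy := (weight_pos α y).le
    calc weight α x * ‖R z‖ ≤ (2 ^ |α| * weight |α| z * weight α y) * ‖R z‖ := by gcongr
      _ = 2 ^ |α| * (‖R z‖ * weight |α| z) * weight α y := by ring
      _ ≤ 2 ^ |α| * (C * weight (-(d + 1 : ℝ)) z) * weight α y := by
          exact mul_le_mul_of_nonneg_right (mul_le_mul_of_nonneg_left (hC z) (by positivity)) hy
      _ = _ := by rw [hc]; ring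
  refine ⟨ENNReal.ofReal c * (A + I), ENNReal.mul_ne_top ENNReal.ofReal_ne_top
    (ENNReal.add_ne_top.2 ⟨hA, hIt⟩), fun k => ?_, fun x => ?_⟩
  · calc _ ≤ ∫⁻ x, ENNReal.ofReal c * ENNReal.ofReal (weight (-(d + 1 : ℝ)) (x - toSpace k)) *
          ENNReal.ofReal (weight α (toSpace k)) :=
          lintegral_mono fun x => hpt x (toSpace k) _ (Or.inl rfl)
      _ = ENNReal.ofReal c * I * ENNReal.ofReal (weight α (toSpace k)) := by
          rw [lintegral_mul_const' _ _ ENNReal.ofReal_ne_top,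
            lintegral_const_mul' _ _ ENNReal.ofReal_ne_top,
            lintegral_sub_right_eq_self
              (fun x => ENNReal.ofReal (weight (-(d + 1 : ℝ)) x)) (toSpace k)]
      _ ≤ _ := by
          gcongr
          exact le_add_self
  · calc _ ≤ ∑' k, ENNReal.ofReal c * ENNReal.ofReal (weight (-(d + 1 : ℝ)) (x - toSpace k)) *
          ENNReal.ofReal (weight α x) :=
          ENNReal.tsum_le_tsum fun k => hpt (toSpace k) x _ (Or.inr rfl)
      _ ≤ ENNReal.ofReal c * A * ENNReal.ofReal (weight α x) := by
          rw [ENNReal.tsum_mul_right, ENNReal.tsum_mul_left]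
          gcongr
          exact hAx x
      _ ≤ _ := by
          gcongr
          exact le_self_add

theorem exists_kernel_le_const (hR : ConditionR1 R) : ∃ A : ℝ≥0∞, A ≠ ⊤ ∧
    (∀ k : Lattice d, ∫⁻ x, ‖R (x - toSpace k)‖ₑ ≤ A) ∧
    ∀ x : Space d, ∑' k, ‖R (x - toSpace k)‖ₑ ≤ A := by
  simpa [weight] using exists_kernel_le hR 0

theorem measurable_kernel (hR : ConditionR1 R) :
    Measurable (Function.uncurry fun (x : Space d) (k : Lattice d) => ‖R (x - toSpace k)‖ₑ) := by
  have h1 : Measurable fun p : Space d × Lattice d => p.1 - toSpace p.2 :=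
    measurable_fst.sub ((measurable_of_countable toSpace).comp measurable_snd)
  exact (hR.1.continuous.measurable.comp h1).enorm

theorem measurable_kernel_swap (hR : ConditionR1 R) :
    Measurable (Function.uncurry fun (k : Lattice d) (x : Space d) => ‖R (x - toSpace k)‖ₑ) := by
  have h1 : Measurable fun p : Lattice d × Space d => p.2 - toSpace p.1 :=
    measurable_snd.sub ((measurable_of_countable toSpace).comp measurable_fst)
  exact (hR.1.continuous.measurable.comp h1).enorm

theorem measurable_kernel_left (hR : ConditionR1 R) (k : Lattice d) :
    Measurable fun x : Space d => ‖R (x - toSpace k)‖ₑ :=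
  (hR.1.continuous.measurable.comp (measurable_id.sub_const _)).enorm

/-- Schur's test from counting measure to the weighted field measure. The weight produced by the
column bound turns the right side into the norm of `L^α`. -/
theorem exists_lintegral_tsum_kernel_le (hR : ConditionR1 R) (α : ℝ) : ∃ c : ℝ≥0∞, c ≠ ⊤ ∧
    ∀ u : LatticeSpace d n α,
      ∫⁻ x, (∑' k, ‖R (x - toSpace k)‖ₑ * ‖u k‖ₑ) ^ 2 ∂(fieldMeasure d α) ≤
        c * ∫⁻ k, ‖u k‖ₑ ^ 2 ∂(latticeMeasure d α) := by
  obtain ⟨A, hA, -, hA2⟩ := exists_kernel_le_const hR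
  obtain ⟨B, hB, hB1, -⟩ := exists_kernel_le hR α
  refine ⟨A * B, ENNReal.mul_ne_top hA hB, fun u => ?_⟩
  have hA' : ∀ x : Space d, ∫⁻ k, ‖R (x - toSpace k)‖ₑ ∂Measure.count ≤ A := fun x => by
    rw [lintegral_count]
    exact hA2 x
  have hB' : ∀ k : Lattice d, ∫⁻ x, ‖R (x - toSpace k)‖ₑ ∂(fieldMeasure d α) ≤
      B * ENNReal.ofReal (weight α (toSpace k)) := fun k => by
    rw [lintegral_fieldMeasure (measurable_kernel_left hR k)]
    exact hB1 k
  have hu : Measurable fun k => ‖u k‖ₑ := measurable_of_countable _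
  have h := lintegral_sq_lintegral_mul_le (μ := fieldMeasure d α) (ν := Measure.count)
    (measurable_kernel hR) hu hB hA' hB'
  rw [lintegral_latticeMeasure]
  simp only [lintegral_count] at h
  exact h

/-- The transposed estimate, from Lebesgue measure to the weighted lattice measure. -/
theorem exists_lintegral_lintegral_kernel_le (hR : ConditionR1 R) (α : ℝ) :
    ∃ c : ℝ≥0∞, c ≠ ⊤ ∧ ∀ f : H0 d α,
      ∫⁻ k, (∫⁻ x, ‖R (x - toSpace k)‖ₑ * ‖f x‖ₑ) ^ 2 ∂(latticeMeasure d α) ≤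
        c * ∫⁻ x, ‖f x‖ₑ ^ 2 ∂(fieldMeasure d α) := by
  obtain ⟨A, hA, hA1, -⟩ := exists_kernel_le_const hR
  obtain ⟨B, hB, -, hB2⟩ := exists_kernel_le hR α
  refine ⟨A * B, ENNReal.mul_ne_top hA hB, fun f => ?_⟩
  have hf : Measurable fun x => ‖f x‖ₑ := (Lp.stronglyMeasurable f).enorm
  have hB' : ∀ x : Space d, ∫⁻ k, ‖R (x - toSpace k)‖ₑ ∂(latticeMeasure d α) ≤
      B * ENNReal.ofReal (weight α x) := fun x => by
    rw [lintegral_latticeMeasure]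
    exact hB2 x
  have h := lintegral_sq_lintegral_mul_le (μ := latticeMeasure d α) (ν := volume)
    (measurable_kernel_swap hR) hf hB hA1 hB'
  rw [lintegral_fieldMeasure (hf.pow_const 2)]
  exact h

/-- The sum defining `S u` converges absolutely almost everywhere. -/
theorem ae_summable_coupling (hR : ConditionR1 R) {α : ℝ} (u : LatticeSpace d n α) :
    ∀ᵐ x ∂(fieldMeasure d α), Summable fun k => inner ℝ (R (x - toSpace k)) (u k) := by
  obtain ⟨c, hc, hb⟩ := exists_lintegral_tsum_kernel_le hR α
  have hm : Measurable fun x : Space d => (∑' k, ‖R (x - toSpace k)‖ₑ * ‖u k‖ₑ) ^ 2 :=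
    (Measurable.tsum fun k =>
      (measurable_kernel_left hR k).mul_const _).pow_const 2
  have hfin : ∫⁻ k, ‖u k‖ₑ ^ 2 ∂(latticeMeasure d α) ≠ ⊤ := by
    rw [← eLpNorm_two_sq]
    exact ENNReal.pow_ne_top (Lp.memLp u).2.ne
  filter_upwards [ae_lt_top hm ((hb u).trans_lt
    (ENNReal.mul_lt_top hc.lt_top hfin.lt_top)).ne] with x hx
  have hx' : ∑' k, ‖R (x - toSpace k)‖ₑ * ‖u k‖ₑ ≠ ⊤ := fun h => by simp [h] at hx
  refine Summable.of_enorm (ne_top_of_le_ne_top hx' (ENNReal.tsum_le_tsum fun k => ?_))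
  rw [← ofReal_norm, ← ofReal_norm, ← ofReal_norm,
    ← ENNReal.ofReal_mul (norm_nonneg _)]
  exact ENNReal.ofReal_le_ofReal (norm_inner_le_norm _ _)

theorem lattice_coeFn_add {α : ℝ} (u v : LatticeSpace d n α) (k : Lattice d) :
    (u + v : LatticeSpace d n α) k = u k + v k := latticeMeasure_ae (Lp.coeFn_add u v) k

theorem lattice_coeFn_smul {α : ℝ} (a : ℝ) (u : LatticeSpace d n α) (k : Lattice d) :
    (a • u : LatticeSpace d n α) k = a • u k := latticeMeasure_ae (Lp.coeFn_smul a u) k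

theorem lattice_coeFn_sub {α : ℝ} (u v : LatticeSpace d n α) (k : Lattice d) :
    (u - v : LatticeSpace d n α) k = u k - v k := latticeMeasure_ae (Lp.coeFn_sub u v) k

theorem lattice_coeFn_zero {α : ℝ} (k : Lattice d) : (0 : LatticeSpace d n α) k = 0 :=
  latticeMeasure_ae (Lp.coeFn_zero _ 2 _) k

theorem lattice_ext {α : ℝ} {u v : LatticeSpace d n α} (h : ∀ k, u k = v k) : u = v :=
  Lp.ext (Filter.Eventually.of_forall h)

/-- `S` is bounded from `L^α` to `H^{0,α}`. -/
theorem exists_couplingS (hR : ConditionR1 R) (α : ℝ) :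
    ∃ S : LatticeSpace d n α →L[ℝ] H0 d α, ∀ u, ∀ᵐ x, S u x = couplingS R u x := by
  obtain ⟨c, hc, hb⟩ := exists_lintegral_tsum_kernel_le hR α
  suffices h : ∃ S : LatticeSpace d n α →L[ℝ] H0 d α, ∀ u, S u =ᵐ[fieldMeasure d α]
      couplingS R u from h.imp fun S hS u => fieldMeasure_ae (hS u)
  refine exists_clm_of_lintegral_le (μ := latticeMeasure d α) (ν := fieldMeasure d α)
    (couplingS R) hc (fun u => ?_) (fun u => ?_) (fun u v => ?_) (fun a u => ?_)
  · refine aestronglyMeasurable_of_tendsto_ae (Filter.atTop : Filter (Finset (Lattice d)))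
      (f := fun s x => ∑ k ∈ s, inner ℝ (R (x - toSpace k)) (u k)) (fun s => ?_) ?_
    · have : Continuous fun x : Space d => ∑ k ∈ s, inner ℝ (R (x - toSpace k)) (u k) :=
        continuous_finsetSum _ fun k _ =>
          (hR.1.continuous.comp (continuous_id.sub continuous_const)).inner continuous_const
      exact this.aestronglyMeasurable
    · filter_upwards [ae_summable_coupling hR u] with x hx
      exact hx.hasSum
  · refine (lintegral_mono fun x => ?_).trans (hb u)
    gcongr
    refine enorm_tsum_le_tsum_enorm.trans (ENNReal.tsum_le_tsum fun k => ?_)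
    rw [← ofReal_norm, ← ofReal_norm, ← ofReal_norm,
      ← ENNReal.ofReal_mul (norm_nonneg _)]
    exact ENNReal.ofReal_le_ofReal (norm_inner_le_norm _ _)
  · filter_upwards [ae_summable_coupling hR u, ae_summable_coupling hR v] with x hu hv
    simp only [couplingS, lattice_coeFn_add, inner_add_right]
    exact hu.tsum_add hv
  · refine Filter.Eventually.of_forall fun x => ?_
    simp only [couplingS, lattice_coeFn_smul, inner_smul_right, smul_eq_mul]
    exact tsum_mul_left

/-- `S^*` is bounded from `H^{0,α}` to `L^α`. -/
theorem exists_couplingSAdj (hR : ConditionR1 R) (α : ℝ) :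
    ∃ S : H0 d α →L[ℝ] LatticeSpace d n α, ∀ f k, S f k = couplingSAdj R f k := by
  obtain ⟨c, hc, hb⟩ := exists_lintegral_lintegral_kernel_le hR α
  have hen : ∀ (f : H0 d α) (k : Lattice d) (x : Space d),
      ‖f x • R (x - toSpace k)‖ₑ = ‖R (x - toSpace k)‖ₑ * ‖f x‖ₑ := fun f k x => by
    rw [enorm_smul, mul_comm]
  have hinteg : ∀ (f : H0 d α) (k : Lattice d),
      Integrable fun x => f x • R (x - toSpace k) := by
    intro f k
    refine ⟨(Lp.stronglyMeasurable f).aestronglyMeasurable.smul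
      (hR.1.continuous.comp (continuous_id.sub continuous_const)).aestronglyMeasurable, ?_⟩
    have hfin : ∫⁻ x, ‖f x‖ₑ ^ 2 ∂(fieldMeasure d α) ≠ ⊤ := by
      rw [← eLpNorm_two_sq]
      exact ENNReal.pow_ne_top (Lp.memLp f).2.ne
    have h1 := ae_lt_top (measurable_of_countable _)
      ((hb f).trans_lt (ENNReal.mul_lt_top hc.lt_top hfin.lt_top)).ne
    have h2 := latticeMeasure_ae h1 k
    rw [HasFiniteIntegral]
    simp_rw [hen]
    by_contra hcon
    rw [not_lt, top_le_iff] at hcon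
    simp [hcon] at h2
  suffices h : ∃ S : H0 d α →L[ℝ] LatticeSpace d n α, ∀ f, S f =ᵐ[latticeMeasure d α]
      couplingSAdj R f from h.imp fun S hS f => latticeMeasure_ae (hS f)
  refine exists_clm_of_lintegral_le (μ := fieldMeasure d α) (ν := latticeMeasure d α)
    (couplingSAdj R) hc (fun f => ?_) (fun f => ?_) (fun f g => ?_) (fun a f => ?_)
  · exact (measurable_of_countable _).aestronglyMeasurable
  · refine (lintegral_mono fun k => ?_).trans (hb f)
    gcongr
    refine (enorm_integral_le_lintegral_enorm _).trans_eq ?_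
    simp_rw [hen]
  · refine Filter.Eventually.of_forall fun k => ?_
    simp only [couplingSAdj]
    rw [← integral_add (hinteg f k) (hinteg g k)]
    refine integral_congr_ae ?_
    filter_upwards [fieldMeasure_ae (Lp.coeFn_add f g)] with x hx
    rw [hx, Pi.add_apply, add_smul]
  · refine Filter.Eventually.of_forall fun k => ?_
    simp only [couplingSAdj]
    rw [← integral_smul]
    refine integral_congr_ae ?_
    filter_upwards [fieldMeasure_ae (Lp.coeFn_smul a f)] with x hx
    rw [hx, Pi.smul_apply, smul_assoc]

theorem exists_shift (α : ℝ) (e : Lattice d) :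
    ∃ T : LatticeSpace d n α →L[ℝ] LatticeSpace d n α, ∀ u k, T u k = u (k + e) := by
  have hadd : ∀ k l : Lattice d, toSpace k - toSpace (k + l) = -toSpace l := fun k l => by
    ext j; simp [toSpace]
  suffices h : ∃ T : LatticeSpace d n α →L[ℝ] LatticeSpace d n α, ∀ u,
      T u =ᵐ[latticeMeasure d α] fun k => u (k + e) from
    h.imp fun T hT u => latticeMeasure_ae (hT u)
  refine exists_clm_of_lintegral_le (μ := latticeMeasure d α)
    (ν := latticeMeasure d α)
    (fun (u : Lattice d → EuclideanSpace ℝ (Fin n)) (k : Lattice d) => u (k + e))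
    (c := ENNReal.ofReal (2 ^ |α| * weight |α| (-toSpace e))) ENNReal.ofReal_ne_top
    (fun u => (measurable_of_countable _).aestronglyMeasurable) (fun u => ?_)
    (fun u v => Filter.Eventually.of_forall fun k => lattice_coeFn_add u v _)
    (fun a u => Filter.Eventually.of_forall fun k => lattice_coeFn_smul a u _)
  · rw [lintegral_latticeMeasure, lintegral_latticeMeasure, ← ENNReal.tsum_mul_left,
      ← (Equiv.addRight e).tsum_eq (fun k : Lattice d =>
        ENNReal.ofReal (2 ^ |α| * weight |α| (-toSpace e)) *
          (ENNReal.ofReal (weight α (toSpace k)) * ‖u k‖ₑ ^ 2))]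
    refine ENNReal.tsum_le_tsum fun k => ?_
    rw [← mul_assoc, Equiv.coe_addRight]
    gcongr
    have h0 := (weight_pos |α| (-toSpace e)).le
    rw [← ENNReal.ofReal_mul (by positivity)]
    refine ENNReal.ofReal_le_ofReal ?_
    have := weight_le α (toSpace k) (toSpace (k + e))
    rwa [hadd] at this

/-- The discrete Laplacian is bounded on `L^α`. -/
theorem exists_latticeLaplacian (α : ℝ) :
    ∃ T : LatticeSpace d n α →L[ℝ] LatticeSpace d n α, ∀ u k, T u k = latticeLaplacian u k := by
  choose T hT using exists_shift (d := d) (n := n) α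
  have hsum : ∀ (s : Finset (Fin d)) (u : Fin d → LatticeSpace d n α) (k : Lattice d),
      (∑ j ∈ s, u j : LatticeSpace d n α) k = ∑ j ∈ s, u j k := by
    classical
    intro s u k
    induction s using Finset.induction_on with
    | empty => exact lattice_coeFn_zero k
    | insert j s hj ih => rw [Finset.sum_insert hj, Finset.sum_insert hj, lattice_coeFn_add, ih]
  refine ⟨∑ j, ((T (Pi.single j 1) - 1) + (T (-Pi.single j 1) - 1)), fun u k => ?_⟩
  rw [sum_apply, hsum]
  refine Finset.sum_congr rfl fun j _ => ?_
  change ((T (Pi.single j 1) u - u) + (T (-Pi.single j 1) u - u) : LatticeSpace d n α) k = _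
  rw [lattice_coeFn_add, lattice_coeFn_sub, lattice_coeFn_sub, hT, hT, ← sub_eq_add_neg]

end Coupling

end FieldCrystal

end

/-! ### The free wave system generates a group on the phase space. -/

noncomputable section

section Perturbation

variable {E : Type*} [NormedAddCommGroup E] [InnerProductSpace ℝ E]

/-- The weak equations of a perturbed generator. -/
def perturbEqs (L : Set ((E →L[ℝ] ℝ) × (E →L[ℝ] ℝ))) (B : E →L[ℝ] E) :
    Set ((E →L[ℝ] ℝ) × (E →L[ℝ] ℝ)) :=
  Set.image (fun l => (l.1, l.2 + l.1.comp B)) L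

theorem weakGraph_perturbEqs (L : Set ((E →L[ℝ] ℝ) × (E →L[ℝ] ℝ))) (B : E →L[ℝ] E) :
    weakGraph (perturbEqs L B) = perturb (weakGraph L) B := by
  ext p
  change (∀ l ∈ perturbEqs L B, l.1 p.2 = l.2 p.1) ↔ ∀ l ∈ L, l.1 (p.2 - B p.1) = l.2 p.1
  rw [perturbEqs, Set.forall_mem_image]
  refine forall₂_congr fun l _ => ?_
  simp only [add_apply, ContinuousLinearMap.comp_apply, map_sub]
  rw [sub_eq_iff_eq_add]

theorem isWeakFlow_perturbEqs {L : Set ((E →L[ℝ] ℝ) × (E →L[ℝ] ℝ))} {B : E →L[ℝ] E}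
    {Y : ℝ → E} : IsWeakFlow (perturbEqs L B) Y ↔ ∀ l ∈ L, ∀ t,
      HasDerivAt (fun s => l.1 (Y s)) (l.2 (Y t) + l.1 (B (Y t))) t :=
  Set.forall_mem_image

end Perturbation

namespace FieldCrystal

section System

variable {d n : ℕ} {α : ℝ}

theorem exists_latticeEval (k : Lattice d) :
    ∃ T : LatticeSpace d n α →L[ℝ] EuclideanSpace ℝ (Fin n), ∀ u, T u = u k := by
  have hw := weight_pos α (toSpace k)
  refine ⟨LinearMap.mkContinuous
    { toFun := fun u => u k
      map_add' := fun u v => lattice_coeFn_add u v k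
      map_smul' := fun a u => lattice_coeFn_smul a u k } (√(weight α (toSpace k)))⁻¹
      fun u => ?_, fun u => rfl⟩
  change ‖u k‖ ≤ _
  have h1 : ENNReal.ofReal (weight α (toSpace k)) * ‖u k‖ₑ ^ 2 ≤
      eLpNorm u 2 (latticeMeasure d α) ^ 2 := by
    rw [eLpNorm_two_sq, lintegral_latticeMeasure]
    exact ENNReal.le_tsum k
  have h2 := ENNReal.toReal_mono (ENNReal.pow_ne_top (Lp.memLp u).2.ne) h1
  rw [ENNReal.toReal_mul, ENNReal.toReal_ofReal hw.le, ENNReal.toReal_pow, ENNReal.toReal_pow,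
    toReal_enorm, ← Lp.norm_def] at h2
  have hs := Real.sqrt_pos.2 hw
  rw [inv_mul_eq_div, le_div_iff₀ hs]
  refine abs_le_of_sq_le_sq' ?_ (norm_nonneg u) |>.2
  rw [mul_pow, Real.sq_sqrt hw.le, mul_comm]
  exact h2

/-- Evaluation at a lattice point. -/
def latticeEval (k : Lattice d) : LatticeSpace d n α →L[ℝ] EuclideanSpace ℝ (Fin n) :=
  (exists_latticeEval k).choose

theorem latticeEval_apply (k : Lattice d) (u : LatticeSpace d n α) : latticeEval k u = u k :=
  (exists_latticeEval k).choose_spec u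

local instance instNormedAddCommGroupPhaseSpace : NormedAddCommGroup (PhaseSpace d n α) :=
  inferInstance

local instance instInnerProductSpacePhaseSpace : InnerProductSpace ℝ (PhaseSpace d n α) :=
  inferInstance

local instance instNormedSpacePhaseSpace : NormedSpace ℝ (PhaseSpace d n α) := inferInstance

/-- The field component, without its gradient. -/
def fieldL : PhaseSpace d n α →L[ℝ] H0 d α :=
  (WithLp.fstL 2 ℝ (H0 d α) (H0Vec d α)).comp ((H1 d α).subtypeL.comp
    ((WithLp.fstL 2 ℝ (H1 d α) (LatticeSpace d n α)).comp (WithLp.fstL 2 ℝ _ _)))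

/-- The displacement component. -/
def dispL : PhaseSpace d n α →L[ℝ] LatticeSpace d n α :=
  (WithLp.sndL 2 ℝ (H1 d α) (LatticeSpace d n α)).comp (WithLp.fstL 2 ℝ _ _)

/-- The momentum component. -/
def momL : PhaseSpace d n α →L[ℝ] H0 d α :=
  (WithLp.fstL 2 ℝ (H0 d α) (LatticeSpace d n α)).comp (WithLp.sndL 2 ℝ _ _)

/-- The velocity component. -/
def velL : PhaseSpace d n α →L[ℝ] LatticeSpace d n α :=
  (WithLp.sndL 2 ℝ (H0 d α) (LatticeSpace d n α)).comp (WithLp.sndL 2 ℝ _ _)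

/-- The weak equations of the free wave system `ψ' = π`, `u' = 0`, `π' = Δψ`, `v' = 0`. -/
def freeEqs (d n : ℕ) (α : ℝ) :
    Set ((PhaseSpace d n α →L[ℝ] ℝ) × (PhaseSpace d n α →L[ℝ] ℝ)) :=
  {l | (∃ φ : Space d → ℝ, IsTest φ ∧ l = ((innerSL ℝ (testRep α φ)).comp fieldL,
      (innerSL ℝ (testRep α φ)).comp momL)) ∨
    (∃ (k : Lattice d) (a : EuclideanSpace ℝ (Fin n)),
      l = ((innerSL ℝ a).comp ((latticeEval k).comp dispL), 0)) ∨
    (∃ φ : Space d → ℝ, IsTest φ ∧ l = ((innerSL ℝ (testRep α φ)).comp momL,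
      (innerSL ℝ (testRep α (Δ φ))).comp fieldL)) ∨
    (∃ (k : Lattice d) (a : EuclideanSpace ℝ (Fin n)),
      l = ((innerSL ℝ a).comp ((latticeEval k).comp velL), 0))}

theorem forall_freeEqs {P : (PhaseSpace d n α →L[ℝ] ℝ) → (PhaseSpace d n α →L[ℝ] ℝ) → Prop} :
    (∀ l ∈ freeEqs d n α, P l.1 l.2) ↔
      (∀ φ : Space d → ℝ, IsTest φ → P ((innerSL ℝ (testRep α φ)).comp fieldL)
        ((innerSL ℝ (testRep α φ)).comp momL)) ∧
      (∀ (k : Lattice d) (a : EuclideanSpace ℝ (Fin n)),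
        P ((innerSL ℝ a).comp ((latticeEval k).comp dispL)) 0) ∧
      (∀ φ : Space d → ℝ, IsTest φ → P ((innerSL ℝ (testRep α φ)).comp momL)
        ((innerSL ℝ (testRep α (Δ φ))).comp fieldL)) ∧
      ∀ (k : Lattice d) (a : EuclideanSpace ℝ (Fin n)),
        P ((innerSL ℝ a).comp ((latticeEval k).comp velL)) 0 := by
  constructor
  · intro h
    exact ⟨fun φ hφ => h _ (Or.inl ⟨φ, hφ, rfl⟩), fun k a => h _ (Or.inr (Or.inl ⟨k, a, rfl⟩)),
      fun φ hφ => h _ (Or.inr (Or.inr (Or.inl ⟨φ, hφ, rfl⟩))),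
      fun k a => h _ (Or.inr (Or.inr (Or.inr ⟨k, a, rfl⟩)))⟩
  · rintro ⟨h1, h2, h3, h4⟩ l (⟨φ, hφ, rfl⟩ | ⟨k, a, rfl⟩ | ⟨φ, hφ, rfl⟩ | ⟨k, a, rfl⟩)
    exacts [h1 φ hφ, h2 k a, h3 φ hφ, h4 k a]

theorem eq_zero_of_inner_latticeEval {u : LatticeSpace d n α}
    (h : ∀ (k : Lattice d) (a : EuclideanSpace ℝ (Fin n)), inner ℝ a (latticeEval k u) = 0) :
    u = 0 :=
  lattice_ext fun k => by
    rw [lattice_coeFn_zero, ← latticeEval_apply]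
    exact inner_self_eq_zero.1 (h k _)

/-- Test functions and lattice evaluations separate points, so the weak equations recover the graph
of the wave operator with its maximal domain. -/
theorem mem_weakGraph_freeEqs (p : PhaseSpace d n α × PhaseSpace d n α) :
    p ∈ weakGraph (freeEqs d n α) ↔ fieldL p.2 = momL p.1 ∧ dispL p.2 = 0 ∧
      IsDistLaplacian (fieldL p.1) (momL p.2) ∧ velL p.2 = 0 := by
  refine (forall_freeEqs (P := fun l l' => l p.2 = l' p.1)).trans ?_
  refine and_congr ⟨fun h => ?_, fun h φ _ => ?_⟩ (and_congr ⟨fun h => ?_, fun h k a => ?_⟩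
    (and_congr Iff.rfl ⟨fun h => ?_, fun h k a => ?_⟩))
  · refine sub_eq_zero.1 (eq_zero_of_inner_testRep _ fun φ hφ => ?_)
    have h1 : inner ℝ (testRep α φ) (fieldL p.2) = inner ℝ (testRep α φ) (momL p.1) := h φ hφ
    rw [inner_sub_right, h1, sub_self]
  · change inner ℝ _ (fieldL p.2) = inner ℝ _ (momL p.1)
    rw [h]
  · exact eq_zero_of_inner_latticeEval h
  · change inner ℝ a (latticeEval k (dispL p.2)) = 0
    simp [h]
  · exact eq_zero_of_inner_latticeEval h
  · change inner ℝ a (latticeEval k (velL p.2)) = 0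
    simp [h]

theorem norm_sq_phaseSpace (Y : PhaseSpace d n α) : ‖Y‖ ^ 2 =
    ‖fieldL Y‖ ^ 2 + ‖(Y.fst.fst : WithLp 2 (H0 d α × H0Vec d α)).snd‖ ^ 2 + ‖dispL Y‖ ^ 2 +
      (‖momL Y‖ ^ 2 + ‖velL Y‖ ^ 2) := by
  have h : ‖Y.fst.fst‖ ^ 2 = _ :=
    WithLp.prod_norm_sq_eq_of_L2 (Y.fst.fst : WithLp 2 (H0 d α × H0Vec d α))
  rw [WithLp.prod_norm_sq_eq_of_L2 Y, WithLp.prod_norm_sq_eq_of_L2 Y.fst,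
    WithLp.prod_norm_sq_eq_of_L2 Y.snd, h]
  rfl

/-- The norm also contains the gradient of the field, but that is determined by the field. -/
theorem eq_zero_of_components {Y : PhaseSpace d n α} (h1 : fieldL Y = 0) (h2 : dispL Y = 0)
    (h3 : momL Y = 0) (h4 : velL Y = 0) : Y = 0 := by
  have h5 : (Y.fst.fst : WithLp 2 (H0 d α × H0Vec d α)).snd = 0 :=
    eq_zero_of_mem_H1 Y.fst.fst.2 h1
  have := norm_sq_phaseSpace Y
  simp only [h1, h2, h3, h4, h5, norm_zero] at this
  exact norm_eq_zero.1 (by nlinarith [norm_nonneg Y])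

theorem phaseSpace_ext {Y Z : PhaseSpace d n α} (h1 : fieldL Y = fieldL Z)
    (h2 : dispL Y = dispL Z) (h3 : momL Y = momL Z) (h4 : velL Y = velL Z) : Y = Z := by
  refine sub_eq_zero.1 (eq_zero_of_components ?_ ?_ ?_ ?_) <;> rw [map_sub, sub_eq_zero] <;>
    assumption

/-- The phase-space vector with given components. -/
def mkPhase (ψ : H1 d α) (u : LatticeSpace d n α) (π : H0 d α) (v : LatticeSpace d n α) :
    PhaseSpace d n α := WithLp.toLp 2 (WithLp.toLp 2 (ψ, u), WithLp.toLp 2 (π, v))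

theorem fieldL_mkPhase (ψ : H1 d α) (u : LatticeSpace d n α) (π : H0 d α)
    (v : LatticeSpace d n α) :
    fieldL (mkPhase ψ u π v) = (ψ : WithLp 2 (H0 d α × H0Vec d α)).fst := rfl

theorem dispL_mkPhase (ψ : H1 d α) (u : LatticeSpace d n α) (π : H0 d α)
    (v : LatticeSpace d n α) : dispL (mkPhase ψ u π v) = u := rfl

theorem momL_mkPhase (ψ : H1 d α) (u : LatticeSpace d n α) (π : H0 d α)
    (v : LatticeSpace d n α) : momL (mkPhase ψ u π v) = π := rfl

theorem velL_mkPhase (ψ : H1 d α) (u : LatticeSpace d n α) (π : H0 d α)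
    (v : LatticeSpace d n α) : velL (mkPhase ψ u π v) = v := rfl

/-- Eliminating `π = lam ψ - f` from `lam π - Δψ = g` leaves `lam² ψ - Δψ = lam f + g`; the
threshold ensures `lam² ≥ 1 + α²`. -/
theorem free_surj {lam : ℝ} (hlam : 1 + |α| < |lam|) (z : PhaseSpace d n α) :
    ∃ p ∈ weakGraph (freeEqs d n α), lam • p.1 - p.2 = z := by
  have hlam0 : lam ≠ 0 := by
    rintro rfl
    rw [abs_zero] at hlam
    linarith [abs_nonneg α]
  have hsq : 1 + α ^ 2 ≤ lam ^ 2 := by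
    rw [← sq_abs lam, ← sq_abs α]
    nlinarith [abs_nonneg α]
  obtain ⟨ψ, hψ, hv⟩ := exists_isVarLaplacian hsq (lam • fieldL z + momL z)
  have hd := hv.isDistLaplacian hψ
  have hfield : ((lam • (⟨ψ, hψ⟩ : H1 d α) - z.fst.fst : H1 d α) :
      WithLp 2 (H0 d α × H0Vec d α)).fst = lam • ψ.fst - fieldL z := rfl
  refine ⟨(mkPhase ⟨ψ, hψ⟩ (lam⁻¹ • dispL z) (lam • ψ.fst - fieldL z) (lam⁻¹ • velL z),
    mkPhase (lam • (⟨ψ, hψ⟩ : H1 d α) - z.fst.fst) 0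
      (lam ^ 2 • ψ.fst - (lam • fieldL z + momL z)) 0), ?_, ?_⟩
  · rw [mem_weakGraph_freeEqs]
    simp only [fieldL_mkPhase, dispL_mkPhase, momL_mkPhase, velL_mkPhase, hfield, true_and,
      and_true]
    exact hd
  · refine phaseSpace_ext ?_ ?_ ?_ ?_ <;>
      simp only [map_sub, map_smul, fieldL_mkPhase, dispL_mkPhase, momL_mkPhase, velL_mkPhase,
        hfield, sub_zero, smul_inv_smul₀ hlam0]
    · abel
    · module

/-- The free wave system generates a group. -/
theorem isGroupGenerator_free :
    IsGroupGenerator (weakGraph (freeEqs d n α)) (1 + |α|) where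
  abs_inner_le := by
    intro p hp
    obtain ⟨h1, h2, h3, h4⟩ := (mem_weakGraph_freeEqs p).1 hp
    set ψ : WithLp 2 (H0 d α × H0Vec d α) := (p.1.fst.fst : WithLp 2 (H0 d α × H0Vec d α)) with hψ
    set χ : WithLp 2 (H0 d α × H0Vec d α) := (p.2.fst.fst : WithLp 2 (H0 d α × H0Vec d α)) with hχ
    -- The competitor `χ` is the field part of the image, that is, `π` with its gradient. The
    -- identity cancels `⟨∇π, ∇ψ⟩` against `⟨Δψ, π⟩`, up to the drift term.
    have hvar := IsDistLaplacian.isVarLaplacian (ψ := ψ) p.1.fst.fst.2 h3 χ p.2.fst.fst.2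
    have hχf : χ.fst = momL p.1 := h1
    have hin : inner ℝ p.2 p.1 = inner ℝ χ.fst ψ.fst + inner ℝ χ.snd ψ.snd +
        inner ℝ (dispL p.2) (dispL p.1) + (inner ℝ (momL p.2) (momL p.1) +
          inner ℝ (velL p.2) (velL p.1)) := by
      rw [WithLp.prod_inner_apply, WithLp.prod_inner_apply, WithLp.prod_inner_apply,
        Submodule.coe_inner, WithLp.prod_inner_apply]
      rfl
    rw [hχf] at hvar hin
    rw [h2, h4, inner_zero_left, inner_zero_left, real_inner_comm ψ.snd χ.snd] at hin
    have hval : inner ℝ p.2 p.1 = inner ℝ (momL p.1) ψ.fst -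
        inner ℝ (drift d α ψ.snd) (momL p.1) := by
      linarith
    have hn := norm_sq_phaseSpace p.1
    have e1 := abs_real_inner_le_norm (momL p.1) ψ.fst
    have e2 : |inner ℝ (drift d α ψ.snd) (momL p.1)| ≤ |α| * (‖ψ.snd‖ * ‖momL p.1‖) := by
      refine (abs_real_inner_le_norm _ _).trans ?_
      rw [← mul_assoc]
      gcongr
      exact norm_drift_le _
    have e3 : ‖momL p.1‖ * ‖ψ.fst‖ ≤ ‖p.1‖ ^ 2 := by
      change ‖p.1‖ ^ 2 = ‖ψ.fst‖ ^ 2 + _ + _ + _ at hn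
      nlinarith [sq_nonneg (‖momL p.1‖ - ‖ψ.fst‖), sq_nonneg ‖ψ.snd‖, sq_nonneg ‖dispL p.1‖,
        sq_nonneg ‖velL p.1‖, sq_nonneg ‖momL p.1‖, sq_nonneg ‖ψ.fst‖]
    have e4 : ‖ψ.snd‖ * ‖momL p.1‖ ≤ ‖p.1‖ ^ 2 := by
      nlinarith [sq_nonneg (‖momL p.1‖ - ‖ψ.snd‖), sq_nonneg ‖ψ.snd‖, sq_nonneg ‖dispL p.1‖,
        sq_nonneg ‖velL p.1‖, sq_nonneg ‖momL p.1‖, sq_nonneg ‖fieldL p.1‖]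
    rw [hval]
    calc _ ≤ |inner ℝ (momL p.1) ψ.fst| + |inner ℝ (drift d α ψ.snd) (momL p.1)| := abs_sub _ _
      _ ≤ ‖p.1‖ ^ 2 + |α| * ‖p.1‖ ^ 2 :=
          add_le_add (e1.trans e3) (e2.trans (by gcongr))
      _ = _ := by ring
  surj := ⟨1 + |α|, fun lam hlam z => free_surj hlam z⟩
  eq_zero := by
    intro y hy
    obtain ⟨h1, h2, h3, h4⟩ := (mem_weakGraph_freeEqs _).1 hy
    simp only [map_zero] at h1 h3
    refine eq_zero_of_components h1 h2 (eq_zero_of_inner_testRep _ fun φ hφ => ?_) h4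
    rw [h3 φ hφ, inner_zero_right]

end System

end FieldCrystal

end

/-! ### The Cauchy problem as weak equations, and its well-posedness. -/

noncomputable section

/-- Splits the vector-valued lattice equations into scalar ones, the form a weak flow requires. -/
theorem hasDerivAt_iff_forall_inner {ι : Type*} [Fintype ι] {f : ℝ → EuclideanSpace ℝ ι}
    {f' : EuclideanSpace ℝ ι} {t : ℝ} :
    HasDerivAt f f' t ↔ ∀ a, HasDerivAt (fun s => inner ℝ a (f s)) (inner ℝ a f') t := by
  classical
  refine ⟨fun h a => (innerSL ℝ a).hasFDerivAt.comp_hasDerivAt t h, fun h => ?_⟩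
  let b := EuclideanSpace.basisFun ι ℝ
  have h1 : HasDerivAt (fun s => ∑ i, inner ℝ (b i) (f s) • b i) (∑ i, inner ℝ (b i) f' • b i) t :=
    HasDerivAt.fun_sum fun i _ => (h (b i)).smul_const (b i)
  simpa only [b.sum_repr'] using h1

/-- The map into an `L²` product with given components. -/
def prodToLp {E F G : Type*} [NormedAddCommGroup E] [NormedSpace ℝ E] [NormedAddCommGroup F]
    [NormedSpace ℝ F] [NormedAddCommGroup G] [NormedSpace ℝ G] (f : E →L[ℝ] F) (g : E →L[ℝ] G) :
    E →L[ℝ] WithLp 2 (F × G) :=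
  (WithLp.prodContinuousLinearEquiv 2 ℝ F G).symm.toContinuousLinearMap.comp (f.prod g)

namespace FieldCrystal

section Cauchy

variable {d n : ℕ} {α : ℝ}

attribute [local instance] instNormedAddCommGroupPhaseSpace instInnerProductSpacePhaseSpace
  instNormedSpacePhaseSpace

/-- The bounded part of the generator,
`(ψ, u, π, v) ↦ (0, v, -m₀² ψ - S u, Δ_L u - ν₀² u - S^* ψ)`. -/
def boundedPart (m₀ ν₀ : ℝ) (S : LatticeSpace d n α →L[ℝ] H0 d α)
    (S' : H0 d α →L[ℝ] LatticeSpace d n α) (D : LatticeSpace d n α →L[ℝ] LatticeSpace d n α) :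
    PhaseSpace d n α →L[ℝ] PhaseSpace d n α :=
  prodToLp (prodToLp (0 : PhaseSpace d n α →L[ℝ] H1 d α) velL)
    (prodToLp (-(m₀ ^ 2 • fieldL) - S.comp dispL)
      (D.comp dispL - ν₀ ^ 2 • dispL - S'.comp fieldL))

variable {m₀ ν₀ : ℝ} {S : LatticeSpace d n α →L[ℝ] H0 d α}
    {S' : H0 d α →L[ℝ] LatticeSpace d n α} {D : LatticeSpace d n α →L[ℝ] LatticeSpace d n α}

theorem fieldL_boundedPart (Y : PhaseSpace d n α) : fieldL (boundedPart m₀ ν₀ S S' D Y) = 0 := rfl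

theorem dispL_boundedPart (Y : PhaseSpace d n α) :
    dispL (boundedPart m₀ ν₀ S S' D Y) = velL Y := rfl

theorem momL_boundedPart (Y : PhaseSpace d n α) :
    momL (boundedPart m₀ ν₀ S S' D Y) = -(m₀ ^ 2 • fieldL Y) - S (dispL Y) := rfl

theorem velL_boundedPart (Y : PhaseSpace d n α) :
    velL (boundedPart m₀ ν₀ S S' D Y) =
      D (dispL Y) - ν₀ ^ 2 • dispL Y - S' (fieldL Y) := rfl

theorem inner_testRep_momL_boundedPart {R : Space d → EuclideanSpace ℝ (Fin n)}
    (hS : ∀ u, ∀ᵐ x, S u x = couplingS R u x) {φ : Space d → ℝ} (hφ : IsTest φ)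
    (Y : PhaseSpace d n α) :
    inner ℝ (testRep α (Δ φ)) (fieldL Y) +
        inner ℝ (testRep α φ) (momL (boundedPart m₀ ν₀ S S' D Y)) =
      (∫ x, fieldOf Y x * (Δ φ x - m₀ ^ 2 * φ x)) - ∫ x, couplingS R (dispOf Y) x * φ x := by
  have e1 : ∫ x, fieldOf Y x * (Δ φ x - m₀ ^ 2 * φ x) =
      inner ℝ (testRep α (Δ φ)) (fieldL Y) - m₀ ^ 2 * inner ℝ (testRep α φ) (fieldL Y) := by
    rw [inner_testRep (continuous_laplacian hφ) (hasCompactSupport_laplacian hφ),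
      inner_testRep hφ.1.continuous hφ.2, ← integral_const_mul, ← integral_sub]
    · refine integral_congr_ae (Filter.Eventually.of_forall fun x => ?_)
      change fieldOf Y x * (Δ φ x - m₀ ^ 2 * φ x) =
        fieldOf Y x * Δ φ x - m₀ ^ 2 * (fieldOf Y x * φ x)
      ring
    · exact integrable_mul_of_compact (Lp.memLp (fieldL Y)) (continuous_laplacian hφ)
        (hasCompactSupport_laplacian hφ)
    · exact (integrable_mul_of_compact (Lp.memLp (fieldL Y)) hφ.1.continuous hφ.2).const_mul _
  have e2 : ∫ x, couplingS R (dispOf Y) x * φ x = inner ℝ (testRep α φ) (S (dispL Y)) := by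
    rw [inner_testRep hφ.1.continuous hφ.2]
    refine integral_congr_ae ?_
    filter_upwards [hS (dispL Y)] with x hx
    rw [hx]
    rfl
  rw [momL_boundedPart, inner_sub_right, inner_neg_right, inner_smul_right, e1, e2]
  ring

theorem latticeEval_velL_boundedPart {R : Space d → EuclideanSpace ℝ (Fin n)}
    (hS' : ∀ f k, S' f k = couplingSAdj R f k) (hD : ∀ u k, D u k = latticeLaplacian u k)
    (k : Lattice d) (Y : PhaseSpace d n α) :
    latticeEval k (velL (boundedPart m₀ ν₀ S S' D Y)) =
      latticeLaplacian (dispOf Y) k - ν₀ ^ 2 • dispOf Y k - couplingSAdj R (fieldOf Y) k := by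
  rw [velL_boundedPart, map_sub, map_sub, map_smul, latticeEval_apply, latticeEval_apply,
    latticeEval_apply, hD, hS']
  rfl

/-- The Cauchy problem as a family of weak evolution equations. -/
theorem isSolution_iff {R : Space d → EuclideanSpace ℝ (Fin n)}
    (hS : ∀ u, ∀ᵐ x, S u x = couplingS R u x) (hS' : ∀ f k, S' f k = couplingSAdj R f k)
    (hD : ∀ u k, D u k = latticeLaplacian u k) {Y₀ : PhaseSpace d n α}
    {Y : ℝ → PhaseSpace d n α} :
    IsSolution R m₀ ν₀ Y₀ Y ↔ Y 0 = Y₀ ∧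
      IsWeakFlow (perturbEqs (freeEqs d n α) (boundedPart m₀ ν₀ S S' D)) Y := by
  set B := boundedPart m₀ ν₀ S S' D with hB
  rw [isWeakFlow_perturbEqs, forall_freeEqs (P := fun l l' => ∀ t,
    HasDerivAt (fun s => l (Y s)) (l' (Y t) + l (B (Y t))) t)]
  have hfield : ∀ φ : Space d → ℝ, IsTest φ → ∀ t,
      (HasDerivAt (fun s => ∫ x, fieldOf (Y s) x * φ x) (∫ x, momOf (Y t) x * φ x) t ↔
        HasDerivAt (fun s => inner ℝ (testRep α φ) (fieldL (Y s)))
          (inner ℝ (testRep α φ) (momL (Y t)) + inner ℝ (testRep α φ) (fieldL (B (Y t)))) t) := by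
    intro φ hφ t
    simp_rw [inner_testRep hφ.1.continuous hφ.2 (fieldL (Y _)), hB, fieldL_boundedPart,
      inner_zero_right, add_zero, inner_testRep hφ.1.continuous hφ.2]
    rfl
  have hmom : ∀ φ : Space d → ℝ, IsTest φ → ∀ t,
      (HasDerivAt (fun s => ∫ x, momOf (Y s) x * φ x)
        ((∫ x, fieldOf (Y t) x * (Δ φ x - m₀ ^ 2 * φ x)) -
          ∫ x, couplingS R (dispOf (Y t)) x * φ x) t ↔
        HasDerivAt (fun s => inner ℝ (testRep α φ) (momL (Y s)))
          (inner ℝ (testRep α (Δ φ)) (fieldL (Y t)) +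
            inner ℝ (testRep α φ) (momL (B (Y t)))) t) := by
    intro φ hφ t
    rw [hB, inner_testRep_momL_boundedPart hS hφ]
    simp_rw [inner_testRep hφ.1.continuous hφ.2]
    rfl
  have hdisp : ∀ (k : Lattice d) (t : ℝ),
      (HasDerivAt (fun s => dispOf (Y s) k) (velOf (Y t) k) t ↔ ∀ a,
        HasDerivAt (fun s => inner ℝ a (latticeEval k (dispL (Y s))))
          (0 + inner ℝ a (latticeEval k (dispL (B (Y t))))) t) := by
    intro k t
    simp_rw [zero_add]
    rw [← hasDerivAt_iff_forall_inner, hB, dispL_boundedPart]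
    simp_rw [latticeEval_apply]
    rfl
  have hvel : ∀ (k : Lattice d) (t : ℝ),
      (HasDerivAt (fun s => velOf (Y s) k) (latticeLaplacian (dispOf (Y t)) k -
        ν₀ ^ 2 • dispOf (Y t) k - couplingSAdj R (fieldOf (Y t)) k) t ↔ ∀ a,
        HasDerivAt (fun s => inner ℝ a (latticeEval k (velL (Y s))))
          (0 + inner ℝ a (latticeEval k (velL (B (Y t))))) t) := by
    intro k t
    simp_rw [zero_add]
    rw [← hasDerivAt_iff_forall_inner, hB, latticeEval_velL_boundedPart hS' hD]
    simp_rw [latticeEval_apply]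
    rfl
  constructor
  · intro h
    exact ⟨h.initial, fun φ hφ t => (hfield φ hφ t).1 (h.field_eq φ hφ t),
      fun k a t => (hdisp k t).1 (h.disp_eq k t) a,
      fun φ hφ t => (hmom φ hφ t).1 (h.mom_eq φ hφ t),
      fun k a t => (hvel k t).1 (h.vel_eq k t) a⟩
  · rintro ⟨h0, h1, h2, h3, h4⟩
    exact ⟨h0, fun φ hφ t => (hfield φ hφ t).2 (h1 φ hφ t),
      fun k t => (hdisp k t).2 fun a => h2 k a t,
      fun φ hφ t => (hmom φ hφ t).2 (h3 φ hφ t), fun k t => (hvel k t).2 fun a => h4 k a t⟩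

/-- Under R1 the Cauchy problem is a family of weak evolution equations governed by a group
generator. -/
theorem exists_isGroupGenerator {R : Space d → EuclideanSpace ℝ (Fin n)} (hR : ConditionR1 R)
    (α m₀ ν₀ : ℝ) : ∃ (L : Set ((PhaseSpace d n α →L[ℝ] ℝ) × (PhaseSpace d n α →L[ℝ] ℝ))) (c : ℝ),
      IsGroupGenerator (weakGraph L) c ∧ ∀ Y₀ Y, IsSolution R m₀ ν₀ Y₀ Y ↔
        Y 0 = Y₀ ∧ IsWeakFlow L Y := by
  obtain ⟨S, hS⟩ := exists_couplingS hR α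
  obtain ⟨S', hS'⟩ := exists_couplingSAdj hR α
  obtain ⟨D, hD⟩ := exists_latticeLaplacian (d := d) (n := n) α
  have hgen := isGroupGenerator_free.perturb (boundedPart m₀ ν₀ S S' D)
  rw [← weakGraph_perturbEqs] at hgen
  exact ⟨_, _, hgen, fun Y₀ Y => isSolution_iff hS hS' hD⟩

end Cauchy

end FieldCrystal

/-- Well-posedness of weak evolution equations governed by a group generator: unique solvability,
and a bound for every solution operator. -/
theorem IsGroupGenerator.wellPosed {E : Type*} [NormedAddCommGroup E] [InnerProductSpace ℝ E]
    [CompleteSpace E] {L : Set ((E →L[ℝ] ℝ) × (E →L[ℝ] ℝ))} {c : ℝ}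
    (h : IsGroupGenerator (weakGraph L) c) :
    (∀ x, ∃! Y : C(ℝ, E), Y 0 = x ∧ IsWeakFlow L Y) ∧
    ∀ W : ℝ → E → E,
      (∀ x, Continuous (fun t => W t x) ∧ W 0 x = x ∧ IsWeakFlow L fun t => W t x) →
      (∀ t, Continuous (W t)) ∧ ∀ t x, ‖W t x‖ ≤ Real.exp (c * |t|) * ‖x‖ := by
  have huniq : ∀ Y Z : ℝ → E, Continuous Y → Continuous Z → Y 0 = Z 0 → IsWeakFlow L Y →
      IsWeakFlow L Z → ∀ t, Y t = Z t := fun Y Z hY hZ h0 hYw hZw t =>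
    sub_eq_zero.1 (h.eq_zero_of_isWeakFlow (hY.sub hZ) (sub_eq_zero.2 h0) (hYw.sub hZw) t)
  constructor
  · intro x
    obtain ⟨Y, hYc, hY0, hYw, -⟩ := h.exists_isWeakFlow x
    exact ⟨⟨Y, hYc⟩, ⟨hY0, hYw⟩, fun Z hZ => ContinuousMap.ext fun t =>
      huniq Z Y Z.continuous hYc (hZ.1.trans hY0.symm) hZ.2 hYw t⟩
  · intro W hW
    have hbound : ∀ t x, ‖W t x‖ ≤ Real.exp (c * |t|) * ‖x‖ := by
      intro t x
      obtain ⟨Y, hYc, hY0, hYw, hYb⟩ := h.exists_isWeakFlow x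
      have := huniq (fun t => W t x) Y (hW x).1 hYc ((hW x).2.1.trans hY0.symm) (hW x).2.2 hYw t
      rw [this]
      exact hYb t
    refine ⟨fun t => ?_, hbound⟩
    -- Linearity of `W t` is not assumed; uniqueness supplies it, and the growth bound becomes a
    -- Lipschitz bound.
    have hsub : ∀ x y, W t x - W t y = W t (x - y) := fun x y =>
      huniq (fun t => W t x - W t y) (fun t => W t (x - y)) ((hW x).1.sub (hW y).1)
        (hW (x - y)).1 (by simp only [(hW _).2.1]) ((hW x).2.2.sub (hW y).2.2) (hW (x - y)).2.2 t
    refine (LipschitzWith.of_dist_le_mul (K := ⟨Real.exp (c * |t|), (Real.exp_pos _).le⟩)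
      fun x y => ?_).continuous
    rw [dist_eq_norm, dist_eq_norm, hsub]
    exact hbound t (x - y)

end

theorem propositionp1p1 (d n : ℕ) (α : ℝ) (hα : α < -(d : ℝ) / 2)
    (m₀ ν₀ : ℝ) (hm₀ : 0 < m₀) (hν₀ : 0 < ν₀)
    (R : FieldCrystal.Space d → EuclideanSpace ℝ (Fin n))
    (hR1 : FieldCrystal.ConditionR1 R) (hR2 : FieldCrystal.ConditionR2 R m₀ ν₀) :
    (∀ Y₀ : FieldCrystal.PhaseSpace d n α,
      ∃! Y : C(ℝ, FieldCrystal.PhaseSpace d n α), FieldCrystal.IsSolution R m₀ ν₀ Y₀ Y) ∧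
    ∀ W : ℝ → FieldCrystal.PhaseSpace d n α → FieldCrystal.PhaseSpace d n α,
      (∀ Y₀, Continuous (fun t => W t Y₀) ∧
        FieldCrystal.IsSolution R m₀ ν₀ Y₀ (fun t => W t Y₀)) →
      (∀ t, Continuous (W t)) ∧
      ((∃ a : ℤ, Even a ∧ a ≤ -2 ∧ α = a) →
        ∀ T > 0, ∃ C : ℝ, ∀ Y₀, ∀ t, |t| ≤ T → ‖W t Y₀‖ ≤ C * ‖Y₀‖) := by
  obtain ⟨L, c, hgen, hsol⟩ := FieldCrystal.exists_isGroupGenerator hR1 α m₀ ν₀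
  obtain ⟨hex, hW⟩ := hgen.wellPosed
  simp only [hsol]
  refine ⟨hex, fun W hWs => ?_⟩
  obtain ⟨hc, hb⟩ := hW W hWs
  -- The sign of `c` is not recorded, so `|c|` makes the exponent monotone in `|t| ≤ T`.
  refine ⟨hc, fun _ T _ => ⟨Real.exp (|c| * T), fun Y₀ t ht => (hb t Y₀).trans ?_⟩⟩
  gcongr
  exact le_abs_self c
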